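/- Let $S\subset\mathbb R^3$ be a smooth ($C^\infty$) surface. A line has at least $k$-point contact with $S$ at $q\in S$ if a regular local equation of $S$ at $q$, restricted to the line, vanishes to order at least $k$ at $q$; a line with at least $3$-point contact is called asymptotic. The parabolic curve $P$ is the set of points with exactly one asymptotic line; the flecnodal curve $F$ is the set of points at which some line has at least $4$-point contact; the conodal curve $D$ at a point $g$ is the germ at $g$ of the closure of the locus of points of contact of $S\cap U$ with planes tangent to $S\cap U$ at two distinct points at least, $U$ being any sufficiently small neighbourhood of $g$. A godron is a point $g\in P$ at which $P$ is a smooth curve tangent to the asymptotic line; it is simple if the tangential map $\tau_S$ (point $\mapsto$ tangent plane) at $g$ is, up to diffeomorphism germs of source and target, the standard swallowtail, i.e. if the dual surface has a swallowtail at $\tau_S(g)$. Let $g$ be a simple godron of $S$. Then $F,P,D$ are, near $g$, regular smooth curves tangent to the asymptotic line at $g$. The curves of contact elements of $S$ tangent to $F$, to $P$, to $D$ and to the point $g$ have at the common contact element tangent lines $\ell_F,\ell_P,\ell_D,\ell_g$ lying in one plane, and the cr-invariant $\rho=\rho(g)=(\ell_F,\ell_P,\ell_D,\ell_g)$ (the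 cross-ratio that equals $\frac{s_F-s_D}{s_P-s_D}$ for lines of slopes $s_F,s_P,s_D,\infty$) is well defined, with $\rho\ne1$. There is a projective transformation sending $g$ to the origin and $S$, near $g$, to a graph $$z=\tfrac{y^2}{2}-x^2y+\tfrac{r}{2}x^4+\varphi(x,y),\qquad(\ast)$$ where $\varphi$ is smooth and its Taylor series at $0$ contains only monomials $x^iy^j$ with $i+2j\ge5$. For every such transformation $r=\rho$, and the following holds. The asymptotic line at $g$ becomes the line $y=0$, of coefficient $c_{al}=0$. Identify the $2$-jets of curves of $S$ tangent to $P$ at $g$ with the jets of the parabolas $y=cx^2$, $c\in\mathbb R$, through the projection to the $(x,y)$-plane. Then there is exactly one separating $2$-jet, $c=c_\sigma=1$; a separating $2$-jet is one such that the images under $\tau_S$ of all other $2$-jets are cusps with a common tangent line, its own image is a singular curve with a different tangent line, and the images of any two $2$-jets separated by it are cusps pointing in opposite directions. The $2$-jets of $F,P,D$ have well-defined coefficients (the canonical coefficients) $$c_F=\rho(2\rho-1),\qquad c_P=3\rho-2,\qquad c_D=\rho .$$ The configuration of $F,P,D$ with respect to the asymptotic line ($c=0$) and the separating $2$-jet ($c=1$)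 is given by $$\begin{array}{rcl} \rho\in(1,\infty)&\iff&1<c_D<c_P<c_F;\\ \rho\in(\frac23,1)&\iff&0<c_P<c_F<c_D<1;\\ \rho\in(\frac12,\frac23)&\iff&c_P<0<c_F<c_D<1;\\ \rho\in(0,\frac12)&\iff&c_P<c_F<0<c_D<1;\\ \rho\in(-\frac12,0)&\iff&c_P<c_D<0<c_F<1;\\ \rho\in(-\infty,-\frac12)&\iff&c_P<c_D<0<1<c_F, \end{array}$$ and whenever $0,1,c_F,c_P,c_D$ are pairwise distinct, one of these six configurations occurs. Conversely every real $\rho\neq1$ is the cr-invariant of a simple godron of some smooth surface, so all six configurations occur. -/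

import Mathlib

open Filter Topology Asymptotics
open scoped ContDiff

/-- Real affine `3`-space, with its standard coordinates `(x, y, z) = (p 0, p 1, p 2)`. -/
abbrev R3 : Type := Fin 3 → ℝ

/-- `f` is of class `C^∞` in a neighbourhood of `x`. -/
def SmoothNear {E F : Type*} [NormedAddCommGroup E] [NormedSpace ℝ E]
    [NormedAddCommGroup F] [NormedSpace ℝ F] (f : E → F) (x : E) : Prop :=
  ∀ᶠ y in 𝓝 x, ContDiffAt ℝ ∞ f y

/-! ### Smooth surfaces and their tangent planes -/

/-- `G = 0` is a regular local equation of the set `S` at its point `q`. -/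
def IsDefining (S : Set R3) (q : R3) (G : R3 → ℝ) : Prop :=
  q ∈ S ∧ SmoothNear G q ∧ fderiv ℝ G q ≠ 0 ∧ ∀ᶠ p in 𝓝 q, (p ∈ S ↔ G p = 0)

/-- A smooth surface: a set having a regular local equation at each of its points. -/
def IsSmoothSurface (S : Set R3) : Prop :=
  ∀ q ∈ S, ∃ G : R3 → ℝ, IsDefining S q G

/-- `n` is a nonzero covector whose kernel is the direction of the tangent plane of `S` at `q`,
so that this tangent plane is `{p | n (p - q) = 0}`. -/
def IsConormal (S : Set R3) (q : R3) (n : R3 →L[ℝ] ℝ) : Prop :=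
  ∃ G : R3 → ℝ, IsDefining S q G ∧ fderiv ℝ G q = n

/-- The vectors tangent to `S` at `q`. -/
def tangentDirections (S : Set R3) (q : R3) : Submodule ℝ R3 :=
  ⨅ (n : R3 →L[ℝ] ℝ) (_ : IsConormal S q n), LinearMap.ker (n : R3 →ₗ[ℝ] ℝ)

/-- The line through `q` in the direction `w` has at least `k`-point contact with `S` at `q`. -/
def LineContact (S : Set R3) (q w : R3) (k : ℕ) : Prop :=
  ∃ G : R3 → ℝ, IsDefining S q G ∧ (fun t : ℝ => G (q + t • w)) =O[𝓝 0] (fun t : ℝ => t ^ k)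

/-- `w` directs an asymptotic line at `q`: a line exceeding `2`-point contact with `S`. -/
def IsAsymptotic (S : Set R3) (q w : R3) : Prop :=
  w ≠ 0 ∧ LineContact S q w 3

/-! ### The parabolic, flecnodal and conodal curves -/

/-- The parabolic curve `P`: the points with exactly one asymptotic line. -/
def parabolicCurve (S : Set R3) : Set R3 :=
  {q | q ∈ S ∧ ∃ w, IsAsymptotic S q w ∧ ∀ w', IsAsymptotic S q w' → w' ∈ Submodule.span ℝ {w}}

/-- The flecnodal curve `F`: the points at which an asymptotic line exceeds `3`-point contact. -/
def flecnodalCurve (S : Set R3) : Set R3 :=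
  {q | q ∈ S ∧ ∃ w, IsAsymptotic S q w ∧ LineContact S q w 4}

/-- The conodal curve of the part of `S` lying in `U`: the closure in `S` of the locus of points
of contact of `S ∩ U` with the planes tangent to `S ∩ U` at two distinct points at least. -/
def conodalCurve (S U : Set R3) : Set R3 :=
  S ∩ closure {q | q ∈ S ∩ U ∧ ∃ q' ∈ S ∩ U, q' ≠ q ∧
    ∃ n, IsConormal S q n ∧ IsConormal S q' n ∧ n (q' - q) = 0}

/-- `γ` is a regular smooth parametrisation, with `γ 0 = g`, of the set `C` near `g`. -/
def IsArc (C : Set R3) (g : R3) (γ : ℝ → R3) : Prop :=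
  SmoothNear γ 0 ∧ γ 0 = g ∧ deriv γ 0 ≠ 0 ∧
    ∀ᶠ ε in 𝓝[>] (0 : ℝ), ∀ᶠ p in 𝓝 g, (p ∈ C ↔ p ∈ γ '' Set.Ioo (-ε) ε)

/-- `γ` parametrises the (local) parabolic curve `P` at `g`. -/
def IsParabolicArc (S : Set R3) (g : R3) (γ : ℝ → R3) : Prop :=
  IsArc (parabolicCurve S) g γ

/-- `γ` parametrises the (local) flecnodal curve `F` at `g`. -/
def IsFlecnodalArc (S : Set R3) (g : R3) (γ : ℝ → R3) : Prop :=
  IsArc (flecnodalCurve S) g γ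

/-- `γ` parametrises the local conodal curve `D` at `g`, that is, the conodal curve of every
sufficiently small neighbourhood of `g` in `S`. -/
def IsConodalArc (S : Set R3) (g : R3) (γ : ℝ → R3) : Prop :=
  ∀ᶠ U in (𝓝 g).smallSets, U ∈ 𝓝 g → IsArc (conodalCurve S U) g γ

/-! ### The tangential map and simple godrons -/

/-- The planes transverse to the vector `b 2` form an affine chart of the dual projective space:
such a plane is `{p | n p = c}` for a unique covector `n` with `n (b 2) = 1`, and its coordinates
are `(n (b 0), n (b 1), c)`. -/
def IsTransverse (S : Set R3) (g : R3) (b : Module.Basis (Fin 3) ℝ R3) : Prop :=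
  ∃ n, IsConormal S g n ∧ n (b 2) = 1

/-- The conormal of `S` at `q` normalised by `n (b 2) = 1`. -/
noncomputable def normalizedConormal (S : Set R3) (b : Module.Basis (Fin 3) ℝ R3) (q : R3) :
    R3 →L[ℝ] ℝ :=
  Classical.epsilon fun n => IsConormal S q n ∧ n (b 2) = 1

/-- The tangential map of `S` (sending a point to the tangent plane of `S` there), written in the
affine chart of the dual space given by the frame `b`. -/
noncomputable def tangentialMap (S : Set R3) (b : Module.Basis (Fin 3) ℝ R3) (q : R3) : R3 :=
  ![normalizedConormal S b q (b 0), normalizedConormal S b q (b 1), normalizedConormal S b q q]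

/-- The standard swallowtail: the polynomials `X^4 + a X^2 + b X + c` (points `(a, b, c)`) having
the multiple root `u.1`, with `a = u.2`. -/
def standardSwallowtail (u : ℝ × ℝ) : R3 :=
  ![u.2, -4 * u.1 ^ 3 - 2 * u.2 * u.1, 3 * u.1 ^ 4 + u.2 * u.1 ^ 2]

/-- The dual surface of `S` has a swallowtail at the tangent plane of `g`: up to a change of local
parameters of `S` and a local diffeomorphism of the dual space, the tangential map at `g` is the
standard swallowtail. -/
def IsDualSwallowtail (S : Set R3) (g : R3) : Prop :=
  ∃ b : Module.Basis (Fin 3) ℝ R3, IsTransverse S g b ∧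
    ∃ X : ℝ × ℝ → R3, SmoothNear X 0 ∧ X 0 = g ∧ Function.Injective (fderiv ℝ X 0) ∧
      (∀ᶠ u in 𝓝 (0 : ℝ × ℝ), X u ∈ S) ∧
      ∃ ψ : R3 → R3, SmoothNear ψ (tangentialMap S b g) ∧
        Function.Bijective (fderiv ℝ ψ (tangentialMap S b g)) ∧
        ∀ᶠ u in 𝓝 (0 : ℝ × ℝ), ψ (tangentialMap S b (X u)) = standardSwallowtail u

/-- A godron: a parabolic point at which the asymptotic direction is tangent to the parabolic
curve. -/
def IsGodron (S : Set R3) (g : R3) : Prop :=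
  g ∈ parabolicCurve S ∧ ∃ γ, IsParabolicArc S g γ ∧ IsAsymptotic S g (deriv γ 0)

/-- A simple godron: it corresponds to a swallowtail point of the dual surface. -/
def IsSimpleGodron (S : Set R3) (g : R3) : Prop :=
  IsGodron S g ∧ IsDualSwallowtail S g

/-! ### The cr-invariant -/

/-- `r` is the cross-ratio `(l₁, l₂, l₃, l₄)` of four lines through the origin of a common plane;
for lines of slopes `s₁, s₂, s₃, s₄` it is `((s₁ - s₃) (s₂ - s₄)) / ((s₂ - s₃) (s₁ - s₄))`. -/
def IsCrossRatio {V : Type*} [AddCommGroup V] [Module ℝ V] (l₁ l₂ l₃ l₄ : Submodule ℝ V)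
    (r : ℝ) : Prop :=
  ∃ e f : V, LinearIndependent ℝ ![e, f] ∧ ∃ a₁ b₁ a₂ b₂ a₃ b₃ a₄ b₄ : ℝ,
    l₁ = Submodule.span ℝ {a₁ • e + b₁ • f} ∧ l₂ = Submodule.span ℝ {a₂ • e + b₂ • f} ∧
    l₃ = Submodule.span ℝ {a₃ • e + b₃ • f} ∧ l₄ = Submodule.span ℝ {a₄ • e + b₄ • f} ∧
    a₂ * b₃ - a₃ * b₂ ≠ 0 ∧ a₁ * b₄ - a₄ * b₁ ≠ 0 ∧
    r = ((a₁ * b₃ - a₃ * b₁) * (a₂ * b₄ - a₄ * b₂)) /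
      ((a₂ * b₃ - a₃ * b₂) * (a₁ * b₄ - a₄ * b₁))

/-- The contact elements of `S` are the pairs (point `q`, line of tangent vectors at `q`), and the
tangent space at `(g, ℝ v)` to the manifold of pairs (point, line of vectors) is
`R3 × (R3 ⧸ ℝ v)`. This is the tangent line, at `(g, ℝ v)`, of the Legendrian curve
`t ↦ (γ t, ℝ (deriv γ t))` of contact elements tangent to `γ`, where `deriv γ 0 = v`. -/
noncomputable def legendrianLine (v : R3) (γ : ℝ → R3) :
    Submodule ℝ (R3 × (R3 ⧸ Submodule.span ℝ {v})) :=
  Submodule.span ℝ {(v, (Submodule.span ℝ {v}).mkQ (iteratedDeriv 2 γ 0))}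

/-- The tangent line, at `(g, ℝ v)`, of the fibre over `g`, formed by the contact elements of `S`
at `g`. -/
noncomputable def fibreLine (S : Set R3) (g v : R3) :
    Submodule ℝ (R3 × (R3 ⧸ Submodule.span ℝ {v})) :=
  (tangentDirections S g).map
    (LinearMap.inr ℝ R3 (R3 ⧸ Submodule.span ℝ {v}) ∘ₗ (Submodule.span ℝ {v}).mkQ)

/-- `ρ` is the cr-invariant of the godron `g`: the cross-ratio `(ℓ_F, ℓ_P, ℓ_D, ℓ_g)`. -/
def IsCrInvariant (S : Set R3) (g : R3) (ρ : ℝ) : Prop :=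
  ∃ (v : R3) (γF γP γD : ℝ → R3),
    IsFlecnodalArc S g γF ∧ IsParabolicArc S g γP ∧ IsConodalArc S g γD ∧
    deriv γF 0 = v ∧ deriv γP 0 = v ∧ deriv γD 0 = v ∧
    IsCrossRatio (legendrianLine v γF) (legendrianLine v γP) (legendrianLine v γD)
      (fibreLine S g v) ρ

/-! ### Normal form and canonical coefficients -/

/-- The projective transformation of the `3`-space given by a linear automorphism of `ℝ⁴`, in the
affine chart `(x, y, z) ↦ [x : y : z : 1]`. -/
noncomputable def projMap (A : (Fin 4 → ℝ) ≃ₗ[ℝ] (Fin 4 → ℝ)) (p : R3) : R3 :=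
  fun i => A ![p 0, p 1, p 2, 1] i.castSucc / A ![p 0, p 1, p 2, 1] 3

/-- The projective transformation `A` sends `g` to the origin and `S`, near `g`, to the graph
`z = y²/2 - x² y + r x⁴/2 + φ(x, y)`, where `φ` is smooth and its Taylor series contains only
monomials `x^i y^j` with `i + 2 j ≥ 5`. -/
def IsNormalForm (S : Set R3) (g : R3) (A : (Fin 4 → ℝ) ≃ₗ[ℝ] (Fin 4 → ℝ)) (r : ℝ) : Prop :=
  A ![g 0, g 1, g 2, 1] 3 ≠ 0 ∧ projMap A g = 0 ∧
    ∃ φ : ℝ × ℝ → ℝ, SmoothNear φ 0 ∧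
      φ =O[𝓝 0] (fun u : ℝ × ℝ =>
        |u.1| ^ 5 + |u.1| ^ 3 * |u.2| + |u.1| * |u.2| ^ 2 + |u.2| ^ 3) ∧
      ∀ᶠ p in 𝓝 g, (p ∈ S ↔
        projMap A p 2 = (projMap A p 1) ^ 2 / 2 - (projMap A p 0) ^ 2 * projMap A p 1
          + r * (projMap A p 0) ^ 4 / 2 + φ (projMap A p 0, projMap A p 1))

/-- After the transformation `A` and the projection to the `(x, y)`-plane, the curve `γ` has at
`t = 0` the same `2`-jet (as an unparametrised curve) as the parabola `y = c x²`. -/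
def HasJet (A : (Fin 4 → ℝ) ≃ₗ[ℝ] (Fin 4 → ℝ)) (γ : ℝ → R3) (c : ℝ) : Prop :=
  projMap A (γ 0) 0 = 0 ∧ projMap A (γ 0) 1 = 0 ∧
    deriv (fun t => projMap A (γ t) 0) 0 ≠ 0 ∧ deriv (fun t => projMap A (γ t) 1) 0 = 0 ∧
    iteratedDeriv 2 (fun t => projMap A (γ t) 1) 0 =
      2 * c * (deriv (fun t => projMap A (γ t) 0) 0) ^ 2

/-! ### The separating 2-jet -/

/-- A smooth curve of `S` passing through `g` at `t = 0`. -/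
def IsCurveOn (S : Set R3) (g : R3) (γ : ℝ → R3) : Prop :=
  SmoothNear γ 0 ∧ γ 0 = g ∧ ∀ᶠ t in 𝓝 (0 : ℝ), γ t ∈ S

/-- The (possibly singular) curve `α` has the tangent line of direction `L` at `t = 0`. -/
def HasTangentLine (α : ℝ → R3) (L : Submodule ℝ R3) : Prop :=
  ∃ k : ℕ, 0 < k ∧ (∀ j : ℕ, 0 < j → j < k → iteratedDeriv j α 0 = 0) ∧
    iteratedDeriv k α 0 ≠ 0 ∧ L = Submodule.span ℝ {iteratedDeriv k α 0}

/-- The curve `α` has a (possibly degenerate) cusp at `t = 0`; it points in the direction opposite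
to `iteratedDeriv 2 α 0`. -/
def HasCusp (α : ℝ → R3) : Prop :=
  deriv α 0 = 0 ∧ iteratedDeriv 2 α 0 ≠ 0

/-- In the coordinates given by `A`, the `2`-jets of curves of `S` tangent to `P` at `g` are the
jets of the parabolas `y = c x²`; here `c = s` is a separating `2`-jet:
the images under the tangential map of all the other jets are cusps with a common tangent line;
the image of the jet `s` is singular, with a different tangent line; the images of two jets
separated by `s` are cusps pointing in opposite directions. -/
def IsSeparatingJet (S : Set R3) (g : R3) (A : (Fin 4 → ℝ) ≃ₗ[ℝ] (Fin 4 → ℝ)) (s : ℝ) : Prop :=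
  ∃ b : Module.Basis (Fin 3) ℝ R3, IsTransverse S g b ∧ ∃ L : Submodule ℝ R3,
    (∀ γ c, IsCurveOn S g γ → HasJet A γ c → c ≠ s →
      HasCusp (fun t => tangentialMap S b (γ t)) ∧
      HasTangentLine (fun t => tangentialMap S b (γ t)) L) ∧
    (∀ γ, IsCurveOn S g γ → HasJet A γ s →
      deriv (fun t => tangentialMap S b (γ t)) 0 = 0 ∧
      ∃ L', HasTangentLine (fun t => tangentialMap S b (γ t)) L' ∧ L' ≠ L) ∧
    (∀ γ₁ γ₂ c₁ c₂, IsCurveOn S g γ₁ → IsCurveOn S g γ₂ → HasJet A γ₁ c₁ → HasJet A γ₂ c₂ →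
      c₁ < s → s < c₂ →
      ∃ k : ℝ, k < 0 ∧ iteratedDeriv 2 (fun t => tangentialMap S b (γ₁ t)) 0 =
        k • iteratedDeriv 2 (fun t => tangentialMap S b (γ₂ t)) 0)

/-!
Put `g` at the origin of a projective chart in which the tangent plane is `z = 0` and the asymptotic
line is the `x`-axis, so that `S` is a graph `z = f (x, y)` (`IsGraphChart`). That `g` is parabolic
with `P` tangent to the asymptotic line means `f_xx = f_xy = f_xxx = 0 ≠ f_yy`, and the swallowtail
condition gives moreover `f_xxy ≠ 0` and `f_xxxx f_yy ≠ 3 f_xxy²`; scaling `y` and `z` then yields the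
normal form, with `f_yy = 1`, `f_xxy = -2`, `f_xxxx = 12 r`, `r ≠ 1`
(`IsSimpleGodron.exists_isNormalJet`, `isNormalForm_iff`).

In this chart the contact of lines with `S` is that of lines with the graph of `f`, so `P` is the
zero locus of the Hessian determinant and `F` is the locus where the second and third differentials
of `f` have a common zero; the implicit function theorem gives both curves and their `2`-jets
(`IsGraphChart.exists_parabolic_arc`, `IsGraphChart.exists_flecnodal_arc`). The tangential map is, in
dual coordinates, the Legendre map `u ↦ (f_x, f_y, f - x f_x - y f_y)`. The points having the same
tangent plane as another point are the double points of this map, and those of the standard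
swallowtail form the curve `a = -2 t²`: its image in the source is `D`
(`IsGraphChart.exists_conodal_arc`). Comparing the second and third derivatives of the Legendre map
and of the standard swallowtail, along the curves of parameters `(t, β t²)` in the source of the
latter, gives both the `2`-jet of `D` and the two inequalities above (`IsSwallowtailChart.jets`). The
separating jet is found from the second and third derivatives of the Legendre map along a parabola
`y = c x²`: the second one is `2 (c - 1)` times a fixed vector
(`IsGraphChart.isSeparatingJet_iff`).

A projective chart acts on the second derivatives at `g` of curves of `S` with a given velocity by an
affine map (modulo the velocity). Hence the Legendrian lines of three curves of `2`-jets `y = cᵢ x²`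
have slopes which are, up to a common affine map, the coefficients `cᵢ`, and the cr-invariant is
`(c_F - c_D) / (c_P - c_D) = (r (2 r - 1) - r) / (2 r - 2) = r`
(`IsGraphChart.isCrInvariant_iff`). So `r` does not depend on the chart. Conversely the polynomial
normal form itself has a Legendre map which is the standard swallowtail in explicit coordinates, for
every `r ≠ 1` (`isSwallowtailChart_normalPoly`).
-/

/-! ### Smooth germs -/

section SmoothGerms

variable {E F G : Type*} [NormedAddCommGroup E] [NormedSpace ℝ E]
  [NormedAddCommGroup F] [NormedSpace ℝ F] [NormedAddCommGroup G] [NormedSpace ℝ G]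

theorem SmoothNear.contDiffAt {f : E → F} {x : E} (h : SmoothNear f x) : ContDiffAt ℝ ∞ f x :=
  Eventually.self_of_nhds h

theorem SmoothNear.eventually {f : E → F} {x : E} (h : SmoothNear f x) :
    ∀ᶠ y in 𝓝 x, SmoothNear f y :=
  eventually_eventually_nhds.2 h

theorem SmoothNear.continuousAt {f : E → F} {x : E} (h : SmoothNear f x) : ContinuousAt f x :=
  h.contDiffAt.continuousAt

theorem SmoothNear.differentiableAt {f : E → F} {x : E} (h : SmoothNear f x) :
    DifferentiableAt ℝ f x :=
  h.contDiffAt.differentiableAt (by simp)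

theorem SmoothNear.hasStrictFDerivAt {f : E → F} {x : E} (h : SmoothNear f x) :
    HasStrictFDerivAt f (fderiv ℝ f x) x :=
  h.contDiffAt.hasStrictFDerivAt (by simp)

theorem SmoothNear.congr {f g : E → F} {x : E} (h : SmoothNear f x) (hfg : g =ᶠ[𝓝 x] f) :
    SmoothNear g x := by
  filter_upwards [h, hfg.eventuallyEq_nhds] with y hy hy'
  exact hy.congr_of_eventuallyEq hy'

theorem SmoothNear.comp {g : F → G} {f : E → F} {x : E} (hg : SmoothNear g (f x))
    (hf : SmoothNear f x) : SmoothNear (fun y => g (f y)) x := by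
  filter_upwards [hf, hf.continuousAt.eventually hg] with y hy hy'
  exact ContDiffAt.comp y hy' hy

/-- Composition of smooth germs, with the base point of the outer germ given by an equation. -/
theorem SmoothNear.comp_of_eq {g : F → G} {f : E → F} {x : E} {y : F} (hg : SmoothNear g y)
    (hf : SmoothNear f x) (hy : f x = y) : SmoothNear (fun z => g (f z)) x := by
  subst hy; exact hg.comp hf

theorem ContDiff.smoothNear {f : E → F} (h : ContDiff ℝ ∞ f) (x : E) : SmoothNear f x :=
  Eventually.of_forall fun _ => h.contDiffAt

theorem smoothNear_const (c : F) (x : E) : SmoothNear (fun _ : E => c) x :=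
  contDiff_const.smoothNear x

theorem SmoothNear.add {f g : E → F} {x : E} (hf : SmoothNear f x) (hg : SmoothNear g x) :
    SmoothNear (fun y => f y + g y) x := by
  filter_upwards [hf, hg] with y h₁ h₂ using h₁.add h₂

theorem SmoothNear.sub {f g : E → F} {x : E} (hf : SmoothNear f x) (hg : SmoothNear g x) :
    SmoothNear (fun y => f y - g y) x := by
  filter_upwards [hf, hg] with y h₁ h₂ using h₁.sub h₂

theorem SmoothNear.mul {f g : E → ℝ} {x : E} (hf : SmoothNear f x) (hg : SmoothNear g x) :
    SmoothNear (fun y => f y * g y) x := by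
  filter_upwards [hf, hg] with y h₁ h₂ using h₁.mul h₂

theorem SmoothNear.pow {f : E → ℝ} {x : E} (hf : SmoothNear f x) (n : ℕ) :
    SmoothNear (fun y => f y ^ n) x := by
  filter_upwards [hf] with y h₁ using h₁.pow n

theorem SmoothNear.div {f g : E → ℝ} {x : E} (hf : SmoothNear f x) (hg : SmoothNear g x)
    (h0 : g x ≠ 0) : SmoothNear (fun y => f y / g y) x := by
  filter_upwards [hf, hg, hg.continuousAt.eventually_ne h0] with y h₁ h₂ h₃ using h₁.div h₂ h₃

theorem SmoothNear.smul {f : E → ℝ} {g : E → F} {x : E} (hf : SmoothNear f x)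
    (hg : SmoothNear g x) : SmoothNear (fun y => f y • g y) x := by
  filter_upwards [hf, hg] with y h₁ h₂ using h₁.smul h₂

theorem SmoothNear.prodMk {f : E → F} {g : E → G} {x : E} (hf : SmoothNear f x)
    (hg : SmoothNear g x) : SmoothNear (fun y => (f y, g y)) x := by
  filter_upwards [hf, hg] with y h₁ h₂ using h₁.prodMk h₂

theorem SmoothNear.pi {n : ℕ} {f : E → Fin n → ℝ} {x : E}
    (hf : ∀ i, SmoothNear (fun y => f y i) x) : SmoothNear f x := by
  filter_upwards [eventually_all.2 hf] with y hy using contDiffAt_pi.2 hy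

theorem SmoothNear.apply {n : ℕ} {f : E → Fin n → ℝ} {x : E} (hf : SmoothNear f x) (i : Fin n) :
    SmoothNear (fun y => f y i) x := by
  filter_upwards [hf] with y hy using contDiffAt_pi.1 hy i

theorem SmoothNear.fst {f : E → F × G} {x : E} (hf : SmoothNear f x) :
    SmoothNear (fun y => (f y).1) x := by
  filter_upwards [hf] with y hy using hy.fst

theorem SmoothNear.snd {f : E → F × G} {x : E} (hf : SmoothNear f x) :
    SmoothNear (fun y => (f y).2) x := by
  filter_upwards [hf] with y hy using hy.snd

theorem SmoothNear.fderiv_apply {f : E → F} {x : E} (hf : SmoothNear f x) (v : E) :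
    SmoothNear (fun y => fderiv ℝ f y v) x := by
  filter_upwards [hf] with y hy
  exact (hy.fderiv_right (m := ∞) (by simp)).clm_apply contDiffAt_const

theorem SmoothNear.derivative {f : ℝ → F} {x : ℝ} (hf : SmoothNear f x) :
    SmoothNear (deriv f) x :=
  (hf.fderiv_apply 1).congr (Eventually.of_forall fun y => by simp)

theorem SmoothNear.hasDerivAt {f : ℝ → F} {x : ℝ} (hf : SmoothNear f x) :
    HasDerivAt f (deriv f x) x :=
  hf.differentiableAt.hasDerivAt

/-- The inverse function theorem for smooth germs. -/
theorem SmoothNear.exists_local_inverse [CompleteSpace E] [CompleteSpace F] {f : E → F} {x : E}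
    (hf : SmoothNear f x) (hb : Function.Bijective (fderiv ℝ f x)) :
    ∃ g : F → E, SmoothNear g (f x) ∧ g (f x) = x ∧ (∀ᶠ y in 𝓝 x, g (f y) = y) ∧
      ∀ᶠ z in 𝓝 (f x), f (g z) = z := by
  set e : E ≃L[ℝ] F := ContinuousLinearEquiv.ofBijective (fderiv ℝ f x)
    (LinearMap.ker_eq_bot.2 hb.1) (LinearMap.range_eq_top.2 hb.2)
  have he : HasFDerivAt f (e : E →L[ℝ] F) x := hf.differentiableAt.hasFDerivAt
  have hs : HasStrictFDerivAt f (e : E →L[ℝ] F) x :=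
    hf.contDiffAt.hasStrictFDerivAt' he (by simp)
  have h1 : ∀ᶠ y in 𝓝 x, ∃ e' : E ≃L[ℝ] F, HasFDerivAt f (e' : E →L[ℝ] F) y := by
    have hc : ContinuousAt (fun y => fderiv ℝ f y) x :=
      (hf.contDiffAt.fderiv_right (m := ∞) (by simp)).continuousAt
    have ho := ContinuousLinearEquiv.nhds e
    have : fderiv ℝ f x = (e : E →L[ℝ] F) := rfl
    rw [← this] at ho
    filter_upwards [hc.eventually ho, hf] with y hy hy'
    obtain ⟨e', he'⟩ := hy
    exact ⟨e', he' ▸ (hy'.differentiableAt (by simp)).hasFDerivAt⟩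
  have hinv : ContinuousAt (hs.localInverse f e x) (f x) := hs.localInverse_continuousAt
  have hx : hs.localInverse f e x (f x) = x := hs.localInverse_apply_image
  refine ⟨hs.localInverse f e x, ?_, hx, hs.eventually_left_inverse, hs.eventually_right_inverse⟩
  have hsrc : ∀ᶠ z in 𝓝 (f x), z ∈ (hs.toOpenPartialHomeomorph f).target :=
    (hs.toOpenPartialHomeomorph f).open_target.mem_nhds hs.image_mem_toOpenPartialHomeomorph_target
  rw [ContinuousAt, hx] at hinv
  filter_upwards [hinv.eventually h1, hinv.eventually hf, hsrc] with z ⟨e', he'⟩ hz hz'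
  exact (hs.toOpenPartialHomeomorph f).contDiffAt_symm hz' he' hz

end SmoothGerms

/-! ### Jets of curves -/

section Jets

variable {E F : Type*} [NormedAddCommGroup E] [NormedSpace ℝ E]
  [NormedAddCommGroup F] [NormedSpace ℝ F]

theorem SmoothNear.iteratedDerivative {f : ℝ → F} {x : ℝ} (hf : SmoothNear f x) (n : ℕ) :
    SmoothNear (iteratedDeriv n f) x := by
  induction n with
  | zero => simpa using hf
  | succ n ih => rw [iteratedDeriv_succ]; exact ih.derivative

theorem iteratedDeriv_congr_nhds {f g : ℝ → F} {x : ℝ} (h : f =ᶠ[𝓝 x] g) (n : ℕ) :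
    iteratedDeriv n f =ᶠ[𝓝 x] iteratedDeriv n g := by
  induction n with
  | zero => simpa using h
  | succ n ih => simpa [iteratedDeriv_succ] using ih.deriv

theorem SmoothNear.taylor {h : ℝ → F} (hh : SmoothNear h 0) (n : ℕ) :
    (fun t => h t - ∑ j ∈ Finset.range (n + 1), ((j.factorial : ℝ)⁻¹ * t ^ j) • iteratedDeriv j h 0)
      =o[𝓝 0] fun t : ℝ => t ^ n := by
  obtain ⟨ε, hε, hb⟩ := Metric.eventually_nhds_iff_ball.1 hh
  have h0 : (0 : ℝ) ∈ Metric.ball (0 : ℝ) ε := Metric.mem_ball_self hε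
  have hc : ContDiffOn ℝ n h (Metric.ball 0 ε) := fun t ht =>
    ((hb t ht).of_le (WithTop.coe_le_coe.2 le_top)).contDiffWithinAt
  have := taylor_isLittleO (convex_ball (0 : ℝ) ε) h0 hc
  rw [nhdsWithin_eq_nhds.2 (Metric.isOpen_ball.mem_nhds h0)] at this
  refine this.congr (fun t => ?_) (fun t => by simp)
  rw [taylor_within_apply]
  congr 1
  refine Finset.sum_congr rfl fun j _ => ?_
  rw [iteratedDerivWithin_of_isOpen Metric.isOpen_ball h0, sub_zero]

/-- A smooth germ of curve vanishes to order `k` if and only if its `(k - 1)`-jet vanishes. -/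
theorem SmoothNear.isBigO_pow_iff {h : ℝ → F} (hh : SmoothNear h 0) (k : ℕ) :
    h =O[𝓝 0] (fun t : ℝ => t ^ k) ↔ ∀ j < k, iteratedDeriv j h 0 = 0 := by
  constructor
  · intro hO j
    induction j using Nat.strong_induction_on with
    | _ j ih =>
      intro hj
      have h1 := hh.taylor j
      have h2 : h =o[𝓝 0] fun t : ℝ => t ^ j := hO.trans_isLittleO (isLittleO_pow_pow hj)
      have h3 := h2.sub h1
      have h4 : (fun t : ℝ => t ^ j • iteratedDeriv j h 0) =o[𝓝 0] fun t : ℝ => t ^ j := by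
        have h5 := h3.const_smul_left (j.factorial : ℝ)
        refine h5.congr_left fun t => ?_
        simp only [Pi.smul_apply]
        rw [Finset.sum_range_succ, Finset.sum_eq_zero fun i hi => by
          rw [ih i (Finset.mem_range.1 hi) ((Finset.mem_range.1 hi).trans hj), smul_zero]]
        have : (j.factorial : ℝ) ≠ 0 := by positivity
        simp [smul_smul, this]
      by_contra hne
      have h6 := (isLittleO_iff.1 h4) (half_pos (norm_pos_iff.2 hne))
      obtain ⟨ε, hε, hb⟩ := Metric.eventually_nhds_iff_ball.1 h6
      have h7 := hb (ε / 2) (by simp [abs_of_pos, hε])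
      rw [norm_smul] at h7
      have h8 : 0 < ‖(ε / 2) ^ j‖ := norm_pos_iff.2 (by positivity)
      have h9 := norm_pos_iff.2 hne
      nlinarith [mul_pos h8 h9]
  · intro hj
    have h1 := (hh.taylor k).isBigO
    simp only [Finset.sum_range_succ _ k] at h1
    have h2 : (fun t : ℝ => ((k.factorial : ℝ)⁻¹ * t ^ k) • iteratedDeriv k h 0) =O[𝓝 0]
        fun t : ℝ => t ^ k := by
      refine IsBigO.of_bound (‖(k.factorial : ℝ)⁻¹‖ * ‖iteratedDeriv k h 0‖)
        (Eventually.of_forall fun t => ?_)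
      rw [norm_smul, norm_mul]
      exact le_of_eq (by ring)
    refine (h1.add h2).congr_left fun t => ?_
    rw [Finset.sum_eq_zero fun i hi => by rw [hj i (Finset.mem_range.1 hi), smul_zero]]
    simp

theorem iteratedDeriv_clm_comp (L : E →L[ℝ] F) {α : ℝ → E} {x : ℝ} (hα : SmoothNear α x) (n : ℕ) :
    iteratedDeriv n (fun t => L (α t)) x = L (iteratedDeriv n α x) := by
  suffices ∀ᶠ y in 𝓝 x, iteratedDeriv n (fun t => L (α t)) y = L (iteratedDeriv n α y) from
    this.self_of_nhds
  induction n with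
  | zero => simp
  | succ n ih =>
    filter_upwards [eventually_eventually_nhds.2 ih, (hα.iteratedDerivative n).eventually] with y hy hy'
    rw [iteratedDeriv_succ, iteratedDeriv_succ, EventuallyEq.deriv_eq hy]
    exact (L.hasFDerivAt.comp_hasDerivAt y hy'.hasDerivAt).deriv

theorem iteratedDeriv_apply {k : ℕ} {α : ℝ → Fin k → ℝ} {x : ℝ} (hα : SmoothNear α x) (n : ℕ)
    (i : Fin k) : iteratedDeriv n α x i = iteratedDeriv n (fun t => α t i) x :=
  (iteratedDeriv_clm_comp (ContinuousLinearMap.proj i) hα n).symm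

theorem deriv_apply {k : ℕ} {α : ℝ → Fin k → ℝ} {x : ℝ} (hα : SmoothNear α x)
    (i : Fin k) : deriv α x i = deriv (fun t => α t i) x := by
  simpa using iteratedDeriv_apply hα 1 i

theorem SmoothNear.deriv_comp {θ : E → F} {α : ℝ → E} {t : ℝ} (hθ : SmoothNear θ (α t))
    (hα : SmoothNear α t) :
    deriv (fun s => θ (α s)) t = fderiv ℝ θ (α t) (deriv α t) :=
  (hθ.differentiableAt.hasFDerivAt.comp_hasDerivAt t hα.hasDerivAt).deriv

theorem SmoothNear.iteratedDeriv_two_comp {θ : E → F} {α : ℝ → E} {t : ℝ}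
    (hθ : SmoothNear θ (α t)) (hα : SmoothNear α t) :
    iteratedDeriv 2 (fun s => θ (α s)) t =
      iteratedFDeriv ℝ 2 θ (α t) (fun _ => deriv α t) +
        fderiv ℝ θ (α t) (iteratedDeriv 2 α t) := by
  exact iteratedDeriv_vcomp_two (hθ.contDiffAt.of_le (WithTop.coe_le_coe.2 le_top))
    (hα.contDiffAt.of_le (WithTop.coe_le_coe.2 le_top))

/-- A map acts on the second derivative of a singular curve through its differential. -/
theorem SmoothNear.iteratedDeriv_two_comp_of_deriv_eq_zero {θ : E → F} {α : ℝ → E} {t : ℝ}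
    (hθ : SmoothNear θ (α t)) (hα : SmoothNear α t) (h : deriv α t = 0) :
    iteratedDeriv 2 (fun s => θ (α s)) t =
        fderiv ℝ θ (α t) (iteratedDeriv 2 α t) := by
  rw [hθ.iteratedDeriv_two_comp hα, h, ContinuousMultilinearMap.map_coord_zero _ (0 : Fin 2) rfl,
    zero_add]

/-- A map acts on the third derivative of a singular curve through its differential. -/
theorem SmoothNear.iteratedDeriv_three_comp_of_deriv_eq_zero {θ : E → F} {α : ℝ → E} {t : ℝ}
    (hθ : SmoothNear θ (α t)) (hα : SmoothNear α t) (h : deriv α t = 0) :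
    iteratedDeriv 3 (fun s => θ (α s)) t =
        fderiv ℝ θ (α t) (iteratedDeriv 3 α t) := by
  have := iteratedDeriv_vcomp_three (g := θ) (f := α) (x := t)
    (hθ.contDiffAt.of_le (WithTop.coe_le_coe.2 le_top))
    (hα.contDiffAt.of_le (WithTop.coe_le_coe.2 le_top))
  refine this.trans ?_
  rw [h]
  have h1 : iteratedFDeriv ℝ 3 θ (α t) (fun _ => 0) = 0 :=
    ContinuousMultilinearMap.map_coord_zero _ (0 : Fin 3) rfl
  have h2 : iteratedFDeriv ℝ 2 θ (α t) ![iteratedDeriv 2 α t, 0] = 0 :=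
    ContinuousMultilinearMap.map_coord_zero _ 1 (by simp)
  have h3 : iteratedFDeriv ℝ 2 θ (α t) ![0, iteratedDeriv 2 α t] = 0 :=
    ContinuousMultilinearMap.map_coord_zero _ 0 (by simp)
  simp [h1, h2, h3]

end Jets

/-! ### Partial derivatives of functions of two variables -/

/-- The partial derivative `∂h/∂x` of a function `h` of `(x, y)`. -/
noncomputable def px (h : ℝ × ℝ → ℝ) (u : ℝ × ℝ) : ℝ := fderiv ℝ h u (1, 0)

/-- The partial derivative `∂h/∂y` of a function `h` of `(x, y)`. -/
noncomputable def py (h : ℝ × ℝ → ℝ) (u : ℝ × ℝ) : ℝ := fderiv ℝ h u (0, 1)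

section Partial

variable {h : ℝ × ℝ → ℝ} {u : ℝ × ℝ}

theorem SmoothNear.partial_x (hh : SmoothNear h u) : SmoothNear (px h) u := hh.fderiv_apply _

theorem SmoothNear.partial_y (hh : SmoothNear h u) : SmoothNear (py h) u := hh.fderiv_apply _

theorem fderiv_eq_px_py (h : ℝ × ℝ → ℝ) (u v : ℝ × ℝ) :
    fderiv ℝ h u v = px h u * v.1 + py h u * v.2 := by
  have : v = v.1 • ((1, 0) : ℝ × ℝ) + v.2 • ((0, 1) : ℝ × ℝ) := by ext <;> simp
  conv_lhs => rw [this, map_add, map_smul, map_smul]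
  simp [px, py, mul_comm]

theorem px_congr {h k : ℝ × ℝ → ℝ} (e : h =ᶠ[𝓝 u] k) : px h =ᶠ[𝓝 u] px k := by
  filter_upwards [e.eventuallyEq_nhds] with v hv
  simp [px, hv.fderiv_eq]

theorem py_congr {h k : ℝ × ℝ → ℝ} (e : h =ᶠ[𝓝 u] k) : py h =ᶠ[𝓝 u] py k := by
  filter_upwards [e.eventuallyEq_nhds] with v hv
  simp [py, hv.fderiv_eq]

theorem px_py (hh : SmoothNear h u) : px (py h) u = py (px h) u := by
  have hs : IsSymmSndFDerivAt ℝ h u :=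
    hh.contDiffAt.isSymmSndFDerivAt (by simpa using WithTop.coe_le_coe.2 (le_top : (2 : ℕ∞) ≤ ⊤))
  have hd : DifferentiableAt ℝ (fderiv ℝ h) u :=
    (hh.contDiffAt.fderiv_right (m := ∞) (by simp)).differentiableAt (by simp)
  have key : ∀ v w : ℝ × ℝ, fderiv ℝ (fun z => fderiv ℝ h z v) u w = fderiv ℝ (fderiv ℝ h) u w v := by
    intro v w
    rw [fderiv_clm_apply hd (differentiableAt_const v)]
    simp
  change fderiv ℝ (fun z => fderiv ℝ h z (0, 1)) u (1, 0) =
    fderiv ℝ (fun z => fderiv ℝ h z (1, 0)) u (0, 1)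
  rw [key, key]
  exact hs.eq _ _

theorem px_py_eventuallyEq (hh : SmoothNear h u) : px (py h) =ᶠ[𝓝 u] py (px h) := by
  filter_upwards [hh.eventually] with v hv using px_py hv

variable {x y : ℝ → ℝ} {t : ℝ}

theorem SmoothNear.hasDerivAt_comp₂ (hh : SmoothNear h (x t, y t)) (hx : SmoothNear x t)
    (hy : SmoothNear y t) : HasDerivAt (fun s => h (x s, y s))
      (px h (x t, y t) * deriv x t + py h (x t, y t) * deriv y t) t := by
  have := hh.differentiableAt.hasFDerivAt.comp_hasDerivAt t (hx.hasDerivAt.prodMk hy.hasDerivAt)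
  rwa [fderiv_eq_px_py] at this

theorem SmoothNear.eventually_comp₂ (hh : SmoothNear h (x t, y t)) (hx : SmoothNear x t)
    (hy : SmoothNear y t) : ∀ᶠ s in 𝓝 t, SmoothNear h (x s, y s) :=
  (hx.continuousAt.prodMk hy.continuousAt).eventually hh.eventually

theorem SmoothNear.deriv_comp₂ (hh : SmoothNear h (x t, y t)) (hx : SmoothNear x t)
    (hy : SmoothNear y t) : deriv (fun s => h (x s, y s)) t =
      px h (x t, y t) * deriv x t + py h (x t, y t) * deriv y t :=
  (hh.hasDerivAt_comp₂ hx hy).deriv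

theorem iteratedDeriv_two (f : ℝ → ℝ) : iteratedDeriv 2 f = deriv (deriv f) := by
  rw [iteratedDeriv_succ, iteratedDeriv_one]

theorem SmoothNear.iteratedDeriv_two_comp₂ (hh : SmoothNear h (x t, y t)) (hx : SmoothNear x t)
    (hy : SmoothNear y t) : iteratedDeriv 2 (fun s => h (x s, y s)) t =
      px (px h) (x t, y t) * deriv x t ^ 2
      + 2 * py (px h) (x t, y t) * deriv x t * deriv y t
      + py (py h) (x t, y t) * deriv y t ^ 2
      + px h (x t, y t) * iteratedDeriv 2 x t
      + py h (x t, y t) * iteratedDeriv 2 y t := by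
  have e : deriv (fun s => h (x s, y s)) =ᶠ[𝓝 t] fun s =>
      px h (x s, y s) * deriv x s + py h (x s, y s) * deriv y s := by
    filter_upwards [hh.eventually_comp₂ hx hy, hx.eventually, hy.eventually] with s h1 h2 h3
    exact h1.deriv_comp₂ h2 h3
  rw [iteratedDeriv_two, e.deriv_eq, iteratedDeriv_two, iteratedDeriv_two]
  refine Eq.trans (HasDerivAt.deriv (((hh.partial_x.hasDerivAt_comp₂ hx hy).mul hx.derivative.hasDerivAt).add
      ((hh.partial_y.hasDerivAt_comp₂ hx hy).mul hy.derivative.hasDerivAt))) ?_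
  rw [px_py hh]
  ring

theorem SmoothNear.iteratedDeriv_three_comp₂ (hh : SmoothNear h (x t, y t)) (hx : SmoothNear x t)
    (hy : SmoothNear y t) : iteratedDeriv 3 (fun s => h (x s, y s)) t =
      px (px (px h)) (x t, y t) * deriv x t ^ 3
      + 3 * py (px (px h)) (x t, y t) * deriv x t ^ 2 * deriv y t
      + 3 * py (py (px h)) (x t, y t) * deriv x t * deriv y t ^ 2
      + py (py (py h)) (x t, y t) * deriv y t ^ 3
      + 3 * px (px h) (x t, y t) * deriv x t * iteratedDeriv 2 x t
      + 3 * py (px h) (x t, y t) *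
          (deriv x t * iteratedDeriv 2 y t + iteratedDeriv 2 x t * deriv y t)
      + 3 * py (py h) (x t, y t) * deriv y t * iteratedDeriv 2 y t
      + px h (x t, y t) * iteratedDeriv 3 x t
      + py h (x t, y t) * iteratedDeriv 3 y t := by
  have e : iteratedDeriv 2 (fun s => h (x s, y s)) =ᶠ[𝓝 t] fun s =>
      px (px h) (x s, y s) * (deriv x s * deriv x s)
      + 2 * py (px h) (x s, y s) * (deriv x s * deriv y s)
      + py (py h) (x s, y s) * (deriv y s * deriv y s)
      + px h (x s, y s) * iteratedDeriv 2 x s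
      + py h (x s, y s) * iteratedDeriv 2 y s := by
    filter_upwards [hh.eventually_comp₂ hx hy, hx.eventually, hy.eventually] with s h1 h2 h3
    rw [h1.iteratedDeriv_two_comp₂ h2 h3]
    ring
  have hx1 := hx.derivative.hasDerivAt
  have hy1 := hy.derivative.hasDerivAt
  have hx2 := (hx.iteratedDerivative 2).hasDerivAt
  have hy2 := (hy.iteratedDerivative 2).hasDerivAt
  have c1 : px (py (px h)) (x t, y t) =
      py (px (px h)) (x t, y t) := px_py hh.partial_x
  have c2 : px (py (py h)) (x t, y t) =
      py (py (px h)) (x t, y t) := by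
    rw [px_py hh.partial_y]
    exact (py_congr (px_py_eventuallyEq hh)).self_of_nhds
  rw [iteratedDeriv_succ, e.deriv_eq]
  refine Eq.trans (HasDerivAt.deriv ((((((hh.partial_x.partial_x.hasDerivAt_comp₂ hx hy).mul (hx1.mul hx1)).add
      (((hh.partial_x.partial_y.hasDerivAt_comp₂ hx hy).const_mul 2).mul (hx1.mul hy1))).add
      ((hh.partial_y.partial_y.hasDerivAt_comp₂ hx hy).mul (hy1.mul hy1))).add
      ((hh.partial_x.hasDerivAt_comp₂ hx hy).mul hx2)).add
      ((hh.partial_y.hasDerivAt_comp₂ hx hy).mul hy2))) ?_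
  rw [iteratedDeriv_succ (n := 2) (f := x), iteratedDeriv_succ (n := 2) (f := y), c1, c2, px_py hh]
  simp only [iteratedDeriv_two, Pi.mul_apply]
  ring

theorem deriv_mul_of_smoothNear (hx : SmoothNear x t) (hy : SmoothNear y t) :
    deriv (fun s => x s * y s) t = deriv x t * y t + x t * deriv y t :=
  (hx.hasDerivAt.mul hy.hasDerivAt).deriv

theorem iteratedDeriv_two_mul (hx : SmoothNear x t) (hy : SmoothNear y t) :
    iteratedDeriv 2 (fun s => x s * y s) t =
      iteratedDeriv 2 x t * y t + 2 * deriv x t * deriv y t + x t * iteratedDeriv 2 y t := by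
  have e : deriv (fun s => x s * y s) =ᶠ[𝓝 t] fun s => deriv x s * y s + x s * deriv y s := by
    filter_upwards [hx.eventually, hy.eventually] with s h1 h2 using deriv_mul_of_smoothNear h1 h2
  rw [iteratedDeriv_two, e.deriv_eq]
  refine Eq.trans (HasDerivAt.deriv ((hx.derivative.hasDerivAt.mul hy.hasDerivAt).add
    (hx.hasDerivAt.mul hy.derivative.hasDerivAt))) ?_
  simp only [iteratedDeriv_two]
  ring

theorem iteratedDeriv_add_of_smoothNear (hx : SmoothNear x t) (hy : SmoothNear y t) (n : ℕ) :
    iteratedDeriv n (fun s => x s + y s) t = iteratedDeriv n x t + iteratedDeriv n y t :=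
  iteratedDeriv_fun_add (hx.contDiffAt.of_le (WithTop.coe_le_coe.2 le_top))
    (hy.contDiffAt.of_le (WithTop.coe_le_coe.2 le_top))

theorem iteratedDeriv_sub_of_smoothNear (hx : SmoothNear x t) (hy : SmoothNear y t) (n : ℕ) :
    iteratedDeriv n (fun s => x s - y s) t = iteratedDeriv n x t - iteratedDeriv n y t :=
  iteratedDeriv_fun_sub (hx.contDiffAt.of_le (WithTop.coe_le_coe.2 le_top))
    (hy.contDiffAt.of_le (WithTop.coe_le_coe.2 le_top))

end Partial

/-! ### Regular local equations of a surface -/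

theorem IsDefining.eq_zero {S : Set R3} {q : R3} {G : R3 → ℝ} (h : IsDefining S q G) : G q = 0 :=
  (h.2.2.2.self_of_nhds).1 h.1

/-- Two regular local equations of a surface are comparable: each is bounded by a multiple of the
other. A point `p` is moved to the surface along a transverse direction by a distance of the order
of `G₁ p`, and `G₂` vanishes at the resulting point. -/
theorem IsDefining.isBigO {S : Set R3} {q : R3} {G₁ G₂ : R3 → ℝ} (h₁ : IsDefining S q G₁)
    (h₂ : IsDefining S q G₂) : G₂ =O[𝓝 q] G₁ := by
  obtain ⟨e, he⟩ : ∃ e, fderiv ℝ G₁ q e = 1 := by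
    obtain ⟨v, hv⟩ : ∃ v, fderiv ℝ G₁ q v ≠ 0 := by
      by_contra hne
      push Not at hne
      exact h₁.2.2.1 (ContinuousLinearMap.ext hne)
    exact ⟨(fderiv ℝ G₁ q v)⁻¹ • v, by simp [hv]⟩
  set n := fderiv ℝ G₁ q with hn
  -- a local diffeomorphism taking `G₁` to the linear form `n`
  let Ψ : R3 → R3 := fun p => (p - q) + (G₁ p - n (p - q)) • e
  have hsub : SmoothNear (fun p : R3 => p - q) q := (contDiff_id.sub contDiff_const).smoothNear q
  have hΨs : SmoothNear Ψ q :=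
    hsub.add ((h₁.2.1.sub ((n.contDiff.smoothNear _).comp hsub)).smul (smoothNear_const e q))
  have hΨ0 : Ψ q = 0 := by simp [Ψ, h₁.eq_zero]
  have hΨd : fderiv ℝ Ψ q = ContinuousLinearMap.id ℝ R3 := by
    have a1 : HasFDerivAt (fun p : R3 => p - q) (ContinuousLinearMap.id ℝ R3) q :=
      (hasFDerivAt_id q).sub_const q
    have a2 : HasFDerivAt G₁ n q := h₁.2.1.differentiableAt.hasFDerivAt
    have a3 := a1.add ((a2.sub (n.hasFDerivAt.comp q a1)).smul_const e)
    refine HasFDerivAt.fderiv (a3.congr_fderiv ?_)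
    ext v
    simp
  have hnΨ : ∀ p, n (Ψ p) = G₁ p := by intro p; simp [Ψ, he]
  obtain ⟨Θ, hΘs, hΘ0, hl, hr⟩ := hΨs.exists_local_inverse
    (by rw [hΨd]; exact Function.bijective_id)
  rw [hΨ0] at hΘs hΘ0 hr
  have hT1 : Tendsto Ψ (𝓝 q) (𝓝 0) := by simpa [ContinuousAt, hΨ0] using hΨs.continuousAt
  have hT2 : Tendsto (fun p => Ψ p - G₁ p • e) (𝓝 q) (𝓝 0) := by
    have : ContinuousAt (fun p => Ψ p - G₁ p • e) q :=
      (hΨs.sub (h₁.2.1.smul (smoothNear_const e q))).continuousAt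
    simpa [ContinuousAt, hΨ0, h₁.eq_zero] using this
  have hT3 : Tendsto (fun p => Θ (Ψ p - G₁ p • e)) (𝓝 q) (𝓝 q) := by
    have := hΘs.continuousAt.tendsto
    rw [hΘ0] at this
    exact this.comp hT2
  have hzero : ∀ᶠ p in 𝓝 q, G₂ (Θ (Ψ p - G₁ p • e)) = 0 := by
    filter_upwards [hT2.eventually hr, hT3.eventually h₁.2.2.2, hT3.eventually h₂.2.2.2]
      with p hp1 hp2 hp3
    refine hp3.1 (hp2.2 ?_)
    rw [← hnΨ, hp1, map_sub, map_smul, hnΨ, he]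
    simp
  have hO1 : (fun p => Θ (Ψ p) - Θ (Ψ p - G₁ p • e)) =O[𝓝 q] G₁ := by
    have h3 := hΘs.hasStrictFDerivAt.isBigO_sub
    have h4 : Tendsto (fun p => (Ψ p, Ψ p - G₁ p • e)) (𝓝 q) (𝓝 ((0 : R3), (0 : R3))) :=
      hT1.prodMk_nhds hT2
    refine (h3.comp_tendsto h4).trans ?_
    refine IsBigO.of_bound ‖e‖ (Eventually.of_forall fun p => ?_)
    simp only [Function.comp, sub_sub_cancel, norm_smul]
    exact le_of_eq (mul_comm _ _)
  have hO2 : (fun p => G₂ p - G₂ (Θ (Ψ p - G₁ p • e))) =O[𝓝 q]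
      fun p => p - Θ (Ψ p - G₁ p • e) := by
    have h3 := h₂.2.1.hasStrictFDerivAt.isBigO_sub
    have h4 : Tendsto (fun p => (p, Θ (Ψ p - G₁ p • e))) (𝓝 q) (𝓝 (q, q)) :=
      tendsto_id.prodMk_nhds hT3
    exact h3.comp_tendsto h4
  refine (hO2.trans (hO1.congr' ?_ EventuallyEq.rfl)).congr' ?_ EventuallyEq.rfl
  · filter_upwards [hl] with p hp
    rw [hp]
  · filter_upwards [hzero] with p hp
    rw [hp, sub_zero]

theorem lineContact_iff {S : Set R3} {q : R3} {G : R3 → ℝ} (h : IsDefining S q G) (w : R3) (k : ℕ) :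
    LineContact S q w k ↔ (fun t : ℝ => G (q + t • w)) =O[𝓝 0] (fun t : ℝ => t ^ k) := by
  refine ⟨?_, fun hO => ⟨G, h, hO⟩⟩
  rintro ⟨G', h', hO⟩
  refine IsBigO.trans ?_ hO
  have : Tendsto (fun t : ℝ => q + t • w) (𝓝 0) (𝓝 q) := by
    have : Continuous (fun t : ℝ => q + t • w) := by fun_prop
    simpa using this.tendsto 0
  exact (h'.isBigO h).comp_tendsto this

/-- The gradients of two regular local equations are proportional. -/
theorem isConormal_iff {S : Set R3} {q : R3} {G : R3 → ℝ} (h : IsDefining S q G)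
    (n : R3 →L[ℝ] ℝ) : IsConormal S q n ↔ ∃ c : ℝ, c ≠ 0 ∧ n = c • fderiv ℝ G q := by
  constructor
  · rintro ⟨G', h', rfl⟩
    have hker : ∀ v, fderiv ℝ G q v = 0 → fderiv ℝ G' q v = 0 := by
      intro v hv
      have hline : HasDerivAt (fun t : ℝ => q + t • v) v 0 := by
        simpa using ((hasDerivAt_id (0 : ℝ)).smul_const v).const_add q
      have d1 : HasDerivAt (fun t : ℝ => G (q + t • v)) (fderiv ℝ G q v) 0 := by
        have : HasFDerivAt G (fderiv ℝ G q) (q + (0 : ℝ) • v) := by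
          simpa using h.2.1.differentiableAt.hasFDerivAt
        exact this.comp_hasDerivAt 0 hline
      have d2 : HasDerivAt (fun t : ℝ => G' (q + t • v)) (fderiv ℝ G' q v) 0 := by
        have : HasFDerivAt G' (fderiv ℝ G' q) (q + (0 : ℝ) • v) := by
          simpa using h'.2.1.differentiableAt.hasFDerivAt
        exact this.comp_hasDerivAt 0 hline
      have l1 : (fun t : ℝ => G (q + t • v)) =o[𝓝 0] fun t : ℝ => t := by
        simpa [hv, h.eq_zero] using d1.isLittleO
      have l2 : (fun t : ℝ => G' (q + t • v)) =o[𝓝 0] fun t : ℝ => t := by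
        refine IsBigO.trans_isLittleO ?_ l1
        have : Tendsto (fun t : ℝ => q + t • v) (𝓝 0) (𝓝 q) := by
          simpa using hline.continuousAt.tendsto
        exact (h.isBigO h').comp_tendsto this
      refine d2.unique ?_
      rw [hasDerivAt_iff_isLittleO]
      simpa [h'.eq_zero] using l2
    obtain ⟨e, he⟩ : ∃ e, fderiv ℝ G q e = 1 := by
      obtain ⟨v, hv⟩ : ∃ v, fderiv ℝ G q v ≠ 0 := by
        by_contra hne
        push Not at hne
        exact h.2.2.1 (ContinuousLinearMap.ext hne)
      exact ⟨(fderiv ℝ G q v)⁻¹ • v, by simp [hv]⟩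
    have hprop : fderiv ℝ G' q = fderiv ℝ G' q e • fderiv ℝ G q := by
      ext1 v
      have := hker (v - fderiv ℝ G q v • e) (by simp [he])
      simp only [map_sub, map_smul, smul_eq_mul, sub_eq_zero] at this
      simp [this, mul_comm]
    refine ⟨_, fun h0 => h'.2.2.1 ?_, hprop⟩
    rw [hprop, h0, zero_smul]
  · rintro ⟨c, hc, rfl⟩
    have hd : fderiv ℝ (fun p => c * G p) q = c • fderiv ℝ G q :=
      (h.2.1.differentiableAt.hasFDerivAt.const_mul c).fderiv
    refine ⟨fun p => c * G p, ⟨h.1, (smoothNear_const c q).mul h.2.1, ?_, ?_⟩, hd⟩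
    · rw [hd]
      exact smul_ne_zero hc h.2.2.1
    · filter_upwards [h.2.2.2] with p hp
      rw [hp]
      simp [hc]

theorem tangentDirections_eq {S : Set R3} {q : R3} {G : R3 → ℝ} (h : IsDefining S q G) :
    tangentDirections S q = LinearMap.ker (fderiv ℝ G q : R3 →ₗ[ℝ] ℝ) := by
  apply le_antisymm
  · exact iInf₂_le (fderiv ℝ G q) ⟨G, h, rfl⟩
  · refine le_iInf₂ fun n hn => ?_
    obtain ⟨c, -, rfl⟩ := (isConormal_iff h n).1 hn
    intro v hv
    simp only [LinearMap.mem_ker, ContinuousLinearMap.coe_coe] at hv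
    simp [hv]

/-- A regular local equation at a point is one at every nearby point of the surface. -/
theorem IsDefining.eventually {S : Set R3} {q : R3} {G : R3 → ℝ} (h : IsDefining S q G) :
    ∀ᶠ p in 𝓝 q, p ∈ S → IsDefining S p G := by
  have hc : ContinuousAt (fun p => fderiv ℝ G p) q :=
    (h.2.1.contDiffAt.fderiv_right (m := ∞) (by simp)).continuousAt
  filter_upwards [h.2.1.eventually, hc.eventually_ne h.2.2.1, eventually_eventually_nhds.2 h.2.2.2]
    with p h1 h2 h3 hp
  exact ⟨hp, h1, h2, h3⟩

/-! ### Projective transformations -/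

section Projective

variable (A : (Fin 4 → ℝ) ≃ₗ[ℝ] (Fin 4 → ℝ)) {p : R3}

theorem homogeneous_projMap (hp : A ![p 0, p 1, p 2, 1] 3 ≠ 0) :
    ![projMap A p 0, projMap A p 1, projMap A p 2, 1] =
      (A ![p 0, p 1, p 2, 1] 3)⁻¹ • A ![p 0, p 1, p 2, 1] := by
  ext i
  fin_cases i <;> simp [projMap, div_eq_inv_mul, hp]

theorem projMap_symm_den (hp : A ![p 0, p 1, p 2, 1] 3 ≠ 0) :
    A.symm ![projMap A p 0, projMap A p 1, projMap A p 2, 1] 3 ≠ 0 := by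
  rw [homogeneous_projMap A hp, map_smul, LinearEquiv.symm_apply_apply]
  simpa using hp

theorem projMap_symm_projMap (hp : A ![p 0, p 1, p 2, 1] 3 ≠ 0) :
    projMap A.symm (projMap A p) = p := by
  ext i
  rw [projMap, homogeneous_projMap A hp, map_smul, LinearEquiv.symm_apply_apply]
  fin_cases i <;> simp <;> field_simp

theorem contDiff_homogeneous (i : Fin 4) :
    ContDiff ℝ ∞ fun p : R3 => A ![p 0, p 1, p 2, 1] i := by
  have h1 : ContDiff ℝ ∞ fun p : R3 => (![p 0, p 1, p 2, 1] : Fin 4 → ℝ) := by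
    refine contDiff_pi.2 fun j => ?_
    fin_cases j
    · exact contDiff_apply ℝ ℝ (0 : Fin 3)
    · exact contDiff_apply ℝ ℝ (1 : Fin 3)
    · exact contDiff_apply ℝ ℝ (2 : Fin 3)
    · exact contDiff_const
  exact (contDiff_apply ℝ ℝ i).comp
    ((LinearMap.toContinuousLinearMap (A : (Fin 4 → ℝ) →ₗ[ℝ] (Fin 4 → ℝ))).contDiff.comp h1)

theorem smoothNear_projMap (hp : A ![p 0, p 1, p 2, 1] 3 ≠ 0) : SmoothNear (projMap A) p :=
  SmoothNear.pi fun i => ((contDiff_homogeneous A i.castSucc).smoothNear p).div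
    ((contDiff_homogeneous A 3).smoothNear p) hp

theorem eventually_den_ne_zero (hp : A ![p 0, p 1, p 2, 1] 3 ≠ 0) :
    ∀ᶠ p' : R3 in 𝓝 p, A ![p' 0, p' 1, p' 2, 1] 3 ≠ 0 :=
  (contDiff_homogeneous A 3).continuous.continuousAt.eventually_ne hp

theorem fderiv_leftInverse {E F : Type*} [NormedAddCommGroup E] [NormedSpace ℝ E]
    [NormedAddCommGroup F] [NormedSpace ℝ F] {f : E → F} {g : F → E} {x : E}
    (hf : SmoothNear f x) (hg : SmoothNear g (f x)) (h : ∀ᶠ y in 𝓝 x, g (f y) = y) (v : E) :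
    fderiv ℝ g (f x) (fderiv ℝ f x v) = v := by
  have h1 := hg.differentiableAt.hasFDerivAt.comp x hf.differentiableAt.hasFDerivAt
  have h2 : HasFDerivAt (fun y => g (f y)) (ContinuousLinearMap.id ℝ E) x :=
    (hasFDerivAt_id x).congr_of_eventuallyEq h
  have := h1.unique h2
  exact DFunLike.congr_fun this v

theorem bijective_fderiv_projMap (hp : A ![p 0, p 1, p 2, 1] 3 ≠ 0) :
    Function.Bijective (fderiv ℝ (projMap A) p) := by
  have hinj : Function.Injective (fderiv ℝ (projMap A) p) :=
    Function.LeftInverse.injective (g := fderiv ℝ (projMap A.symm) (projMap A p)) fun v =>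
      fderiv_leftInverse (smoothNear_projMap A hp)
        (smoothNear_projMap A.symm (projMap_symm_den A hp))
        ((eventually_den_ne_zero A hp).mono fun p' hp' => projMap_symm_projMap A hp') v
  exact ⟨hinj, (LinearMap.injective_iff_surjective
    (f := (fderiv ℝ (projMap A) p : R3 →ₗ[ℝ] R3))).1 hinj⟩

/-- The linear map which describes, up to a nonzero factor, the differential at `p` of
the projective transformation `A`. -/
noncomputable def projDir (A : (Fin 4 → ℝ) ≃ₗ[ℝ] (Fin 4 → ℝ)) (p : R3) : R3 →ₗ[ℝ] R3 where
  toFun w i := A ![w 0, w 1, w 2, 0] i.castSucc - projMap A p i * A ![w 0, w 1, w 2, 0] 3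
  map_add' v w := by
    have : (![(v + w) 0, (v + w) 1, (v + w) 2, 0] : Fin 4 → ℝ) =
        ![v 0, v 1, v 2, 0] + ![w 0, w 1, w 2, 0] := by
      ext i; fin_cases i <;> simp
    ext i
    rw [this]
    simp only [map_add, Pi.add_apply]
    ring
  map_smul' c w := by
    have : (![(c • w) 0, (c • w) 1, (c • w) 2, 0] : Fin 4 → ℝ) = c • ![w 0, w 1, w 2, 0] := by
      ext i; fin_cases i <;> simp
    ext i
    rw [this]
    simp only [map_smul, Pi.smul_apply, smul_eq_mul, RingHom.id_apply]
    ring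

theorem projDir_apply (w : R3) (i : Fin 3) : projDir A p w i =
    A ![w 0, w 1, w 2, 0] i.castSucc - projMap A p i * A ![w 0, w 1, w 2, 0] 3 := rfl

theorem homogeneous_add_smul (w : R3) (t : ℝ) :
    (![(p + t • w) 0, (p + t • w) 1, (p + t • w) 2, 1] : Fin 4 → ℝ) =
      ![p 0, p 1, p 2, 1] + t • ![w 0, w 1, w 2, 0] := by
  ext i; fin_cases i <;> simp

/-- A projective transformation maps lines to lines, parametrised homographically. -/
theorem projMap_line (hp : A ![p 0, p 1, p 2, 1] 3 ≠ 0) (w : R3) (t : ℝ)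
    (ht : A ![p 0, p 1, p 2, 1] 3 + t * A ![w 0, w 1, w 2, 0] 3 ≠ 0) :
    projMap A (p + t • w) = projMap A p +
      (t / (A ![p 0, p 1, p 2, 1] 3 + t * A ![w 0, w 1, w 2, 0] 3)) • projDir A p w := by
  ext i
  rw [projMap, homogeneous_add_smul]
  simp only [map_add, map_smul, Pi.add_apply, Pi.smul_apply, smul_eq_mul, projDir_apply]
  rw [projMap]
  field_simp
  ring

theorem fderiv_projMap (hp : A ![p 0, p 1, p 2, 1] 3 ≠ 0) (w : R3) :
    fderiv ℝ (projMap A) p w = (A ![p 0, p 1, p 2, 1] 3)⁻¹ • projDir A p w := by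
  set d := A ![p 0, p 1, p 2, 1] 3 with hd
  set m := A ![w 0, w 1, w 2, 0] 3 with hm
  have hline : HasDerivAt (fun t : ℝ => p + t • w) w 0 := by
    simpa using ((hasDerivAt_id (0 : ℝ)).smul_const w).const_add p
  have h1 : HasDerivAt (fun t : ℝ => projMap A (p + t • w)) (fderiv ℝ (projMap A) p w) 0 := by
    have : HasFDerivAt (projMap A) (fderiv ℝ (projMap A) p) (p + (0 : ℝ) • w) := by
      simpa using (smoothNear_projMap A hp).differentiableAt.hasFDerivAt
    exact this.comp_hasDerivAt 0 hline
  have hden : HasDerivAt (fun t : ℝ => d + t * m) m 0 := by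
    simpa using ((hasDerivAt_id (0 : ℝ)).mul_const m).const_add d
  have h2 : HasDerivAt (fun t : ℝ => projMap A p + (t / (d + t * m)) • projDir A p w)
      (d⁻¹ • projDir A p w) 0 := by
    have := (((hasDerivAt_id (0 : ℝ)).div hden (by simpa using hp)).smul_const
      (projDir A p w)).const_add (projMap A p)
    refine this.congr_deriv ?_
    have : d ≠ 0 := hp
    congr 1
    simp
    field_simp
  refine h1.unique (h2.congr_of_eventuallyEq ?_)
  have hne : ∀ᶠ t in 𝓝 (0 : ℝ), d + t * m ≠ 0 :=
    hden.continuousAt.eventually_ne (by simpa using hp)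
  filter_upwards [hne] with t ht using projMap_line A hp w t ht

theorem bijective_projDir (hp : A ![p 0, p 1, p 2, 1] 3 ≠ 0) :
    Function.Bijective (projDir A p) := by
  have hinj : Function.Injective (projDir A p) := by
    rw [← LinearMap.ker_eq_bot, LinearMap.ker_eq_bot']
    intro w hw
    have h1 : A ![w 0, w 1, w 2, 0] = A ((A ![w 0, w 1, w 2, 0] 3 / A ![p 0, p 1, p 2, 1] 3) •
        ![p 0, p 1, p 2, 1]) := by
      ext i
      refine Fin.lastCases ?_ (fun j => ?_) i
      · change A _ 3 = A _ 3
        simp only [map_smul, Pi.smul_apply, smul_eq_mul]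
        field_simp
      · have := congrFun hw j
        rw [projDir_apply, projMap] at this
        simp only [map_smul, Pi.smul_apply, smul_eq_mul]
        simp only [Pi.zero_apply, sub_eq_zero] at this
        rw [this]
        ring
    have h2 := A.injective h1
    have h3 := congrFun h2 3
    simp only [Pi.smul_apply, smul_eq_mul, Matrix.cons_val, mul_one] at h3
    rw [← h3] at h2
    ext i
    fin_cases i
    · simpa using congrFun h2 0
    · simpa using congrFun h2 1
    · simpa using congrFun h2 2
  exact ⟨hinj, LinearMap.injective_iff_surjective.1 hinj⟩

end Projective

/-! ### Surfaces as graphs in projective coordinates -/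

/-- The projective transformation `A` sends `g` to the origin and `S`, near `g`, to the graph of a
smooth function `f` with a critical point at the origin. -/
structure IsGraphChart (S : Set R3) (g : R3) (A : (Fin 4 → ℝ) ≃ₗ[ℝ] (Fin 4 → ℝ))
    (f : ℝ × ℝ → ℝ) : Prop where
  den_ne : A ![g 0, g 1, g 2, 1] 3 ≠ 0
  map_base : projMap A g = 0
  smooth : SmoothNear f 0
  zero : f 0 = 0
  px_zero : px f 0 = 0
  py_zero : py f 0 = 0
  mem_iff : ∀ᶠ p in 𝓝 g, (p ∈ S ↔ projMap A p 2 = f (projMap A p 0, projMap A p 1))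

/-- The parametrisation of the surface `z = f (x, y)` of the projective chart `A`. -/
noncomputable def graphParam (A : (Fin 4 → ℝ) ≃ₗ[ℝ] (Fin 4 → ℝ)) (f : ℝ × ℝ → ℝ) (u : ℝ × ℝ) : R3 :=
  projMap A.symm ![u.1, u.2, f u]

/-- The projection to the `(x, y)`-plane in the projective chart `A`. -/
noncomputable def planeCoord (A : (Fin 4 → ℝ) ≃ₗ[ℝ] (Fin 4 → ℝ)) (p : R3) : ℝ × ℝ :=
  (projMap A p 0, projMap A p 1)

/-- The equation `z - f (x, y)` of a graph, in the projective chart `A`. -/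
noncomputable def graphEq (A : (Fin 4 → ℝ) ≃ₗ[ℝ] (Fin 4 → ℝ)) (f : ℝ × ℝ → ℝ) (p : R3) : ℝ :=
  projMap A p 2 - f (planeCoord A p)

/-- The point of parameter `u` is a point of `S` near which `S` is the graph of `f` in the chart
`A`. -/
structure IsGraphPoint (S : Set R3) (A : (Fin 4 → ℝ) ≃ₗ[ℝ] (Fin 4 → ℝ)) (f : ℝ × ℝ → ℝ)
    (u : ℝ × ℝ) : Prop where
  den_ne : A ![graphParam A f u 0, graphParam A f u 1, graphParam A f u 2, 1] 3 ≠ 0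
  map_eq : projMap A (graphParam A f u) = ![u.1, u.2, f u]
  smooth : SmoothNear f u
  defining : IsDefining S (graphParam A f u) (graphEq A f)

section

variable {S : Set R3} {g : R3} {A : (Fin 4 → ℝ) ≃ₗ[ℝ] (Fin 4 → ℝ)} {f : ℝ × ℝ → ℝ}

theorem smoothNear_planeCoord {p : R3} (hp : A ![p 0, p 1, p 2, 1] 3 ≠ 0) :
    SmoothNear (planeCoord A) p :=
  ((smoothNear_projMap A hp).apply 0).prodMk ((smoothNear_projMap A hp).apply 1)

theorem fderiv_planeCoord {p : R3} (hp : A ![p 0, p 1, p 2, 1] 3 ≠ 0) (w : R3) :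
    fderiv ℝ (planeCoord A) p w =
      (fderiv ℝ (projMap A) p w 0, fderiv ℝ (projMap A) p w 1) := by
  have h := (smoothNear_projMap A hp).differentiableAt.hasFDerivAt
  have h' := (hasFDerivAt_pi'.1 h 0).prodMk (hasFDerivAt_pi'.1 h 1)
  exact DFunLike.congr_fun h'.fderiv w

theorem fderiv_graphEq {p : R3} (hp : A ![p 0, p 1, p 2, 1] 3 ≠ 0)
    (hf : SmoothNear f (planeCoord A p)) (w : R3) :
    fderiv ℝ (graphEq A f) p w = fderiv ℝ (projMap A) p w 2
      - px f (planeCoord A p) * fderiv ℝ (projMap A) p w 0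
      - py f (planeCoord A p) * fderiv ℝ (projMap A) p w 1 := by
  have h := (smoothNear_projMap A hp).differentiableAt.hasFDerivAt
  have h' := (hasFDerivAt_pi'.1 h 2).sub (hf.differentiableAt.hasFDerivAt.comp p
    (smoothNear_planeCoord hp).differentiableAt.hasFDerivAt)
  refine (DFunLike.congr_fun h'.fderiv w).trans ?_
  simp only [sub_apply, ContinuousLinearMap.comp_apply,
    ContinuousLinearMap.proj_apply, fderiv_eq_px_py, fderiv_planeCoord hp]
  ring

namespace IsGraphChart

variable (h : IsGraphChart S g A f)
include h

theorem mem : g ∈ S := by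
  have := h.mem_iff.self_of_nhds
  rw [this, h.map_base]
  exact h.zero.symm

theorem graphParam_zero : graphParam A f 0 = g := by
  have h1 := projMap_symm_projMap A h.den_ne
  rw [h.map_base] at h1
  rw [← h1, graphParam, h.zero]
  congr 1
  ext i; fin_cases i <;> rfl

theorem planeCoord_base : planeCoord A g = 0 := by
  rw [planeCoord, h.map_base]; rfl

theorem symm_den_ne : A.symm ![0, 0, f 0, 1] 3 ≠ 0 := by
  have := projMap_symm_den A h.den_ne
  rw [h.map_base] at this
  simpa [h.zero] using this

theorem smooth_lift : SmoothNear (fun u : ℝ × ℝ => (![u.1, u.2, f u] : R3)) 0 := by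
  refine SmoothNear.pi fun i => ?_
  fin_cases i
  · exact contDiff_fst.smoothNear 0
  · exact contDiff_snd.smoothNear 0
  · exact h.smooth

theorem smooth_graphParam : SmoothNear (graphParam A f) 0 := by
  refine (smoothNear_projMap A.symm ?_).comp h.smooth_lift
  simpa using h.symm_den_ne

theorem eventually_symm_den_ne : ∀ᶠ u : ℝ × ℝ in 𝓝 0, A.symm ![u.1, u.2, f u, 1] 3 ≠ 0 := by
  have h1 := eventually_den_ne_zero A.symm (p := ![0, 0, f 0]) (by simpa using h.symm_den_ne)
  simpa using h.smooth_lift.continuousAt.eventually h1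

theorem tendsto_graphParam : Tendsto (graphParam A f) (𝓝 0) (𝓝 g) := by
  have := h.smooth_graphParam.continuousAt.tendsto
  rwa [h.graphParam_zero] at this

theorem tendsto_planeCoord : Tendsto (planeCoord A) (𝓝 g) (𝓝 0) := by
  have := (smoothNear_planeCoord h.den_ne).continuousAt.tendsto
  rwa [h.planeCoord_base] at this

theorem eventually_projMap_graphParam :
    ∀ᶠ u : ℝ × ℝ in 𝓝 0, projMap A (graphParam A f u) = ![u.1, u.2, f u] := by
  filter_upwards [h.eventually_symm_den_ne] with u hu
  have := projMap_symm_projMap A.symm (p := ![u.1, u.2, f u]) (by simpa using hu)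
  rwa [LinearEquiv.symm_symm] at this

theorem eventually_planeCoord_graphParam :
    ∀ᶠ u : ℝ × ℝ in 𝓝 0, planeCoord A (graphParam A f u) = u := by
  filter_upwards [h.eventually_projMap_graphParam] with u hu
  simp [planeCoord, hu]

theorem eventually_mem_iff :
    ∀ᶠ p in 𝓝 g, (p ∈ S ↔ graphParam A f (planeCoord A p) = p) := by
  filter_upwards [h.mem_iff, eventually_den_ne_zero A h.den_ne,
    h.tendsto_planeCoord.eventually h.eventually_projMap_graphParam] with p h1 h2 h3
  rw [h1]
  constructor
  · intro he
    have : (![(planeCoord A p).1, (planeCoord A p).2, f (planeCoord A p)] : R3) = projMap A p := by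
      ext i; fin_cases i
      · rfl
      · rfl
      · exact he.symm
    rw [graphParam, this, projMap_symm_projMap A h2]
  · intro he
    rw [he] at h3
    exact congrFun h3 2

theorem eventually_mem : ∀ᶠ u : ℝ × ℝ in 𝓝 0, graphParam A f u ∈ S := by
  filter_upwards [h.tendsto_graphParam.eventually h.eventually_mem_iff,
    h.eventually_planeCoord_graphParam] with u h1 h2
  rw [h1, h2]

theorem isDefining : IsDefining S g (graphEq A f) := by
  have hf : SmoothNear f (planeCoord A g) := by rw [h.planeCoord_base]; exact h.smooth
  refine ⟨h.mem, ((smoothNear_projMap A h.den_ne).apply 2).sub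
    (hf.comp (smoothNear_planeCoord h.den_ne)), fun h0 => ?_, ?_⟩
  · obtain ⟨w, hw⟩ := (bijective_fderiv_projMap A h.den_ne).2 ![0, 0, 1]
    have := fderiv_graphEq h.den_ne hf w
    rw [h0, hw] at this
    simp at this
  · filter_upwards [h.mem_iff] with p hp
    rw [hp, graphEq, sub_eq_zero, planeCoord]

theorem eventually_isGraphPoint : ∀ᶠ u : ℝ × ℝ in 𝓝 0, IsGraphPoint S A f u := by
  filter_upwards [h.eventually_mem, h.tendsto_graphParam.eventually h.isDefining.eventually,
    h.eventually_projMap_graphParam, h.smooth.eventually,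
    h.tendsto_graphParam.eventually (eventually_den_ne_zero A h.den_ne)] with u h1 h2 h3 h4 h5
  exact ⟨h5, h3, h4, h2 h1⟩

end IsGraphChart

/-! ### Contact of lines with a graph -/

theorem smoothNear_affine (a b t : ℝ) : SmoothNear (fun s : ℝ => a + s * b) t :=
  (contDiff_const.add (contDiff_id.mul contDiff_const)).smoothNear t

theorem deriv_affine (a b : ℝ) : deriv (fun s : ℝ => a + s * b) = fun _ => b := by
  ext t
  simp

theorem iteratedDeriv_two_affine (a b : ℝ) : iteratedDeriv 2 (fun s : ℝ => a + s * b) = 0 := by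
  rw [iteratedDeriv_two, deriv_affine]
  ext t; simp

theorem iteratedDeriv_three_affine (a b : ℝ) : iteratedDeriv 3 (fun s : ℝ => a + s * b) = 0 := by
  rw [iteratedDeriv_succ, iteratedDeriv_two_affine]
  ext t; simp

/-- The second differential of `f` at `u`, on the vector `(a, b)`. -/
noncomputable def secondForm (f : ℝ × ℝ → ℝ) (u : ℝ × ℝ) (a b : ℝ) : ℝ :=
  px (px f) u * a ^ 2 + 2 * py (px f) u * a * b + py (py f) u * b ^ 2

/-- The third differential of `f` at `u`, on the vector `(a, b)`. -/
noncomputable def thirdForm (f : ℝ × ℝ → ℝ) (u : ℝ × ℝ) (a b : ℝ) : ℝ :=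
  px (px (px f)) u * a ^ 3 + 3 * py (px (px f)) u * a ^ 2 * b
    + 3 * py (py (px f)) u * a * b ^ 2 + py (py (py f)) u * b ^ 3

namespace IsGraphPoint

variable {u : ℝ × ℝ} (h : IsGraphPoint S A f u)
include h

theorem planeCoord_eq : planeCoord A (graphParam A f u) = u := by
  simp [planeCoord, h.map_eq]

theorem fderiv_eq (w : R3) : fderiv ℝ (graphEq A f) (graphParam A f u) w =
    (A ![graphParam A f u 0, graphParam A f u 1, graphParam A f u 2, 1] 3)⁻¹ *
      (projDir A (graphParam A f u) w 2 - px f u * projDir A (graphParam A f u) w 0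
        - py f u * projDir A (graphParam A f u) w 1) := by
  rw [fderiv_graphEq h.den_ne (by rw [h.planeCoord_eq]; exact h.smooth), h.planeCoord_eq,
    fderiv_projMap A h.den_ne]
  simp only [Pi.smul_apply, smul_eq_mul]
  ring

/-- The contact of a line with the surface is measured by the restriction of `z - f (x, y)` to the
image of this line in the chart. -/
theorem lineContact_iff_isBigO (w : R3) (k : ℕ) : LineContact S (graphParam A f u) w k ↔
    (fun s : ℝ => (f u + s * projDir A (graphParam A f u) w 2) -
      f (u.1 + s * projDir A (graphParam A f u) w 0,
        u.2 + s * projDir A (graphParam A f u) w 1)) =O[𝓝 0] fun s : ℝ => s ^ k := by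
  rw [lineContact_iff h.defining]
  set q := graphParam A f u with hq
  set d := A ![q 0, q 1, q 2, 1] 3 with hd
  set m := A ![w 0, w 1, w 2, 0] 3 with hm
  set v := projDir A q w with hv
  have hd0 : d ≠ 0 := h.den_ne
  set E : ℝ → ℝ := fun s => (f u + s * v 2) - f (u.1 + s * v 0, u.2 + s * v 1) with hE
  -- the chart reparametrises the line by `s = t / (d + t m)`, which preserves the order of vanishing
  have key : ∀ t : ℝ, d + t * m ≠ 0 → graphEq A f (q + t • w) = E (t / (d + t * m)) := by
    intro t ht
    rw [graphEq, planeCoord, projMap_line A h.den_ne w t ht, h.map_eq]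
    simp [hE]
    rfl
  have e1 : ∀ᶠ t in 𝓝 (0 : ℝ), d + t * m ≠ 0 := by
    have : ContinuousAt (fun t : ℝ => d + t * m) 0 := by fun_prop
    exact this.eventually_ne (by simpa using hd0)
  have e2 : ∀ᶠ s in 𝓝 (0 : ℝ), 1 - s * m ≠ 0 := by
    have : ContinuousAt (fun t : ℝ => 1 - t * m) 0 := by fun_prop
    exact this.eventually_ne (by simp)
  have c1 : ContinuousAt (fun t : ℝ => (d + t * m)⁻¹) 0 :=
    ContinuousAt.inv₀ (by fun_prop) (by simpa using hd0)
  have c2 : ContinuousAt (fun t : ℝ => d * (1 - t * m)⁻¹) 0 :=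
    continuousAt_const.mul (ContinuousAt.inv₀ (by fun_prop) (by simp))
  have scale : ∀ {c : ℝ → ℝ}, ContinuousAt c 0 →
      Tendsto (fun t => t * c t) (𝓝 0) (𝓝 0) ∧
      (fun t => (t * c t) ^ k) =O[𝓝 0] fun t : ℝ => t ^ k := by
    intro c hc
    constructor
    · simpa using (tendsto_id (α := ℝ) (x := 𝓝 0)).mul hc.tendsto
    · have : (fun t => t * c t) =O[𝓝 0] fun t : ℝ => t * 1 :=
        (isBigO_refl _ _).mul (hc.tendsto.isBigO_one ℝ)
      simpa using this.pow k
  constructor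
  · intro hO
    have h1 := (hO.comp_tendsto (scale c2).1).trans (scale c2).2
    refine h1.congr' ?_ EventuallyEq.rfl
    filter_upwards [e2] with s hs
    have h3 : d + s * (d * (1 - s * m)⁻¹) * m = d * (1 - s * m)⁻¹ := by field_simp; ring
    have h4 : d * (1 - s * m)⁻¹ ≠ 0 := mul_ne_zero hd0 (inv_ne_zero hs)
    simp only [Function.comp]
    rw [key _ (by rw [h3]; exact h4), h3, mul_div_assoc, div_self h4, mul_one]
  · intro hO
    have h1 := (hO.comp_tendsto (scale c1).1).trans (scale c1).2
    refine h1.congr' ?_ EventuallyEq.rfl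
    filter_upwards [e1] with t ht
    simp only [Function.comp]
    rw [key t ht, div_eq_mul_inv]

theorem lineContact_jets (w : R3) (k : ℕ) :
    LineContact S (graphParam A f u) w k ↔ ∀ j < k, iteratedDeriv j
    (fun s : ℝ => (f u + s * projDir A (graphParam A f u) w 2) -
      f (u.1 + s * projDir A (graphParam A f u) w 0,
        u.2 + s * projDir A (graphParam A f u) w 1)) 0 = 0 := by
  rw [h.lineContact_iff_isBigO]
  refine SmoothNear.isBigO_pow_iff ((smoothNear_affine _ _ 0).sub ?_) k
  refine SmoothNear.comp_of_eq (g := f) (y := u) h.smooth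
    ((smoothNear_affine _ _ 0).prodMk (smoothNear_affine _ _ 0)) (by simp)

theorem deviation_jets (a b c : ℝ) :
    (fun s : ℝ => (f u + s * c) - f (u.1 + s * a, u.2 + s * b)) 0 = 0 ∧
    deriv (fun s : ℝ => (f u + s * c) - f (u.1 + s * a, u.2 + s * b)) 0 =
      c - (px f u * a + py f u * b) ∧
    iteratedDeriv 2 (fun s : ℝ => (f u + s * c) - f (u.1 + s * a, u.2 + s * b)) 0 =
      -secondForm f u a b ∧
    iteratedDeriv 3 (fun s : ℝ => (f u + s * c) - f (u.1 + s * a, u.2 + s * b)) 0 =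
      -thirdForm f u a b := by
  have hx := smoothNear_affine u.1 a 0
  have hy := smoothNear_affine u.2 b 0
  have hu : (u.1 + 0 * a, u.2 + 0 * b) = u := by simp
  have hs : SmoothNear f (u.1 + 0 * a, u.2 + 0 * b) := by rw [hu]; exact h.smooth
  have hc : SmoothNear (fun s : ℝ => f (u.1 + s * a, u.2 + s * b)) 0 :=
    SmoothNear.comp (g := f) hs (hx.prodMk hy)
  have hz := smoothNear_affine (f u) c 0
  refine ⟨by simp, ?_, ?_, ?_⟩
  · have := iteratedDeriv_sub_of_smoothNear hz hc 1
    rw [iteratedDeriv_one, iteratedDeriv_one, iteratedDeriv_one, hs.deriv_comp₂ hx hy,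
      deriv_affine, deriv_affine, deriv_affine, hu] at this
    exact this
  · rw [iteratedDeriv_sub_of_smoothNear hz hc 2, hs.iteratedDeriv_two_comp₂ hx hy,
      deriv_affine, deriv_affine, iteratedDeriv_two_affine, iteratedDeriv_two_affine,
      iteratedDeriv_two_affine, hu, secondForm]
    simp
  · rw [iteratedDeriv_sub_of_smoothNear hz hc 3, hs.iteratedDeriv_three_comp₂ hx hy,
      deriv_affine, deriv_affine, iteratedDeriv_two_affine, iteratedDeriv_two_affine,
      iteratedDeriv_three_affine, iteratedDeriv_three_affine, iteratedDeriv_three_affine, hu,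
      thirdForm]
    simp

theorem lineContact_three_iff (w : R3) : LineContact S (graphParam A f u) w 3 ↔
    projDir A (graphParam A f u) w 2 = px f u * projDir A (graphParam A f u) w 0
      + py f u * projDir A (graphParam A f u) w 1 ∧
    secondForm f u (projDir A (graphParam A f u) w 0) (projDir A (graphParam A f u) w 1) = 0 := by
  obtain ⟨j0, j1, j2, -⟩ := h.deviation_jets (projDir A (graphParam A f u) w 0)
    (projDir A (graphParam A f u) w 1) (projDir A (graphParam A f u) w 2)
  rw [h.lineContact_jets]
  constructor
  · intro hj
    have h1 := hj 1 (by norm_num)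
    have h2 := hj 2 (by norm_num)
    rw [iteratedDeriv_one, j1, sub_eq_zero] at h1
    rw [j2, neg_eq_zero] at h2
    exact ⟨h1, h2⟩
  · rintro ⟨h1, h2⟩ j hj
    interval_cases j
    · exact j0
    · rw [iteratedDeriv_one, j1, h1, sub_self]
    · rw [j2, h2, neg_zero]

theorem lineContact_four_iff (w : R3) : LineContact S (graphParam A f u) w 4 ↔
    LineContact S (graphParam A f u) w 3 ∧
    thirdForm f u (projDir A (graphParam A f u) w 0) (projDir A (graphParam A f u) w 1) = 0 := by
  obtain ⟨-, -, -, j3⟩ := h.deviation_jets (projDir A (graphParam A f u) w 0)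
    (projDir A (graphParam A f u) w 1) (projDir A (graphParam A f u) w 2)
  rw [h.lineContact_jets, h.lineContact_jets]
  constructor
  · intro hj
    have h1 := hj 3 (by norm_num)
    rw [j3, neg_eq_zero] at h1
    exact ⟨fun j hj' => hj j (by lia), h1⟩
  · rintro ⟨h1, h2⟩ j hj
    rcases Nat.lt_succ_iff_lt_or_eq.1 hj with hj | rfl
    · exact h1 j hj
    · rw [j3, h2, neg_zero]

/-- The vectors whose image in the chart is tangent to the graph are parametrised by their
projection to the `(x, y)`-plane. -/
theorem exists_direction (a b : ℝ) : ∃ w : R3, projDir A (graphParam A f u) w =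
    ![a, b, px f u * a + py f u * b] :=
  (bijective_projDir A h.den_ne).2 _

theorem isAsymptotic_iff (w : R3) : IsAsymptotic S (graphParam A f u) w ↔ ∃ a b : ℝ,
    (a ≠ 0 ∨ b ≠ 0) ∧ secondForm f u a b = 0 ∧
    projDir A (graphParam A f u) w = ![a, b, px f u * a + py f u * b] := by
  rw [IsAsymptotic, h.lineContact_three_iff]
  constructor
  · rintro ⟨hw, h1, h2⟩
    refine ⟨_, _, ?_, h2, ?_⟩
    · by_contra hne
      push Not at hne
      refine hw ((bijective_projDir A h.den_ne).1 ?_)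
      rw [map_zero]
      ext i; fin_cases i
      · exact hne.1
      · exact hne.2
      · simpa [hne.1, hne.2] using h1
    · ext i; fin_cases i
      · rfl
      · rfl
      · exact h1
  · rintro ⟨a, b, hab, hQ, hw⟩
    refine ⟨?_, by rw [hw]; simp, by rw [hw]; simpa using hQ⟩
    rintro rfl
    rw [map_zero] at hw
    rcases hab with ha | hb
    · exact ha (by simpa using (congrFun hw 0).symm)
    · exact hb (by simpa using (congrFun hw 1).symm)

theorem mem_flecnodalCurve_iff : graphParam A f u ∈ flecnodalCurve S ↔ ∃ a b : ℝ,
    (a ≠ 0 ∨ b ≠ 0) ∧ secondForm f u a b = 0 ∧ thirdForm f u a b = 0 := by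
  constructor
  · rintro ⟨-, w, hw, hw4⟩
    obtain ⟨a, b, hab, hQ, he⟩ := (h.isAsymptotic_iff w).1 hw
    refine ⟨a, b, hab, hQ, ?_⟩
    simpa [he] using ((h.lineContact_four_iff w).1 hw4).2
  · rintro ⟨a, b, hab, hQ, hC⟩
    obtain ⟨w, he⟩ := h.exists_direction a b
    have hw := (h.isAsymptotic_iff w).2 ⟨a, b, hab, hQ, he⟩
    exact ⟨h.defining.1, w, hw, (h.lineContact_four_iff w).2 ⟨hw.2, by simpa [he] using hC⟩⟩

/-- The parabolic points are those at which the second form has exactly one isotropic line. -/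
theorem mem_parabolicCurve_iff : graphParam A f u ∈ parabolicCurve S ↔ ∃ a b : ℝ,
    (a ≠ 0 ∨ b ≠ 0) ∧ secondForm f u a b = 0 ∧
    ∀ a' b' : ℝ, secondForm f u a' b' = 0 → ∃ k : ℝ, a' = k * a ∧ b' = k * b := by
  constructor
  · rintro ⟨-, w, hw, hun⟩
    obtain ⟨a, b, hab, hQ, he⟩ := (h.isAsymptotic_iff w).1 hw
    refine ⟨a, b, hab, hQ, fun a' b' hQ' => ?_⟩
    by_cases hab' : a' ≠ 0 ∨ b' ≠ 0
    · obtain ⟨w', he'⟩ := h.exists_direction a' b'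
      obtain ⟨k, hk⟩ := Submodule.mem_span_singleton.1
        (hun w' ((h.isAsymptotic_iff w').2 ⟨a', b', hab', hQ', he'⟩))
      rw [← hk, map_smul, he] at he'
      exact ⟨k, by simpa using (congrFun he' 0).symm, by simpa using (congrFun he' 1).symm⟩
    · push Not at hab'
      exact ⟨0, by simp [hab'.1], by simp [hab'.2]⟩
  · rintro ⟨a, b, hab, hQ, hun⟩
    obtain ⟨w, he⟩ := h.exists_direction a b
    refine ⟨h.defining.1, w, (h.isAsymptotic_iff w).2 ⟨a, b, hab, hQ, he⟩, fun w' hw' => ?_⟩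
    obtain ⟨a', b', -, hQ', he'⟩ := (h.isAsymptotic_iff w').1 hw'
    obtain ⟨k, rfl, rfl⟩ := hun a' b' hQ'
    refine Submodule.mem_span_singleton.2 ⟨k, (bijective_projDir A h.den_ne).1 ?_⟩
    rw [map_smul, he, he']
    ext i; fin_cases i
    · simp
    · simp
    · simp; ring

theorem mem_parabolicCurve_iff_hessian (hyy : py (py f) u ≠ 0) :
    graphParam A f u ∈ parabolicCurve S ↔
      px (px f) u * py (py f) u - py (px f) u ^ 2 = 0 := by
  rw [h.mem_parabolicCurve_iff]
  simp only [secondForm]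
  generalize px (px f) u = r
  generalize py (px f) u = s at *
  generalize py (py f) u = t at *
  constructor
  · rintro ⟨a, b, hab, hQ, hun⟩
    have ha : a ≠ 0 := by
      rintro rfl
      simp_all
    -- the reflection of an isotropic vector in the conjugate direction is isotropic
    obtain ⟨k, h1, h2⟩ := hun a (-2 * s / t * a - b) (by field_simp; linear_combination t * hQ)
    have hk : k = 1 := by
      have : (k - 1) * a = 0 := by linear_combination -h1
      rcases mul_eq_zero.1 this with h | h
      · linarith
      · exact absurd h ha
    subst hk
    have h3 : s * a + t * b = 0 := by
      field_simp at h2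
      linear_combination (-1 / 2) * h2
    have h4 : (r * t - s ^ 2) * a ^ 2 = 0 := by
      linear_combination t * hQ - (s * a + t * b) * h3
    simpa [ha] using h4
  · intro hH
    refine ⟨t, -s, Or.inl hyy, by linear_combination t * hH, fun a b hQ => ⟨a / t, ?_, ?_⟩⟩
    · field_simp
    · have h3 : (s * a + t * b) ^ 2 = 0 := by linear_combination t * hQ - a ^ 2 * hH
      have h4 : s * a + t * b = 0 := by simpa using h3
      field_simp
      linear_combination h4

end IsGraphPoint

end

/-! ### The tangential map in a projective chart -/

/-- The coordinates of the tangent plane of the graph `z = f (x, y)` at the point of parameter `u`: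
its two slopes and its height over the origin. -/
noncomputable def legendreMap (f : ℝ × ℝ → ℝ) (u : ℝ × ℝ) : R3 :=
  ![px f u, py f u, f u - u.1 * px f u - u.2 * py f u]

/-- The pairing of the homogeneous coordinates `V` of a plane with the homogeneous coordinates `W` of
a point: the plane of coordinates `[V 0 : V 1 : V 2 : 1]` is `z = V 0 x + V 1 y + V 2`. -/
noncomputable def dualPairing (V : Fin 4 → ℝ) : (Fin 4 → ℝ) →ₗ[ℝ] ℝ where
  toFun W := -V 0 * W 0 - V 1 * W 1 + V 3 * W 2 - V 2 * W 3
  map_add' W W' := by simp only [Pi.add_apply]; ring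
  map_smul' c W := by simp only [Pi.smul_apply, smul_eq_mul, RingHom.id_apply]; ring

theorem dualPairing_apply (V W : Fin 4 → ℝ) :
    dualPairing V W = -V 0 * W 0 - V 1 * W 1 + V 3 * W 2 - V 2 * W 3 := rfl

theorem dualPairing_add (V V' W : Fin 4 → ℝ) :
    dualPairing (V + V') W = dualPairing V W + dualPairing V' W := by
  simp only [dualPairing_apply, Pi.add_apply]; ring

theorem dualPairing_smul (c : ℝ) (V W : Fin 4 → ℝ) :
    dualPairing (c • V) W = c * dualPairing V W := by
  simp only [dualPairing_apply, Pi.smul_apply, smul_eq_mul]; ring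

theorem eq_zero_of_dualPairing {V : Fin 4 → ℝ} (h : ∀ W, dualPairing V W = 0) : V = 0 := by
  ext i
  fin_cases i
  · simpa [dualPairing_apply] using h ![1, 0, 0, 0]
  · simpa [dualPairing_apply] using h ![0, 1, 0, 0]
  · simpa [dualPairing_apply] using h ![0, 0, 0, 1]
  · simpa [dualPairing_apply] using h ![0, 0, 1, 0]

/-- The homogeneous coordinates of the vectors of the affine space. -/
def vectorEmb : R3 →ₗ[ℝ] (Fin 4 → ℝ) where
  toFun w := ![w 0, w 1, w 2, 0]
  map_add' v w := by ext i; fin_cases i <;> simp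
  map_smul' c w := by ext i; fin_cases i <;> simp

theorem vectorEmb_apply (w : R3) : vectorEmb w = ![w 0, w 1, w 2, 0] := rfl

theorem homogeneous_eq (w : R3) : (![w 0, w 1, w 2, 1] : Fin 4 → ℝ) =
    vectorEmb w + ![0, 0, 0, 1] := by
  ext i; fin_cases i <;> simp [vectorEmb_apply]

/-- The linear map on homogeneous coordinates of planes which goes from the chart `A` to the affine
chart of the dual space given by the frame `b`. -/
noncomputable def dualMap (A : (Fin 4 → ℝ) ≃ₗ[ℝ] (Fin 4 → ℝ)) (b : Module.Basis (Fin 3) ℝ R3) :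
    (Fin 4 → ℝ) →ₗ[ℝ] (Fin 4 → ℝ) where
  toFun V := ![dualPairing V (A (vectorEmb (b 0))), dualPairing V (A (vectorEmb (b 1))),
    -dualPairing V (A ![0, 0, 0, 1]), dualPairing V (A (vectorEmb (b 2)))]
  map_add' V V' := by
    ext i
    fin_cases i
    · simp [dualPairing_add]
    · simp [dualPairing_add]
    · simp [dualPairing_add]; ring
    · simp [dualPairing_add]
  map_smul' c V := by
    ext i
    fin_cases i <;> simp [dualPairing_smul]

theorem injective_dualMap (A : (Fin 4 → ℝ) ≃ₗ[ℝ] (Fin 4 → ℝ)) (b : Module.Basis (Fin 3) ℝ R3) :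
    Function.Injective (dualMap A b) := by
  rw [← LinearMap.ker_eq_bot, LinearMap.ker_eq_bot']
  intro V hV
  have h0 : dualPairing V (A (vectorEmb (b 0))) = 0 := congrFun hV 0
  have h1 : dualPairing V (A (vectorEmb (b 1))) = 0 := congrFun hV 1
  have h2 : dualPairing V (A (vectorEmb (b 2))) = 0 := congrFun hV 3
  have h3 : dualPairing V (A ![0, 0, 0, 1]) = 0 := neg_eq_zero.1 (congrFun hV 2)
  have hl : dualPairing V ∘ₗ (A : (Fin 4 → ℝ) →ₗ[ℝ] (Fin 4 → ℝ)) ∘ₗ vectorEmb = 0 := by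
    refine b.ext fun i => ?_
    fin_cases i
    · exact h0
    · exact h1
    · exact h2
  refine eq_zero_of_dualPairing fun W => ?_
  obtain ⟨X, rfl⟩ := A.surjective W
  have hX : X = vectorEmb ![X 0, X 1, X 2] + X 3 • ![0, 0, 0, 1] := by
    ext i; fin_cases i <;> simp [vectorEmb_apply]
  rw [hX, map_add, map_add, map_smul, map_smul, h3, smul_zero, add_zero]
  exact LinearMap.congr_fun hl _

/-- The change of charts of the dual projective space from the chart `A` to the frame `b`. -/
noncomputable def dualEquiv (A : (Fin 4 → ℝ) ≃ₗ[ℝ] (Fin 4 → ℝ)) (b : Module.Basis (Fin 3) ℝ R3) :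
    (Fin 4 → ℝ) ≃ₗ[ℝ] (Fin 4 → ℝ) :=
  LinearEquiv.ofInjectiveEndo (dualMap A b) (injective_dualMap A b)

theorem dualEquiv_apply (A : (Fin 4 → ℝ) ≃ₗ[ℝ] (Fin 4 → ℝ)) (b : Module.Basis (Fin 3) ℝ R3)
    (V : Fin 4 → ℝ) : dualEquiv A b V =
    ![dualPairing V (A (vectorEmb (b 0))), dualPairing V (A (vectorEmb (b 1))),
      -dualPairing V (A ![0, 0, 0, 1]), dualPairing V (A (vectorEmb (b 2)))] := rfl

section

variable {S : Set R3} {g : R3} {A : (Fin 4 → ℝ) ≃ₗ[ℝ] (Fin 4 → ℝ)} {f : ℝ × ℝ → ℝ}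

theorem smoothNear_legendreMap {u : ℝ × ℝ} (h : SmoothNear f u) :
    SmoothNear (legendreMap f) u := by
  refine SmoothNear.pi fun i => ?_
  fin_cases i
  · exact h.partial_x
  · exact h.partial_y
  · exact (h.sub ((contDiff_fst.smoothNear u).mul h.partial_x)).sub
      ((contDiff_snd.smoothNear u).mul h.partial_y)

theorem legendreMap_zero (hf : f 0 = 0) (hx : px f 0 = 0) (hy : py f 0 = 0) :
    legendreMap f 0 = 0 := by
  ext i; fin_cases i <;> simp [legendreMap, hf, hx, hy]

namespace IsGraphPoint

variable {u : ℝ × ℝ} (h : IsGraphPoint S A f u)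
include h

theorem fderiv_eq_dualPairing (w : R3) : fderiv ℝ (graphEq A f) (graphParam A f u) w =
    (A ![graphParam A f u 0, graphParam A f u 1, graphParam A f u 2, 1] 3)⁻¹ *
      dualPairing ![legendreMap f u 0, legendreMap f u 1, legendreMap f u 2, 1]
        (A (vectorEmb w)) := by
  rw [h.fderiv_eq]
  congr 1
  simp only [projDir_apply, h.map_eq, dualPairing_apply, legendreMap, vectorEmb_apply]
  simp
  ring

theorem fderiv_self : fderiv ℝ (graphEq A f) (graphParam A f u) (graphParam A f u) =
    -((A ![graphParam A f u 0, graphParam A f u 1, graphParam A f u 2, 1] 3)⁻¹ *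
      dualPairing ![legendreMap f u 0, legendreMap f u 1, legendreMap f u 2, 1]
        (A ![0, 0, 0, 1])) := by
  rw [h.fderiv_eq_dualPairing]
  have h1 : vectorEmb (graphParam A f u) = ![graphParam A f u 0, graphParam A f u 1,
      graphParam A f u 2, 1] - ![0, 0, 0, 1] := by
    rw [homogeneous_eq (graphParam A f u), add_sub_cancel_right]
  have h2 := homogeneous_projMap A h.den_ne
  rw [h.map_eq] at h2
  have h3 : dualPairing ![legendreMap f u 0, legendreMap f u 1, legendreMap f u 2, 1]
      (A ![graphParam A f u 0, graphParam A f u 1, graphParam A f u 2, 1]) = 0 := by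
    have h4 : dualPairing ![legendreMap f u 0, legendreMap f u 1, legendreMap f u 2, 1]
        ![(![u.1, u.2, f u] : R3) 0, (![u.1, u.2, f u] : R3) 1, (![u.1, u.2, f u] : R3) 2, 1]
        = 0 := by
      simp [dualPairing_apply, legendreMap]; ring
    rw [h2, map_smul, smul_eq_mul] at h4
    exact (mul_eq_zero.1 h4).resolve_left (inv_ne_zero h.den_ne)
  rw [h1, map_sub, map_sub, h3]
  ring

theorem normalizedConormal_eq (b : Module.Basis (Fin 3) ℝ R3)
    (hb : fderiv ℝ (graphEq A f) (graphParam A f u) (b 2) ≠ 0) :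
    normalizedConormal S b (graphParam A f u) =
      (fderiv ℝ (graphEq A f) (graphParam A f u) (b 2))⁻¹ •
        fderiv ℝ (graphEq A f) (graphParam A f u) := by
  set n := fderiv ℝ (graphEq A f) (graphParam A f u)
  have hex : ∃ m, IsConormal S (graphParam A f u) m ∧ m (b 2) = 1 :=
    ⟨(n (b 2))⁻¹ • n, (isConormal_iff h.defining _).2 ⟨_, inv_ne_zero hb, rfl⟩, by simp [hb]⟩
  obtain ⟨h1, h2⟩ := Classical.epsilon_spec hex
  obtain ⟨c, -, hc⟩ := (isConormal_iff h.defining _).1 h1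
  rw [hc] at h2
  change Classical.epsilon _ = _
  rw [hc]
  congr 1
  exact eq_inv_of_mul_eq_one_left h2

theorem tangentialMap_eq (b : Module.Basis (Fin 3) ℝ R3)
    (hb : dualEquiv A b ![legendreMap f u 0, legendreMap f u 1, legendreMap f u 2, 1] 3 ≠ 0) :
    tangentialMap S b (graphParam A f u) = projMap (dualEquiv A b) (legendreMap f u) := by
  have hd := inv_ne_zero h.den_ne
  have hb' : fderiv ℝ (graphEq A f) (graphParam A f u) (b 2) ≠ 0 := by
    rw [h.fderiv_eq_dualPairing]
    exact mul_ne_zero hd hb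
  rw [tangentialMap, h.normalizedConormal_eq b hb']
  simp only [smul_apply, smul_eq_mul]
  rw [h.fderiv_self]
  simp only [h.fderiv_eq_dualPairing, mul_inv]
  rw [dualEquiv_apply] at hb
  ext i
  simp only [projMap, dualEquiv_apply]
  set d := (A ![graphParam A f u 0, graphParam A f u 1, graphParam A f u 2, 1] 3)⁻¹
  fin_cases i
  · simp; field_simp
  · simp; field_simp
  · simp; field_simp

end IsGraphPoint

namespace IsGraphChart

variable (h : IsGraphChart S g A f)
include h

theorem smooth_legendreMap : SmoothNear (legendreMap f) 0 := smoothNear_legendreMap h.smooth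

theorem legendreMap_base : legendreMap f 0 = 0 :=
  legendreMap_zero h.zero h.px_zero h.py_zero

theorem isGraphPoint : IsGraphPoint S A f 0 := h.eventually_isGraphPoint.self_of_nhds

theorem isTransverse_iff (b : Module.Basis (Fin 3) ℝ R3) :
    IsTransverse S g b ↔ fderiv ℝ (graphEq A f) g (b 2) ≠ 0 := by
  constructor
  · rintro ⟨n, hn, hn1⟩ h0
    obtain ⟨c, -, rfl⟩ := (isConormal_iff h.isDefining n).1 hn
    simp [h0] at hn1
  · intro h0
    exact ⟨_, (isConormal_iff h.isDefining _).2 ⟨_, inv_ne_zero h0, rfl⟩, by simp [h0]⟩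

theorem dualEquiv_den_ne {b : Module.Basis (Fin 3) ℝ R3} (hb : IsTransverse S g b) :
    dualEquiv A b ![(0 : R3) 0, (0 : R3) 1, (0 : R3) 2, 1] 3 ≠ 0 := by
  have h1 := (h.isTransverse_iff b).1 hb
  have h2 := h.isGraphPoint.fderiv_eq_dualPairing (b 2)
  rw [h.graphParam_zero, h.legendreMap_base] at h2
  rw [h2] at h1
  exact right_ne_zero_of_mul h1

theorem eventually_tangentialMap_eq {b : Module.Basis (Fin 3) ℝ R3} (hb : IsTransverse S g b) :
    ∀ᶠ u in 𝓝 0, tangentialMap S b (graphParam A f u) =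
      projMap (dualEquiv A b) (legendreMap f u) := by
  have h1 := h.smooth_legendreMap.continuousAt
  rw [ContinuousAt, h.legendreMap_base] at h1
  filter_upwards [h.eventually_isGraphPoint,
    h1.eventually (eventually_den_ne_zero _ (h.dualEquiv_den_ne hb))] with u h2 h3
  exact h2.tangentialMap_eq b h3

theorem exists_isTransverse : ∃ b : Module.Basis (Fin 3) ℝ R3, IsTransverse S g b := by
  by_contra hne
  push Not at hne
  refine h.isDefining.2.2.1 ?_
  have h1 : ∀ σ : Equiv.Perm (Fin 3),
      fderiv ℝ (graphEq A f) g (Pi.basisFun ℝ (Fin 3) (σ 2)) = 0 := by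
    intro σ
    have := (h.isTransverse_iff ((Pi.basisFun ℝ (Fin 3)).reindex σ.symm)).not.1 (hne _)
    simpa using this
  refine ContinuousLinearMap.coe_injective ((Pi.basisFun ℝ (Fin 3)).ext fun i => ?_)
  simpa using h1 (Equiv.swap i 2)

end IsGraphChart

/-- Two points of a graph have a common tangent plane if and only if their parameters have the
same image under the Legendre map. -/
theorem IsGraphPoint.same_tangent_iff {u v : ℝ × ℝ} (hu : IsGraphPoint S A f u)
    (hv : IsGraphPoint S A f v) :
    (∃ n, IsConormal S (graphParam A f u) n ∧ IsConormal S (graphParam A f v) n ∧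
      n (graphParam A f v - graphParam A f u) = 0) ↔ legendreMap f u = legendreMap f v := by
  constructor
  · rintro ⟨n, hnu, hnv, hn⟩
    obtain ⟨c, hc, hcn⟩ := (isConormal_iff hu.defining _).1 hnu
    obtain ⟨d, hd, hdn⟩ := (isConormal_iff hv.defining _).1 hnv
    set du := (A ![graphParam A f u 0, graphParam A f u 1, graphParam A f u 2, 1] 3)⁻¹ with hdu
    set dv := (A ![graphParam A f v 0, graphParam A f v 1, graphParam A f v 2, 1] 3)⁻¹ with hdv
    have hu0 : du ≠ 0 := inv_ne_zero hu.den_ne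
    have hv0 : dv ≠ 0 := inv_ne_zero hv.den_ne
    set U : Fin 4 → ℝ := ![legendreMap f u 0, legendreMap f u 1, legendreMap f u 2, 1] with hU
    set V : Fin 4 → ℝ := ![legendreMap f v 0, legendreMap f v 1, legendreMap f v 2, 1] with hV
    -- the two planes have the same pairing with all vectors and with the origin
    have e1 : ∀ w, dualPairing ((c * du) • U - (d * dv) • V) (A (vectorEmb w)) = 0 := by
      intro w
      have h1 : n w = c * (du * dualPairing U (A (vectorEmb w))) := by
        rw [hcn, smul_apply, hu.fderiv_eq_dualPairing, smul_eq_mul]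
      have h2 : n w = d * (dv * dualPairing V (A (vectorEmb w))) := by
        rw [hdn, smul_apply, hv.fderiv_eq_dualPairing, smul_eq_mul]
      rw [sub_eq_add_neg, ← neg_smul, dualPairing_add, dualPairing_smul, dualPairing_smul]
      linear_combination h2 - h1
    have e2 : dualPairing ((c * du) • U - (d * dv) • V) (A ![0, 0, 0, 1]) = 0 := by
      have h1 : n (graphParam A f u) = -(c * (du * dualPairing U (A ![0, 0, 0, 1]))) := by
        rw [hcn, smul_apply, hu.fderiv_self, smul_eq_mul]
        ring
      have h2 : n (graphParam A f v) = -(d * (dv * dualPairing V (A ![0, 0, 0, 1]))) := by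
        rw [hdn, smul_apply, hv.fderiv_self, smul_eq_mul]
        ring
      rw [map_sub] at hn
      rw [sub_eq_add_neg, ← neg_smul, dualPairing_add, dualPairing_smul, dualPairing_smul]
      linear_combination hn + h1 - h2
    have e3 : (c * du) • U - (d * dv) • V = 0 := by
      refine eq_zero_of_dualPairing fun W => ?_
      obtain ⟨X, rfl⟩ := A.surjective W
      have hX : X = vectorEmb ![X 0, X 1, X 2] + X 3 • ![0, 0, 0, 1] := by
        ext i; fin_cases i <;> simp [vectorEmb_apply]
      rw [hX, map_add, map_add, map_smul, map_smul, e1, e2, smul_zero, add_zero]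
    have e4 : c * du = d * dv := by
      simpa [hU, hV, sub_eq_zero] using congrFun e3 3
    have e5 : U = V := by
      rw [e4, ← smul_sub] at e3
      exact sub_eq_zero.1 ((smul_eq_zero.1 e3).resolve_left (mul_ne_zero hd hv0))
    ext i
    fin_cases i
    · exact congrFun e5 0
    · exact congrFun e5 1
    · exact congrFun e5 2
  · intro he
    set du := (A ![graphParam A f u 0, graphParam A f u 1, graphParam A f u 2, 1] 3)⁻¹ with hdu
    set dv := (A ![graphParam A f v 0, graphParam A f v 1, graphParam A f v 2, 1] 3)⁻¹ with hdv
    have hu0 : du ≠ 0 := inv_ne_zero hu.den_ne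
    have hv0 : dv ≠ 0 := inv_ne_zero hv.den_ne
    have e1 : fderiv ℝ (graphEq A f) (graphParam A f u) =
        (du / dv) • fderiv ℝ (graphEq A f) (graphParam A f v) := by
      ext1 w
      rw [smul_apply, hu.fderiv_eq_dualPairing, hv.fderiv_eq_dualPairing, he,
        smul_eq_mul, ← hdu, ← hdv]
      field_simp
    refine ⟨fderiv ℝ (graphEq A f) (graphParam A f u),
      (isConormal_iff hu.defining _).2 ⟨1, one_ne_zero, by simp⟩,
      (isConormal_iff hv.defining _).2 ⟨du / dv, div_ne_zero hu0 hv0, e1⟩, ?_⟩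
    rw [map_sub, hu.fderiv_self, e1, smul_apply, hv.fderiv_self, he, smul_eq_mul,
      ← hdu, ← hdv]
    field_simp
    ring

end

/-! ### Germs of regular curves -/

/-- `γ` parametrises `C` near `g`, and the smooth function `π` recovers the parameter. -/
structure IsLocalArc (C : Set R3) (g : R3) (γ : ℝ → R3) (π : R3 → ℝ) : Prop where
  smooth : SmoothNear γ 0
  base : γ 0 = g
  smooth_param : SmoothNear π g
  left_inv : ∀ᶠ t in 𝓝 0, π (γ t) = t
  mem_iff : ∀ᶠ p in 𝓝 g, (p ∈ C ↔ γ (π p) = p)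

namespace IsLocalArc

variable {C : Set R3} {g : R3} {γ : ℝ → R3} {π : R3 → ℝ} (h : IsLocalArc C g γ π)
include h

theorem deriv_ne_zero : deriv γ 0 ≠ 0 := by
  intro h0
  have h1 : deriv (fun t => π (γ t)) 0 = 1 := by
    rw [EventuallyEq.deriv_eq (f := fun t : ℝ => t) h.left_inv]
    simp
  have hs : SmoothNear π (γ 0) := by rw [h.base]; exact h.smooth_param
  rw [hs.deriv_comp h.smooth, h0, map_zero] at h1
  exact zero_ne_one h1

theorem isArc : IsArc C g γ := by
  refine ⟨h.smooth, h.base, h.deriv_ne_zero, ?_⟩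
  obtain ⟨η, hη, hb⟩ := Metric.eventually_nhds_iff_ball.1 h.left_inv
  have hπ0 : π g = 0 := by rw [← h.base]; exact h.left_inv.self_of_nhds
  filter_upwards [Ioo_mem_nhdsGT hη] with ε hε
  have hπ : ∀ᶠ p in 𝓝 g, π p ∈ Set.Ioo (-ε) ε := by
    refine h.smooth_param.continuousAt.eventually ?_
    rw [hπ0]
    exact Ioo_mem_nhds (neg_lt_zero.2 hε.1) hε.1
  filter_upwards [h.mem_iff, hπ] with p h1 h2
  rw [h1]
  constructor
  · exact fun he => ⟨π p, h2, he⟩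
  · rintro ⟨t, ht, rfl⟩
    rw [hb t]
    rw [Metric.mem_ball, dist_zero_right, Real.norm_eq_abs]
    exact (abs_lt.2 ht).trans hε.2

/-- Any other regular parametrisation of the same germ of curve is a reparametrisation. -/
theorem exists_reparam {δ : ℝ → R3} (hδ : IsArc C g δ) : ∃ s : ℝ → ℝ, SmoothNear s 0 ∧ s 0 = 0 ∧
    deriv s 0 ≠ 0 ∧ δ =ᶠ[𝓝 0] fun t => γ (s t) := by
  obtain ⟨hs, h0, hd, hev⟩ := hδ
  have hπ0 : π g = 0 := by rw [← h.base]; exact h.left_inv.self_of_nhds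
  have hT : Tendsto δ (𝓝 0) (𝓝 g) := by simpa [ContinuousAt, h0] using hs.continuousAt
  have hsm : SmoothNear (fun t => π (δ t)) 0 := h.smooth_param.comp_of_eq hs h0
  have hs0 : π (δ 0) = 0 := by rw [h0, hπ0]
  have heq : δ =ᶠ[𝓝 0] fun t => γ (π (δ t)) := by
    obtain ⟨ε, hε, hε0⟩ := (hev.and self_mem_nhdsWithin).exists
    have hI : ∀ᶠ t in 𝓝 (0 : ℝ), t ∈ Set.Ioo (-ε) ε :=
      Ioo_mem_nhds (neg_lt_zero.2 hε0) hε0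
    filter_upwards [hT.eventually hε, hT.eventually h.mem_iff, hI] with t h1 h2 h3
    exact (h2.1 (h1.2 ⟨t, h3, rfl⟩)).symm
  refine ⟨fun t => π (δ t), hsm, hs0, fun hz => hd ?_, heq⟩
  have hγ : HasDerivAt γ (deriv γ 0) (π (δ 0)) := by rw [hs0]; exact h.smooth.hasDerivAt
  have := hγ.scomp (0 : ℝ) hsm.hasDerivAt
  rw [hz, zero_smul] at this
  exact (this.congr_of_eventuallyEq heq).deriv

end IsLocalArc

/-! ### Two-jets in the normal form -/

theorem HasJet.unique {A : (Fin 4 → ℝ) ≃ₗ[ℝ] (Fin 4 → ℝ)} {γ : ℝ → R3} {c c' : ℝ}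
    (h : HasJet A γ c) (h' : HasJet A γ c') : c = c' := by
  obtain ⟨-, -, hx, -, hc⟩ := h
  obtain ⟨-, -, -, -, hc'⟩ := h'
  rw [hc] at hc'
  have := mul_right_cancel₀ (pow_ne_zero 2 hx) hc'
  linarith

theorem HasJet.congr {A : (Fin 4 → ℝ) ≃ₗ[ℝ] (Fin 4 → ℝ)} {γ δ : ℝ → R3} {c : ℝ}
    (h : HasJet A γ c) (e : δ =ᶠ[𝓝 0] γ) : HasJet A δ c := by
  have e0 : (fun t => projMap A (δ t) 0) =ᶠ[𝓝 0] fun t => projMap A (γ t) 0 := by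
    filter_upwards [e] with t ht; rw [ht]
  have e1 : (fun t => projMap A (δ t) 1) =ᶠ[𝓝 0] fun t => projMap A (γ t) 1 := by
    filter_upwards [e] with t ht; rw [ht]
  rw [HasJet, e.self_of_nhds, e0.deriv_eq, e1.deriv_eq,
    (iteratedDeriv_congr_nhds e1 2).self_of_nhds]
  exact h

theorem HasJet.comp {A : (Fin 4 → ℝ) ≃ₗ[ℝ] (Fin 4 → ℝ)} {γ : ℝ → R3} {c : ℝ}
    (h : HasJet A γ c) (hγ : SmoothNear γ 0) (hA : A ![γ 0 0, γ 0 1, γ 0 2, 1] 3 ≠ 0)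
    {s : ℝ → ℝ} (hs : SmoothNear s 0) (hs0 : s 0 = 0) (hs1 : deriv s 0 ≠ 0) :
    HasJet A (fun t => γ (s t)) c := by
  obtain ⟨h0, h1, hx, hy, hc⟩ := h
  have hΦ := (smoothNear_projMap A hA).comp hγ
  have d : ∀ i : Fin 3, deriv (fun t => projMap A (γ (s t)) i) 0 =
      deriv (fun t => projMap A (γ t) i) 0 * deriv s 0 := by
    intro i
    have hd := (hΦ.apply i).hasDerivAt
    rw [← hs0] at hd
    refine (hd.comp (0 : ℝ) hs.hasDerivAt).deriv.trans ?_
    rw [hs0]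
  have d2 : iteratedDeriv 2 (fun t => projMap A (γ (s t)) 1) 0 =
      iteratedDeriv 2 (fun t => projMap A (γ t) 1) 0 * deriv s 0 ^ 2 +
        deriv (fun t => projMap A (γ t) 1) 0 * iteratedDeriv 2 s 0 := by
    have hY : ContDiffAt ℝ 2 (fun t => projMap A (γ t) 1) (s 0) := by
      rw [hs0]
      exact (hΦ.apply 1).contDiffAt.of_le (WithTop.coe_le_coe.2 le_top)
    have := iteratedDeriv_comp_two hY (hs.contDiffAt.of_le (WithTop.coe_le_coe.2 le_top))
    rw [hs0] at this
    exact this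
  refine ⟨by simpa [hs0] using h0, by simpa [hs0] using h1, ?_, ?_, ?_⟩
  · rw [d]; exact mul_ne_zero hx hs1
  · rw [d, hy, zero_mul]
  · rw [d2, d, hy, hc]; ring

theorem IsLocalArc.hasJet {C : Set R3} {g : R3} {γ : ℝ → R3} {π : R3 → ℝ}
    (h : IsLocalArc C g γ π) {A : (Fin 4 → ℝ) ≃ₗ[ℝ] (Fin 4 → ℝ)}
    (hA : A ![g 0, g 1, g 2, 1] 3 ≠ 0) {c : ℝ} (hc : HasJet A γ c) {δ : ℝ → R3}
    (hδ : IsArc C g δ) : HasJet A δ c := by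
  obtain ⟨s, hs, hs0, hs1, e⟩ := h.exists_reparam hδ
  exact (hc.comp h.smooth (by rw [h.base]; exact hA) hs hs0 hs1).congr e

section

variable {S : Set R3} {g : R3} {A : (Fin 4 → ℝ) ≃ₗ[ℝ] (Fin 4 → ℝ)} {f : ℝ × ℝ → ℝ}

namespace IsGraphChart

variable (h : IsGraphChart S g A f)
include h

theorem eventually_projMap_curve {x y : ℝ → ℝ} (hx : SmoothNear x 0) (hy : SmoothNear y 0)
    (hx0 : x 0 = 0) (hy0 : y 0 = 0) : ∀ᶠ t in 𝓝 (0 : ℝ),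
      projMap A (graphParam A f (x t, y t)) = ![x t, y t, f (x t, y t)] := by
  have hT : Tendsto (fun t => (x t, y t)) (𝓝 0) (𝓝 (0 : ℝ × ℝ)) := by
    have := (hx.prodMk hy).continuousAt.tendsto
    rw [hx0, hy0] at this
    exact this
  exact hT.eventually h.eventually_projMap_graphParam

theorem hasJet_graphParam {x y : ℝ → ℝ} (hx : SmoothNear x 0) (hy : SmoothNear y 0)
    (hx0 : x 0 = 0) (hy0 : y 0 = 0) {c : ℝ} :
    HasJet A (fun t => graphParam A f (x t, y t)) c ↔ deriv x 0 ≠ 0 ∧ deriv y 0 = 0 ∧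
      iteratedDeriv 2 y 0 = 2 * c * deriv x 0 ^ 2 := by
  have e := h.eventually_projMap_curve hx hy hx0 hy0
  have e0 : (fun t => projMap A (graphParam A f (x t, y t)) 0) =ᶠ[𝓝 0] x := by
    filter_upwards [e] with t ht; rw [ht]; rfl
  have e1 : (fun t => projMap A (graphParam A f (x t, y t)) 1) =ᶠ[𝓝 0] y := by
    filter_upwards [e] with t ht; rw [ht]; rfl
  rw [HasJet, e0.deriv_eq, e1.deriv_eq, (iteratedDeriv_congr_nhds e1 2).self_of_nhds,
    e.self_of_nhds]
  simp [hx0, hy0]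

theorem isCurveOn_graphParam {x y : ℝ → ℝ} (hx : SmoothNear x 0) (hy : SmoothNear y 0)
    (hx0 : x 0 = 0) (hy0 : y 0 = 0) : IsCurveOn S g (fun t => graphParam A f (x t, y t)) := by
  have h0 : (x 0, y 0) = (0 : ℝ × ℝ) := by rw [hx0, hy0]; rfl
  have hT := (hx.prodMk hy).continuousAt.tendsto
  rw [h0] at hT
  refine ⟨h.smooth_graphParam.comp_of_eq (hx.prodMk hy) h0, ?_, hT.eventually h.eventually_mem⟩
  change graphParam A f (x 0, y 0) = g
  rw [h0, h.graphParam_zero]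

/-- A curve of the surface is the lift of its projection to the `(x, y)`-plane. -/
theorem exists_plane_curve {γ : ℝ → R3} (hγ : IsCurveOn S g γ) : ∃ x y : ℝ → ℝ,
    SmoothNear x 0 ∧ SmoothNear y 0 ∧ x 0 = 0 ∧ y 0 = 0 ∧
      γ =ᶠ[𝓝 0] fun t => graphParam A f (x t, y t) := by
  obtain ⟨hs, h0, hS⟩ := hγ
  have hΦ : SmoothNear (fun t => projMap A (γ t)) 0 :=
    (smoothNear_projMap A h.den_ne).comp_of_eq hs h0
  have hT : Tendsto γ (𝓝 0) (𝓝 g) := by simpa [ContinuousAt, h0] using hs.continuousAt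
  refine ⟨fun t => projMap A (γ t) 0, fun t => projMap A (γ t) 1, hΦ.apply 0, hΦ.apply 1,
    by simp [h0, h.map_base], by simp [h0, h.map_base], ?_⟩
  filter_upwards [hS, hT.eventually h.eventually_mem_iff] with t h1 h2
  exact (h2.1 h1).symm

/-- A germ of regular curve of the surface, described in the `(x, y)`-plane. -/
theorem isLocalArc {C : Set R3} (hCS : ∀ᶠ p in 𝓝 g, p ∈ C → p ∈ S) {δ : ℝ → ℝ × ℝ}
    {ϖ : ℝ × ℝ → ℝ} (hδ : SmoothNear δ 0) (hδ0 : δ 0 = 0) (hϖ : SmoothNear ϖ 0)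
    (hl : ∀ᶠ t in 𝓝 0, ϖ (δ t) = t)
    (hC : ∀ᶠ u in 𝓝 0, (graphParam A f u ∈ C ↔ δ (ϖ u) = u)) :
    IsLocalArc C g (fun t => graphParam A f (δ t)) (fun p => ϖ (planeCoord A p)) := by
  have hT : Tendsto δ (𝓝 0) (𝓝 0) := by simpa [ContinuousAt, hδ0] using hδ.continuousAt
  have hϖ0 : ϖ 0 = 0 := by rw [← hδ0]; exact hl.self_of_nhds
  have hTϖ : Tendsto ϖ (𝓝 0) (𝓝 0) := by simpa [ContinuousAt, hϖ0] using hϖ.continuousAt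
  refine ⟨h.smooth_graphParam.comp_of_eq hδ hδ0, by rw [hδ0, h.graphParam_zero],
    hϖ.comp_of_eq (smoothNear_planeCoord h.den_ne) h.planeCoord_base, ?_, ?_⟩
  · filter_upwards [hl, hT.eventually h.eventually_planeCoord_graphParam] with t h1 h2
    rw [h2, h1]
  · filter_upwards [h.eventually_mem_iff, hCS, h.tendsto_planeCoord.eventually hC,
      ((hT.comp hTϖ).comp h.tendsto_planeCoord).eventually h.eventually_planeCoord_graphParam]
      with p h1 h2 h3 h4
    simp only [Function.comp] at h4
    constructor
    · intro hp
      have h5 := h1.1 (h2 hp)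
      rw [h5] at h3
      rw [h3.1 hp, h5]
    · intro he
      rw [he] at h4
      rw [← h4] at he
      rw [← he]
      exact h3.2 h4.symm

end IsGraphChart

end

/-! ### Implicit functions -/

theorem bijective_of_injective {E : Type*} [NormedAddCommGroup E] [NormedSpace ℝ E]
    [FiniteDimensional ℝ E] (L : E →L[ℝ] E) (h : ∀ v, L v = 0 → v = 0) :
    Function.Bijective L := by
  have hinj : Function.Injective (L : E →ₗ[ℝ] E) :=
    LinearMap.ker_eq_bot.1 (LinearMap.ker_eq_bot'.2 h)
  exact ⟨hinj, LinearMap.injective_iff_surjective.1 hinj⟩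

/-- The zero set of a smooth function on `E × ℝ`, where its derivative along `ℝ` does not vanish, is
the graph of a smooth function on `E`. -/
theorem exists_implicit_function {E : Type*} [NormedAddCommGroup E] [NormedSpace ℝ E]
    [FiniteDimensional ℝ E] {H : E × ℝ → ℝ} (hH : SmoothNear H 0) (h0 : H 0 = 0)
    (hy : fderiv ℝ H 0 (0, 1) ≠ 0) : ∃ c : E → ℝ, SmoothNear c 0 ∧ c 0 = 0 ∧
      ∀ᶠ u : E × ℝ in 𝓝 0, (H u = 0 ↔ c u.1 = u.2) := by
  let Θ : E × ℝ → E × ℝ := fun u => (u.1, H u)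
  have hΘ : SmoothNear Θ 0 := (contDiff_fst.smoothNear 0).prodMk hH
  have hΘ0 : Θ 0 = 0 := by simp [Θ, h0]
  have hd : ∀ v, fderiv ℝ Θ 0 v = (v.1, fderiv ℝ H 0 v) := by
    intro v
    have := (hasFDerivAt_fst (𝕜 := ℝ) (E := E) (F := ℝ) (p := 0)).prodMk
      hH.differentiableAt.hasFDerivAt
    exact DFunLike.congr_fun this.fderiv v
  obtain ⟨Ξ, hΞ, hΞ0, hl, hr⟩ := hΘ.exists_local_inverse (bijective_of_injective _ (by
    rintro ⟨a, b⟩ hv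
    rw [hd] at hv
    simp only [Prod.mk_eq_zero] at hv ⊢
    refine ⟨hv.1, ?_⟩
    have h2 : ((a, b) : E × ℝ) = b • (0, 1) := by simp [hv.1]
    have h3 := hv.2
    rw [h2, map_smul, smul_eq_mul] at h3
    exact (mul_eq_zero.1 h3).resolve_right hy))
  rw [hΘ0] at hΞ hΞ0 hr
  have hline : SmoothNear (fun t : E => (t, (0 : ℝ))) 0 :=
    (contDiff_id.prodMk contDiff_const).smoothNear 0
  have hc : SmoothNear (fun t : E => (Ξ (t, 0)).2) 0 := (hΞ.comp_of_eq hline rfl).snd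
  have hT : Tendsto (fun u : E × ℝ => (u.1, (0 : ℝ))) (𝓝 0) (𝓝 0) := by
    have : Continuous fun u : E × ℝ => (u.1, (0 : ℝ)) := by fun_prop
    exact this.tendsto' 0 0 rfl
  refine ⟨fun t => (Ξ (t, 0)).2, hc, ?_, ?_⟩
  · change (Ξ 0).2 = 0
    rw [hΞ0]; rfl
  · filter_upwards [hl, hT.eventually hr] with u h1 h2
    constructor
    · intro hu
      have : Θ u = (u.1, 0) := by simp [Θ, hu]
      rw [this] at h1
      rw [h1]
    · intro hu
      have e1 : (Ξ (u.1, 0)).1 = u.1 := (Prod.ext_iff.1 h2).1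
      have e2 : Ξ (u.1, 0) = u := Prod.ext e1 hu
      rw [e2] at h2
      exact (Prod.ext_iff.1 h2).2

/-! ### The parabolic and flecnodal curves of a normal form -/

/-- The Taylor coefficients of `y²/2 - x² y + r x⁴/2`, up to terms `x^i y^j` with `i + 2 j ≥ 5`,
beyond the `1`-jet. -/
structure IsNormalJet (f : ℝ × ℝ → ℝ) (r : ℝ) : Prop where
  xx : px (px f) 0 = 0
  yx : py (px f) 0 = 0
  yy : py (py f) 0 = 1
  xxx : px (px (px f)) 0 = 0
  yxx : py (px (px f)) 0 = -2
  xxxx : px (px (px (px f))) 0 = 12 * r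

section

variable {S : Set R3} {g : R3} {A : (Fin 4 → ℝ) ≃ₗ[ℝ] (Fin 4 → ℝ)} {f : ℝ × ℝ → ℝ} {r : ℝ}

theorem smoothNear_id : SmoothNear (fun t : ℝ => t) 0 := contDiff_id.smoothNear 0

theorem iteratedDeriv_two_id : iteratedDeriv 2 (fun t : ℝ => t) 0 = 0 := by
  simpa using congrFun (iteratedDeriv_two_affine 0 1) 0

/-- The first and second derivatives at `0` of the restriction to a curve of the entries of the
Hessian matrix of a normal form. -/
theorem IsNormalJet.hessian_curve (hj : IsNormalJet f r) (hf : SmoothNear f 0) {x y : ℝ → ℝ}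
    (hx : SmoothNear x 0) (hy : SmoothNear y 0) (hx0 : x 0 = 0) (hy0 : y 0 = 0) :
    deriv (fun t => px (px f) (x t, y t)) 0 = -2 * deriv y 0 ∧
    deriv (fun t => py (px f) (x t, y t)) 0 =
      -2 * deriv x 0 + py (py (px f)) 0 * deriv y 0 ∧
    (deriv y 0 = 0 → iteratedDeriv 2 (fun t => px (px f) (x t, y t)) 0 =
      12 * r * deriv x 0 ^ 2 - 2 * iteratedDeriv 2 y 0) := by
  have h0 : (x 0, y 0) = (0 : ℝ × ℝ) := by rw [hx0, hy0]; rfl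
  have hf0 : SmoothNear f (x 0, y 0) := by rw [h0]; exact hf
  refine ⟨?_, ?_, fun hy1 => ?_⟩
  · rw [hf0.partial_x.partial_x.deriv_comp₂ hx hy, h0, hj.xxx, hj.yxx]; ring
  · rw [hf0.partial_x.partial_y.deriv_comp₂ hx hy, h0, px_py hf.partial_x, hj.yxx]
  · rw [hf0.partial_x.partial_x.iteratedDeriv_two_comp₂ hx hy, h0, hj.xxx, hj.yxx, hj.xxxx, hy1]
    ring

theorem eventually_mem_of_subset {C : Set R3} (h : C ⊆ S) : ∀ᶠ p in 𝓝 g, p ∈ C → p ∈ S :=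
  Eventually.of_forall fun _ hp => h hp

/-- The Hessian determinant of `f`. -/
noncomputable def hessianDet (f : ℝ × ℝ → ℝ) (u : ℝ × ℝ) : ℝ :=
  px (px f) u * py (py f) u - py (px f) u * py (px f) u

theorem smoothNear_hessianDet {u : ℝ × ℝ} (hf : SmoothNear f u) : SmoothNear (hessianDet f) u :=
  (hf.partial_x.partial_x.mul hf.partial_y.partial_y).sub
    (hf.partial_x.partial_y.mul hf.partial_x.partial_y)

theorem IsNormalJet.hessianDet_curve (hj : IsNormalJet f r) (hf : SmoothNear f 0) {x y : ℝ → ℝ}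
    (hx : SmoothNear x 0) (hy : SmoothNear y 0) (hx0 : x 0 = 0) (hy0 : y 0 = 0) :
    deriv (fun t => hessianDet f (x t, y t)) 0 = -2 * deriv y 0 ∧
    (deriv y 0 = 0 → iteratedDeriv 2 (fun t => hessianDet f (x t, y t)) 0 =
      (12 * r - 8) * deriv x 0 ^ 2 - 2 * iteratedDeriv 2 y 0) := by
  have h0 : (x 0, y 0) = (0 : ℝ × ℝ) := by rw [hx0, hy0]; rfl
  have hxy := hx.prodMk hy
  obtain ⟨d1, d2, d3⟩ := hj.hessian_curve hf hx hy hx0 hy0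
  have s1 : SmoothNear (fun t => px (px f) (x t, y t)) 0 :=
    hf.partial_x.partial_x.comp_of_eq hxy h0
  have s2 : SmoothNear (fun t => py (py f) (x t, y t)) 0 :=
    hf.partial_y.partial_y.comp_of_eq hxy h0
  have s3 : SmoothNear (fun t => py (px f) (x t, y t)) 0 :=
    hf.partial_x.partial_y.comp_of_eq hxy h0
  refine ⟨?_, fun hy1 => ?_⟩
  · have := iteratedDeriv_sub_of_smoothNear (s1.mul s2) (s3.mul s3) 1
    simp only [iteratedDeriv_one] at this
    refine this.trans ?_
    rw [deriv_mul_of_smoothNear s1 s2, deriv_mul_of_smoothNear s3 s3, d1, d2, h0, hj.xx, hj.yx,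
      hj.yy]
    ring
  · have := iteratedDeriv_sub_of_smoothNear (s1.mul s2) (s3.mul s3) 2
    refine this.trans ?_
    rw [iteratedDeriv_two_mul s1 s2, iteratedDeriv_two_mul s3 s3, d1, d2, d3 hy1, hy1, h0, hj.xx,
      hj.yx, hj.yy]
    ring

theorem IsNormalJet.py_hessianDet (hj : IsNormalJet f r) (hf : SmoothNear f 0) :
    py (hessianDet f) 0 = -2 := by
  have h1 := (hj.hessianDet_curve hf (smoothNear_const 0 0) smoothNear_id rfl rfl).1
  have h2 : SmoothNear (hessianDet f) ((fun _ : ℝ => (0 : ℝ)) 0, (fun t : ℝ => t) 0) :=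
    smoothNear_hessianDet hf
  rw [h2.deriv_comp₂ (smoothNear_const 0 0) smoothNear_id] at h1
  change _ * _ + py (hessianDet f) 0 * _ = _ at h1
  simpa using h1

/-- The parabolic curve is the zero set of the Hessian determinant. -/
theorem IsGraphChart.exists_parabolic_arc (h : IsGraphChart S g A f) (hj : IsNormalJet f r) :
    ∃ γ π, IsLocalArc (parabolicCurve S) g γ π ∧ HasJet A γ (3 * r - 2) := by
  have hf := h.smooth
  obtain ⟨c, hc, hc0, hev⟩ := exists_implicit_function (smoothNear_hessianDet hf)
    (by simp [hessianDet, hj.xx, hj.yx])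
    (by change py (hessianDet f) 0 ≠ 0; rw [hj.py_hessianDet hf]; norm_num)
  have hz : (fun t => hessianDet f (t, c t)) =ᶠ[𝓝 0] fun _ => 0 := by
    have hT : Tendsto (fun t => (t, c t)) (𝓝 0) (𝓝 (0 : ℝ × ℝ)) := by
      have := (smoothNear_id.prodMk hc).continuousAt.tendsto
      rwa [hc0] at this
    filter_upwards [hT.eventually hev] with t ht using ht.2 rfl
  obtain ⟨e1, e2⟩ := hj.hessianDet_curve hf smoothNear_id hc rfl hc0
  rw [hz.deriv_eq] at e1
  have hc1 : deriv c 0 = 0 := by simpa using e1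
  have e3 := e2 hc1
  rw [(iteratedDeriv_congr_nhds hz 2).self_of_nhds] at e3
  refine ⟨_, _, h.isLocalArc (δ := fun t => (t, c t)) (ϖ := Prod.fst)
    (eventually_mem_of_subset fun p hp => hp.1) (smoothNear_id.prodMk hc) (by rw [hc0]; rfl)
    (contDiff_fst.smoothNear 0) (Eventually.of_forall fun t => rfl) ?_, ?_⟩
  · have hyy : ∀ᶠ u in 𝓝 (0 : ℝ × ℝ), py (py f) u ≠ 0 :=
      hf.partial_y.partial_y.continuousAt.eventually_ne (by rw [hj.yy]; exact one_ne_zero)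
    filter_upwards [h.eventually_isGraphPoint, hyy, hev] with u h1 h2 h3
    rw [h1.mem_parabolicCurve_iff_hessian h2, pow_two]
    refine h3.trans ⟨fun e => Prod.ext rfl e, fun e => congrArg Prod.snd e⟩
  · rw [h.hasJet_graphParam smoothNear_id hc rfl hc0]
    have : deriv (fun t : ℝ => t) 0 = 1 := by simp
    rw [this] at e3 ⊢
    refine ⟨one_ne_zero, hc1, ?_⟩
    simp at e3
    linear_combination (1 / 2) * e3

/-- The equations, in the unknowns `(x, y)` and the slope `m`, for a line to have four-point contact
with the graph of `f`. -/
noncomputable def flecnodalMap (f : ℝ × ℝ → ℝ) (v : (ℝ × ℝ) × ℝ) : (ℝ × ℝ) × ℝ :=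
  ((v.1.1, secondForm f v.1 1 v.2), thirdForm f v.1 1 v.2)

theorem smoothNear_flecnodalMap (hf : SmoothNear f 0) : SmoothNear (flecnodalMap f) 0 := by
  have s : ∀ {k : ℝ × ℝ → ℝ}, SmoothNear k 0 → SmoothNear (fun v : (ℝ × ℝ) × ℝ => k v.1) 0 :=
    fun hk => hk.comp_of_eq (contDiff_fst.smoothNear 0) rfl
  have m : SmoothNear (fun v : (ℝ × ℝ) × ℝ => v.2) 0 := contDiff_snd.smoothNear 0
  have c : ∀ a : ℝ, SmoothNear (fun _ : (ℝ × ℝ) × ℝ => a) 0 := fun a => smoothNear_const a 0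
  refine (SmoothNear.prodMk ((contDiff_fst.comp contDiff_fst).smoothNear 0) ?_).prodMk ?_
  · exact (((s hf.partial_x.partial_x).mul (c _)).add
      ((((c 2).mul (s hf.partial_x.partial_y)).mul (c 1)).mul m)).add
        ((s hf.partial_y.partial_y).mul (m.pow 2))
  · exact ((((s hf.partial_x.partial_x.partial_x).mul (c _)).add
      ((((c 3).mul (s hf.partial_x.partial_x.partial_y)).mul (c _)).mul m)).add
        ((((c 3).mul (s hf.partial_x.partial_y.partial_y)).mul (c 1)).mul (m.pow 2))).add
          ((s hf.partial_y.partial_y.partial_y).mul (m.pow 3))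

/-- The jets of the two flecnodal equations along a curve. -/
theorem IsNormalJet.flecnodal_curve (hj : IsNormalJet f r) (hf : SmoothNear f 0) {x y m : ℝ → ℝ}
    (hx : SmoothNear x 0) (hy : SmoothNear y 0) (hm : SmoothNear m 0)
    (hx0 : x 0 = 0) (hy0 : y 0 = 0) (hm0 : m 0 = 0) :
    deriv (fun t => secondForm f (x t, y t) 1 (m t)) 0 = -2 * deriv y 0 ∧
    deriv (fun t => thirdForm f (x t, y t) 1 (m t)) 0 =
      12 * r * deriv x 0 + py (px (px (px f))) 0 * deriv y 0 - 6 * deriv m 0 ∧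
    (deriv y 0 = 0 → iteratedDeriv 2 (fun t => secondForm f (x t, y t) 1 (m t)) 0 =
      12 * r * deriv x 0 ^ 2 - 2 * iteratedDeriv 2 y 0 - 8 * deriv x 0 * deriv m 0
        + 2 * deriv m 0 ^ 2) := by
  have h0 : (x 0, y 0) = (0 : ℝ × ℝ) := by rw [hx0, hy0]; rfl
  have hxy := hx.prodMk hy
  have s : ∀ {k : ℝ × ℝ → ℝ}, SmoothNear k 0 → SmoothNear (fun t => k (x t, y t)) 0 :=
    fun hk => hk.comp_of_eq hxy h0
  have c : ∀ a : ℝ, SmoothNear (fun _ : ℝ => a) 0 := fun a => smoothNear_const a 0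
  obtain ⟨d1, d2, d3⟩ := hj.hessian_curve hf hx hy hx0 hy0
  have eQ : (fun t => secondForm f (x t, y t) 1 (m t)) = fun t => px (px f) (x t, y t) +
      m t * (2 * py (px f) (x t, y t) + m t * py (py f) (x t, y t)) := by
    funext t; rw [secondForm]; ring
  have eC : (fun t => thirdForm f (x t, y t) 1 (m t)) = fun t => px (px (px f)) (x t, y t) +
      m t * (3 * py (px (px f)) (x t, y t) + m t * (3 * py (py (px f)) (x t, y t) +
        m t * py (py (py f)) (x t, y t))) := by
    funext t; rw [thirdForm]; ring
  have sxx := s hf.partial_x.partial_x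
  have syx := s hf.partial_x.partial_y
  have syy := s hf.partial_y.partial_y
  have sB := ((c 2).mul syx).add (hm.mul syy)
  have dB : deriv (fun t => 2 * py (px f) (x t, y t) + m t * py (py f) (x t, y t)) 0 =
      2 * (-2 * deriv x 0 + py (py (px f)) 0 * deriv y 0) + deriv m 0 := by
    have := iteratedDeriv_add_of_smoothNear ((c 2).mul syx) (hm.mul syy) 1
    simp only [iteratedDeriv_one] at this
    rw [this, deriv_mul_of_smoothNear (c 2) syx, deriv_mul_of_smoothNear hm syy, d2, h0, hj.yy, hm0]
    simp
  refine ⟨?_, ?_, fun hy1 => ?_⟩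
  · have := iteratedDeriv_add_of_smoothNear sxx (hm.mul sB) 1
    simp only [iteratedDeriv_one] at this
    rw [eQ, this, deriv_mul_of_smoothNear hm sB, d1, h0, hm0, hj.yx]
    ring
  · have sxxx := s hf.partial_x.partial_x.partial_x
    have sD := ((c 3).mul (s hf.partial_x.partial_x.partial_y)).add
      (hm.mul (((c 3).mul (s hf.partial_x.partial_y.partial_y)).add
        (hm.mul (s hf.partial_y.partial_y.partial_y))))
    have := iteratedDeriv_add_of_smoothNear sxxx (hm.mul sD) 1
    simp only [iteratedDeriv_one] at this
    have hf3 : SmoothNear (px (px (px f))) (x 0, y 0) := by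
      rw [h0]; exact hf.partial_x.partial_x.partial_x
    rw [eC, this, deriv_mul_of_smoothNear hm sD, hf3.deriv_comp₂ hx hy, h0, hm0, hj.xxxx, hj.yxx]
    ring
  · rw [eQ, iteratedDeriv_add_of_smoothNear sxx (hm.mul sB) 2, iteratedDeriv_two_mul hm sB, d3 hy1,
      dB, h0, hm0, hj.yx, hy1]
    ring

theorem IsNormalJet.bijective_fderiv_flecnodalMap (hj : IsNormalJet f r) (hf : SmoothNear f 0) :
    Function.Bijective (fderiv ℝ (flecnodalMap f) 0) := by
  refine bijective_of_injective _ ?_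
  rintro ⟨⟨a, b⟩, c⟩ hv
  have hs := smoothNear_flecnodalMap hf
  have l : ∀ a : ℝ, SmoothNear (fun t : ℝ => 0 + t * a) 0 := fun a => smoothNear_affine 0 a 0
  obtain ⟨d1, d2, -⟩ := hj.flecnodal_curve hf (l a) (l b) (l c) (by simp) (by simp) (by simp)
  have hline : HasDerivAt (fun t : ℝ => (((0 + t * a, 0 + t * b), 0 + t * c) : (ℝ × ℝ) × ℝ))
      ((a, b), c) 0 := by
    have e : ∀ a : ℝ, HasDerivAt (fun t : ℝ => 0 + t * a) a 0 := fun a => by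
      simpa using ((hasDerivAt_id (0 : ℝ)).mul_const a).const_add 0
    exact ((e a).prodMk (e b)).prodMk (e c)
  have hd : HasFDerivAt (flecnodalMap f) (fderiv ℝ (flecnodalMap f) 0)
      ((0 + (0 : ℝ) * a, 0 + (0 : ℝ) * b), 0 + (0 : ℝ) * c) := by
    have e : (((0 + (0 : ℝ) * a, 0 + (0 : ℝ) * b), 0 + (0 : ℝ) * c) : (ℝ × ℝ) × ℝ) = 0 := by
      simp
    rw [e]
    exact hs.differentiableAt.hasFDerivAt
  have key := hd.comp_hasDerivAt (0 : ℝ) hline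
  rw [hv] at key
  have kf := (ContinuousLinearMap.fst ℝ (ℝ × ℝ) ℝ).hasFDerivAt.comp_hasDerivAt (0 : ℝ) key
  have k1 : HasDerivAt (fun t : ℝ => 0 + t * a) 0 0 :=
    (ContinuousLinearMap.fst ℝ ℝ ℝ).hasFDerivAt.comp_hasDerivAt (0 : ℝ) kf
  have k2 : HasDerivAt (fun t : ℝ => secondForm f (0 + t * a, 0 + t * b) 1 (0 + t * c)) 0 0 :=
    (ContinuousLinearMap.snd ℝ ℝ ℝ).hasFDerivAt.comp_hasDerivAt (0 : ℝ) kf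
  have k3 : HasDerivAt (fun t : ℝ => thirdForm f (0 + t * a, 0 + t * b) 1 (0 + t * c)) 0 0 :=
    (ContinuousLinearMap.snd ℝ (ℝ × ℝ) ℝ).hasFDerivAt.comp_hasDerivAt (0 : ℝ) key
  have k1' := k1.deriv
  rw [k2.deriv] at d1
  rw [k3.deriv] at d2
  simp only [deriv_affine] at k1' d1 d2
  have hb : b = 0 := by linarith
  subst k1' hb
  simp at d2
  simp [d2]

/-- Near the origin all asymptotic slopes are close to the slope `0` of the asymptotic line there. -/
theorem IsNormalJet.eventually_slope_small (hj : IsNormalJet f r) (hf : SmoothNear f 0)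
    {ε : ℝ} (hε : 0 < ε) : ∀ᶠ u in 𝓝 (0 : ℝ × ℝ), ∀ m, secondForm f u 1 m = 0 → |m| < ε := by
  -- if `|f_xx|, |f_xy| < η` and `f_yy > 1/2`, a root satisfies `m² / 2 < η + 2 η |m|`, while
  -- `|m| ≥ ε` would give `η < m² / 16` and `2 η |m| < m² / 8`
  obtain ⟨η, hη0, hη1, hη2⟩ : ∃ η : ℝ, 0 < η ∧ 16 * η < ε ∧ 16 * η < ε ^ 2 := by
    refine ⟨min ε (ε ^ 2) / 32, by positivity, ?_, ?_⟩
    · have := min_le_left ε (ε ^ 2); linarith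
    · have := min_le_right ε (ε ^ 2)
      have : 0 < ε ^ 2 := by positivity
      linarith
  have c1 := hf.partial_x.partial_x.continuousAt.norm
  have c2 := hf.partial_x.partial_y.continuousAt.norm
  have c3 := hf.partial_y.partial_y.continuousAt
  have e1 : ∀ᶠ u in 𝓝 (0 : ℝ × ℝ), ‖px (px f) u‖ < η :=
    c1.eventually_lt continuousAt_const (by simpa [hj.xx] using hη0)
  have e2 : ∀ᶠ u in 𝓝 (0 : ℝ × ℝ), ‖py (px f) u‖ < η :=
    c2.eventually_lt continuousAt_const (by simpa [hj.yx] using hη0)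
  have e3 : ∀ᶠ u in 𝓝 (0 : ℝ × ℝ), 1 / 2 < py (py f) u :=
    continuousAt_const.eventually_lt c3 (by rw [hj.yy]; norm_num)
  filter_upwards [e1, e2, e3] with u h1 h2 h3 m hm
  rw [Real.norm_eq_abs] at h1 h2
  rw [secondForm] at hm
  by_contra! hcon
  have a1 : 1 / 2 * |m| ^ 2 ≤ py (py f) u * m ^ 2 := by
    rw [sq_abs]; nlinarith [sq_nonneg m]
  have a2 : -(py (px f) u * m) ≤ η * |m| := by
    have := neg_abs_le (py (px f) u * m)
    rw [abs_mul] at this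
    nlinarith [abs_nonneg m]
  have a3 := neg_abs_le (px (px f) u)
  nlinarith [abs_nonneg m, mul_le_mul hcon hcon hε.le (abs_nonneg m)]

theorem IsGraphPoint.mem_flecnodalCurve_iff_slope {u : ℝ × ℝ} (h : IsGraphPoint S A f u)
    (hyy : py (py f) u ≠ 0) : graphParam A f u ∈ flecnodalCurve S ↔
      ∃ m, secondForm f u 1 m = 0 ∧ thirdForm f u 1 m = 0 := by
  rw [h.mem_flecnodalCurve_iff]
  constructor
  · rintro ⟨a, b, hab, h2, h3⟩
    have ha : a ≠ 0 := by
      rintro rfl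
      simp [secondForm] at h2 hab
      tauto
    refine ⟨b / a, ?_, ?_⟩
    · have : secondForm f u a b = a ^ 2 * secondForm f u 1 (b / a) := by
        simp only [secondForm]; field_simp
      rw [this] at h2
      exact (mul_eq_zero.1 h2).resolve_left (pow_ne_zero 2 ha)
    · have : thirdForm f u a b = a ^ 3 * thirdForm f u 1 (b / a) := by
        simp only [thirdForm]; field_simp
      rw [this] at h3
      exact (mul_eq_zero.1 h3).resolve_left (pow_ne_zero 3 ha)
  · rintro ⟨m, h2, h3⟩
    exact ⟨1, m, Or.inl one_ne_zero, h2, h3⟩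

/-- The flecnodal curve is the projection of a curve in the space of pairs (point, slope). -/
theorem IsGraphChart.exists_flecnodal_arc (h : IsGraphChart S g A f) (hj : IsNormalJet f r) :
    ∃ γ π, IsLocalArc (flecnodalCurve S) g γ π ∧ HasJet A γ (r * (2 * r - 1)) := by
  have hf := h.smooth
  have hΘ0 : flecnodalMap f 0 = 0 := by
    simp [flecnodalMap, secondForm, thirdForm, hj.xx, hj.xxx]
  obtain ⟨Ξ, hΞ, hΞ0, hl, hr⟩ := (smoothNear_flecnodalMap hf).exists_local_inverse
    (hj.bijective_fderiv_flecnodalMap hf)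
  rw [hΘ0] at hΞ hΞ0 hr
  have hline : SmoothNear (fun t : ℝ => ((t, (0 : ℝ)), (0 : ℝ))) 0 :=
    ((contDiff_id.prodMk contDiff_const).prodMk contDiff_const).smoothNear 0
  have hξ : SmoothNear (fun t : ℝ => Ξ ((t, 0), 0)) 0 := hΞ.comp_of_eq hline rfl
  set c : ℝ → ℝ := fun t => (Ξ ((t, 0), 0)).1.2 with hcdef
  set m : ℝ → ℝ := fun t => (Ξ ((t, 0), 0)).2 with hmdef
  have hc : SmoothNear c 0 := hξ.fst.snd
  have hm : SmoothNear m 0 := hξ.snd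
  have hc0 : c 0 = 0 := by change (Ξ 0).1.2 = 0; rw [hΞ0]; rfl
  have hm0 : m 0 = 0 := by change (Ξ 0).2 = 0; rw [hΞ0]; rfl
  -- the solutions of the two flecnodal equations, parametrised by `x`
  have hr' : ∀ᶠ t : ℝ in 𝓝 0, Ξ ((t, 0), 0) = ((t, c t), m t) ∧
      secondForm f (t, c t) 1 (m t) = 0 ∧ thirdForm f (t, c t) 1 (m t) = 0 := by
    have hT : Tendsto (fun t : ℝ => ((t, (0 : ℝ)), (0 : ℝ))) (𝓝 0) (𝓝 0) :=
      hline.continuousAt.tendsto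
    filter_upwards [hT.eventually hr] with t ht
    have e1 : (Ξ ((t, 0), 0)).1.1 = t := (Prod.ext_iff.1 (Prod.ext_iff.1 ht).1).1
    have e2 : Ξ ((t, 0), 0) = ((t, c t), m t) := Prod.ext (Prod.ext e1 rfl) rfl
    rw [e2] at ht
    exact ⟨e2, (Prod.ext_iff.1 (Prod.ext_iff.1 ht).1).2, (Prod.ext_iff.1 ht).2⟩
  have hQ : (fun t => secondForm f (t, c t) 1 (m t)) =ᶠ[𝓝 0] fun _ => 0 :=
    hr'.mono fun t ht => ht.2.1
  have hC : (fun t => thirdForm f (t, c t) 1 (m t)) =ᶠ[𝓝 0] fun _ => 0 :=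
    hr'.mono fun t ht => ht.2.2
  obtain ⟨e1, e2, e3⟩ := hj.flecnodal_curve hf smoothNear_id hc hm rfl hc0 hm0
  have hid : deriv (fun t : ℝ => t) 0 = 1 := by simp
  have hc1 : deriv c 0 = 0 := by
    rw [hQ.deriv_eq] at e1; simpa using e1
  have hm1 : deriv m 0 = 2 * r := by
    rw [hC.deriv_eq, hc1, hid] at e2
    simp at e2; linarith
  have e4 := e3 hc1
  rw [(iteratedDeriv_congr_nhds hQ 2).self_of_nhds, hm1, hid] at e4
  refine ⟨_, _, h.isLocalArc (δ := fun t => (t, c t)) (ϖ := Prod.fst)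
    (eventually_mem_of_subset fun p hp => hp.1) (smoothNear_id.prodMk hc) (by rw [hc0]; rfl)
    (contDiff_fst.smoothNear 0) (Eventually.of_forall fun t => rfl) ?_, ?_⟩
  · have hyy : ∀ᶠ u in 𝓝 (0 : ℝ × ℝ), py (py f) u ≠ 0 :=
      hf.partial_y.partial_y.continuousAt.eventually_ne (by rw [hj.yy]; exact one_ne_zero)
    obtain ⟨ε, hε, hb⟩ := Metric.eventually_nhds_iff_ball.1 hl
    have hfst : Tendsto (Prod.fst : ℝ × ℝ → ℝ) (𝓝 0) (𝓝 0) := continuous_fst.tendsto' 0 0 rfl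
    filter_upwards [h.eventually_isGraphPoint, hyy, hj.eventually_slope_small hf hε,
      Metric.ball_mem_nhds (0 : ℝ × ℝ) hε, hfst.eventually hr'] with u h1 h2 h3 h4 h5
    rw [h1.mem_flecnodalCurve_iff_slope h2]
    constructor
    · rintro ⟨μ, hμ2, hμ3⟩
      -- the slope `μ` is small, so that `(u, μ)` lies where the local inverse `Ξ` is defined
      have h6 : (u, μ) ∈ Metric.ball (0 : (ℝ × ℝ) × ℝ) ε := by
        rw [Metric.mem_ball, dist_zero_right] at h4 ⊢
        exact max_lt h4 (h3 μ hμ2)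
      have h7 := hb _ h6
      have h8 : flecnodalMap f (u, μ) = ((u.1, 0), 0) := by
        simp [flecnodalMap, hμ2, hμ3]
      rw [h8, h5.1] at h7
      exact congrArg Prod.fst h7
    · intro he
      rw [← he]
      exact ⟨m u.1, h5.2⟩
  · rw [h.hasJet_graphParam smoothNear_id hc rfl hc0, hid]
    refine ⟨one_ne_zero, hc1, ?_⟩
    simp at e4
    linear_combination (1 / 2) * e4

end

/-! ### Jets of the Legendre map along curves -/

/-- The Taylor coefficients beyond the `1`-jet of a function whose graph has at the origin a
parabolic point with asymptotic line `y = 0`, tangent to the parabolic curve. -/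
structure IsGodronJet (f : ℝ × ℝ → ℝ) (k a d : ℝ) : Prop where
  xx : px (px f) 0 = 0
  yx : py (px f) 0 = 0
  yy : py (py f) 0 = k
  xxx : px (px (px f)) 0 = 0
  yxx : py (px (px f)) 0 = a
  xxxx : px (px (px (px f))) 0 = d

theorem IsNormalJet.isGodronJet {f : ℝ × ℝ → ℝ} {r : ℝ} (h : IsNormalJet f r) :
    IsGodronJet f 1 (-2) (12 * r) :=
  ⟨h.xx, h.yx, h.yy, h.xxx, h.yxx, h.xxxx⟩

theorem IsGodronJet.isNormalJet {f : ℝ × ℝ → ℝ} {r : ℝ} (h : IsGodronJet f 1 (-2) (12 * r)) :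
    IsNormalJet f r :=
  ⟨h.xx, h.yx, h.yy, h.xxx, h.yxx, h.xxxx⟩

theorem iteratedDeriv_const_mul_pow (c : ℝ) (n j : ℕ) :
    iteratedDeriv j (fun t : ℝ => c * t ^ n) 0 = if j = n then c * n.factorial else 0 := by
  rw [iteratedDeriv_const_mul_field]
  rcases lt_trichotomy j n with h | rfl | h
  · simp [h.ne, (Nat.sub_pos_of_lt h).ne']
  · simp [Nat.descFactorial_self]
  · simp [h.ne', Nat.descFactorial_of_lt h]

section

variable {f : ℝ × ℝ → ℝ} {k a d : ℝ} {x y : ℝ → ℝ}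

theorem smoothNear_legendre_curve (hf : SmoothNear f 0) (hx : SmoothNear x 0)
    (hy : SmoothNear y 0) (hx0 : x 0 = 0) (hy0 : y 0 = 0) :
    SmoothNear (fun t => legendreMap f (x t, y t)) 0 :=
  (smoothNear_legendreMap hf).comp_of_eq (hx.prodMk hy) (by rw [hx0, hy0]; rfl)

theorem IsGodronJet.deriv_legendre (hj : IsGodronJet f k a d) (hf : SmoothNear f 0)
    (h1 : px f 0 = 0) (h2 : py f 0 = 0) (hx : SmoothNear x 0) (hy : SmoothNear y 0)
    (hx0 : x 0 = 0) (hy0 : y 0 = 0) :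
    deriv (fun t => legendreMap f (x t, y t)) 0 = ![0, k * deriv y 0, 0] := by
  have h0 : (x 0, y 0) = (0 : ℝ × ℝ) := by rw [hx0, hy0]; rfl
  have hf0 : SmoothNear f (x 0, y 0) := by rw [h0]; exact hf
  have hxy := hx.prodMk hy
  have s0 : SmoothNear (fun t => f (x t, y t)) 0 := hf.comp_of_eq hxy h0
  have s1 : SmoothNear (fun t => px f (x t, y t)) 0 := hf.partial_x.comp_of_eq hxy h0
  have s2 : SmoothNear (fun t => py f (x t, y t)) 0 := hf.partial_y.comp_of_eq hxy h0
  ext i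
  rw [deriv_apply (smoothNear_legendre_curve hf hx hy hx0 hy0)]
  fin_cases i
  · refine (hf0.partial_x.deriv_comp₂ hx hy).trans ?_
    simp [h0, hj.xx, hj.yx]
  · refine (hf0.partial_y.deriv_comp₂ hx hy).trans ?_
    simp [h0, hj.yy, px_py hf, hj.yx]
  · refine HasDerivAt.deriv (((s0.hasDerivAt.sub (hx.hasDerivAt.mul s1.hasDerivAt)).sub
      (hy.hasDerivAt.mul s2.hasDerivAt)).congr_deriv ?_)
    rw [hf0.deriv_comp₂ hx hy, h0, hx0, hy0, h1, h2]
    simp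

/-- The `3`-jet of the tangential map along a curve tangent to the asymptotic line. -/
theorem IsGodronJet.iteratedDeriv_legendre (hj : IsGodronJet f k a d) (hf : SmoothNear f 0)
    (hx : SmoothNear x 0) (hy : SmoothNear y 0) (hx0 : x 0 = 0) (hy0 : y 0 = 0)
    (hy1 : deriv y 0 = 0) :
    iteratedDeriv 2 (fun t => legendreMap f (x t, y t)) 0 =
      ![0, a * deriv x 0 ^ 2 + k * iteratedDeriv 2 y 0, 0] ∧
    ∃ E : ℝ, iteratedDeriv 3 (fun t => legendreMap f (x t, y t)) 0 =
      ![d * deriv x 0 ^ 3 + 3 * a * deriv x 0 * iteratedDeriv 2 y 0, E, 0] := by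
  have h0 : (x 0, y 0) = (0 : ℝ × ℝ) := by rw [hx0, hy0]; rfl
  have hf0 : SmoothNear f (x 0, y 0) := by rw [h0]; exact hf
  have hxy := hx.prodMk hy
  have s1 : SmoothNear (fun t => px f (x t, y t)) 0 := hf.partial_x.comp_of_eq hxy h0
  have s2 : SmoothNear (fun t => py f (x t, y t)) 0 := hf.partial_y.comp_of_eq hxy h0
  have hs := smoothNear_legendre_curve hf hx hy hx0 hy0
  have p1 : deriv (fun t => px f (x t, y t)) 0 = 0 := by
    rw [hf0.partial_x.deriv_comp₂ hx hy]; simp [h0, hj.xx, hj.yx]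
  have p2 : iteratedDeriv 2 (fun t => px f (x t, y t)) 0 = 0 := by
    rw [hf0.partial_x.iteratedDeriv_two_comp₂ hx hy, h0, hj.xx, hj.yx, hj.xxx, hy1]; ring
  have q1 : deriv (fun t => py f (x t, y t)) 0 = 0 := by
    rw [hf0.partial_y.deriv_comp₂ hx hy]; simp [h0, hj.yy, px_py hf, hj.yx, hy1]
  -- the differential of the third coordinate is `-x d(f_x) - y d(f_y)`
  have e : deriv (fun t => f (x t, y t) - x t * px f (x t, y t) - y t * py f (x t, y t)) =ᶠ[𝓝 0]
      fun t => 0 - x t * deriv (fun t => px f (x t, y t)) t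
        - y t * deriv (fun t => py f (x t, y t)) t := by
    filter_upwards [hf0.eventually_comp₂ hx hy, hx.eventually, hy.eventually, s1.eventually,
      s2.eventually] with t ht hxt hyt h1t h2t
    refine HasDerivAt.deriv ((((ht.hasDerivAt_comp₂ hxt hyt).sub
      (hxt.hasDerivAt.mul h1t.hasDerivAt)).sub (hyt.hasDerivAt.mul h2t.hasDerivAt)).congr_deriv ?_)
    ring
  have m1 := hx.mul s1.derivative
  have m2 := hy.mul s2.derivative
  have m0 := smoothNear_const (0 : ℝ) (0 : ℝ)
  constructor
  · ext i
    rw [iteratedDeriv_apply hs]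
    fin_cases i
    · exact p2
    · refine (hf0.partial_y.iteratedDeriv_two_comp₂ hx hy).trans ?_
      have c1 : px (px (py f)) 0 = a := by
        rw [(px_congr (px_py_eventuallyEq hf)).self_of_nhds, px_py hf.partial_x, hj.yxx]
      rw [h0, hj.yy, px_py hf, hj.yx, c1, hy1]
      simp
    · change iteratedDeriv 2 (fun t => f (x t, y t) - x t * px f (x t, y t)
        - y t * py f (x t, y t)) 0 = 0
      have e2 := iteratedDeriv_sub_of_smoothNear (m0.sub m1) m2 1
      have e3 := iteratedDeriv_sub_of_smoothNear m0 m1 1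
      simp only [iteratedDeriv_one] at e2 e3
      rw [iteratedDeriv_two, e.deriv_eq, e2, e3, deriv_mul_of_smoothNear hx s1.derivative,
        deriv_mul_of_smoothNear hy s2.derivative, p1, q1, hx0, hy0]
      simp
  · refine ⟨iteratedDeriv 3 (fun t => py f (x t, y t)) 0, ?_⟩
    ext i
    rw [iteratedDeriv_apply hs]
    fin_cases i
    · refine (hf0.partial_x.iteratedDeriv_three_comp₂ hx hy).trans ?_
      rw [h0, hj.xxxx, hj.xxx, hj.yxx, hj.xx, hj.yx, hy1]
      simp
      ring
    · rfl
    · change iteratedDeriv 3 (fun t => f (x t, y t) - x t * px f (x t, y t)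
        - y t * py f (x t, y t)) 0 = 0
      rw [iteratedDeriv_succ', (iteratedDeriv_congr_nhds e 2).self_of_nhds,
        iteratedDeriv_sub_of_smoothNear (m0.sub m1) m2 2,
        iteratedDeriv_sub_of_smoothNear m0 m1 2, iteratedDeriv_two_mul hx s1.derivative,
        iteratedDeriv_two_mul hy s2.derivative, p1, q1, hx0, hy0, hy1,
        ← iteratedDeriv_two, p2]
      simp

end

/-! ### Swallowtails -/

/-- The Legendre map of `f` is a swallowtail: the changes of variables `ξ` of the source and `κ` of
the target take it to the standard one. -/
structure IsSwallowtailChart (f : ℝ × ℝ → ℝ) (ξ : ℝ × ℝ → ℝ × ℝ) (κ : R3 → R3) : Prop where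
  smooth_source : SmoothNear ξ 0
  source_zero : ξ 0 = 0
  bijective_source : Function.Bijective (fderiv ℝ ξ 0)
  smooth_target : SmoothNear κ 0
  bijective_target : Function.Bijective (fderiv ℝ κ 0)
  eq_standard : ∀ᶠ u in 𝓝 0, κ (legendreMap f (ξ u)) = standardSwallowtail u

theorem smoothNear_standard_curve (β : ℝ) :
    SmoothNear (fun t : ℝ => standardSwallowtail (t, β * t ^ 2)) 0 := by
  refine SmoothNear.pi fun i => ContDiff.smoothNear ?_ 0
  fin_cases i
  · change ContDiff ℝ ∞ fun t : ℝ => β * t ^ 2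
    fun_prop
  · change ContDiff ℝ ∞ fun t : ℝ => -4 * t ^ 3 - 2 * (β * t ^ 2) * t
    fun_prop
  · change ContDiff ℝ ∞ fun t : ℝ => 3 * t ^ 4 + β * t ^ 2 * t ^ 2
    fun_prop

theorem iteratedDeriv_standard_curve (β : ℝ) (j : ℕ) :
    iteratedDeriv j (fun t : ℝ => standardSwallowtail (t, β * t ^ 2)) 0 =
      ![if j = 2 then 2 * β else 0, if j = 3 then -24 - 12 * β else 0,
        if j = 4 then 72 + 24 * β else 0] := by
  ext i
  rw [iteratedDeriv_apply (smoothNear_standard_curve β)]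
  fin_cases i
  · change iteratedDeriv j (fun t : ℝ => β * t ^ 2) 0 = if j = 2 then 2 * β else 0
    rw [iteratedDeriv_const_mul_pow]
    split_ifs <;> norm_num [Nat.factorial]
    ring
  · change iteratedDeriv j (fun t : ℝ => -4 * t ^ 3 - 2 * (β * t ^ 2) * t) 0 =
      if j = 3 then -24 - 12 * β else 0
    have : (fun t : ℝ => -4 * t ^ 3 - 2 * (β * t ^ 2) * t) = fun t => (-4 - 2 * β) * t ^ 3 := by
      funext t; ring
    rw [this, iteratedDeriv_const_mul_pow]
    split_ifs <;> norm_num [Nat.factorial]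
    ring
  · change iteratedDeriv j (fun t : ℝ => 3 * t ^ 4 + β * t ^ 2 * t ^ 2) 0 =
      if j = 4 then 72 + 24 * β else 0
    have : (fun t : ℝ => 3 * t ^ 4 + β * t ^ 2 * t ^ 2) = fun t => (3 + β) * t ^ 4 := by
      funext t; ring
    rw [this, iteratedDeriv_const_mul_pow]
    split_ifs <;> norm_num [Nat.factorial]
    ring

theorem deriv_standard_curve (β : ℝ) :
    deriv (fun t : ℝ => standardSwallowtail (t, β * t ^ 2)) 0 = 0 := by
  rw [← iteratedDeriv_one, iteratedDeriv_standard_curve]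
  ext i; fin_cases i <;> simp

theorem deriv_const_mul_sq (β : ℝ) : deriv (fun t : ℝ => β * t ^ 2) 0 = 0 := by
  rw [← iteratedDeriv_one, iteratedDeriv_const_mul_pow]; simp

theorem smoothNear_const_mul_sq (β : ℝ) : SmoothNear (fun t : ℝ => β * t ^ 2) 0 :=
  ContDiff.smoothNear (by fun_prop) 0

namespace IsSwallowtailChart

variable {f : ℝ × ℝ → ℝ} {k a d : ℝ} {ξ : ℝ × ℝ → ℝ × ℝ} {κ : R3 → R3}
  (h : IsSwallowtailChart f ξ κ)
include h

theorem smooth_curve (β : ℝ) : SmoothNear (fun t : ℝ => ξ (t, β * t ^ 2)) 0 :=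
  h.smooth_source.comp_of_eq (smoothNear_id.prodMk (smoothNear_const_mul_sq β)) (by simp)

theorem curve_zero (β : ℝ) : ξ (0, β * 0 ^ 2) = 0 := by
  have e : ((0 : ℝ), β * (0 : ℝ) ^ 2) = 0 := by simp
  rw [e, h.source_zero]

theorem deriv_curve (β : ℝ) :
    (deriv (fun t : ℝ => (ξ (t, β * t ^ 2)).1) 0, deriv (fun t : ℝ => (ξ (t, β * t ^ 2)).2) 0) =
      fderiv ℝ ξ 0 (1, 0) := by
  have hl : HasDerivAt (fun t : ℝ => (t, β * t ^ 2)) (1, 0) 0 := by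
    have := (smoothNear_const_mul_sq β).hasDerivAt
    rw [deriv_const_mul_sq] at this
    exact (hasDerivAt_id (0 : ℝ)).prodMk this
  have hξ : HasFDerivAt ξ (fderiv ℝ ξ 0) ((0 : ℝ), β * (0 : ℝ) ^ 2) := by
    have : ((0 : ℝ), β * (0 : ℝ) ^ 2) = 0 := by simp
    rw [this]
    exact h.smooth_source.differentiableAt.hasFDerivAt
  have hc := hξ.comp_hasDerivAt (0 : ℝ) hl
  have h1 := (ContinuousLinearMap.fst ℝ ℝ ℝ).hasFDerivAt.comp_hasDerivAt (0 : ℝ) hc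
  have h2 := (ContinuousLinearMap.snd ℝ ℝ ℝ).hasFDerivAt.comp_hasDerivAt (0 : ℝ) hc
  exact Prod.ext h1.deriv h2.deriv

theorem target_comp_curve (β : ℝ) : (fun t : ℝ => κ (legendreMap f (ξ (t, β * t ^ 2)))) =ᶠ[𝓝 0]
    fun t => standardSwallowtail (t, β * t ^ 2) := by
  have hT : Tendsto (fun t : ℝ => (t, β * t ^ 2)) (𝓝 0) (𝓝 (0 : ℝ × ℝ)) := by
    have : Continuous fun t : ℝ => (t, β * t ^ 2) := by fun_prop
    exact this.tendsto' 0 0 (by simp)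
  exact hT.eventually h.eq_standard

end IsSwallowtailChart

section

variable {f : ℝ × ℝ → ℝ} {k a d : ℝ} {ξ : ℝ × ℝ → ℝ × ℝ} {κ : R3 → R3}

/-- The second derivative of a function along the curve `t ↦ (t, β t²)` is affine in `β`. -/
theorem iteratedDeriv_two_parabola {η : ℝ × ℝ → ℝ} (hη : SmoothNear η 0) (hpx : px η 0 = 0)
    (β : ℝ) : iteratedDeriv 2 (fun t : ℝ => η (t, β * t ^ 2)) 0 =
      px (px η) 0 + 2 * β * py η 0 := by
  have h0 : ((0 : ℝ), β * (0 : ℝ) ^ 2) = 0 := by simp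
  have hs : SmoothNear η ((0 : ℝ), β * (0 : ℝ) ^ 2) := by rw [h0]; exact hη
  have h1 := SmoothNear.iteratedDeriv_two_comp₂ (h := η) (x := fun t => t)
    (y := fun t => β * t ^ 2) (t := 0) hs smoothNear_id (smoothNear_const_mul_sq β)
  have h2 : deriv (fun t : ℝ => t) 0 = 1 := by simp
  have h3 : iteratedDeriv 2 (fun t : ℝ => β * t ^ 2) 0 = 2 * β := by
    rw [iteratedDeriv_const_mul_pow]
    simp [Nat.factorial]
    ring
  rw [h0, h2, h3, deriv_const_mul_sq, iteratedDeriv_two_id, hpx] at h1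
  rw [h1]
  ring

/-- The `3`-jets of the standard swallowtail along the curves `t ↦ (t, β t²)` determine the `2`-jet
of the preimage of the double curve `β = -2`, and they force the two non-degeneracy conditions on
the Taylor coefficients of `f`. -/
theorem IsSwallowtailChart.jets (h : IsSwallowtailChart f ξ κ) (hj : IsGodronJet f k a d)
    (hk : k ≠ 0) (hf : SmoothNear f 0) (hfx : px f 0 = 0) (hfy : py f 0 = 0) (hf0 : f 0 = 0) :
    a ≠ 0 ∧ d * k ≠ 3 * a ^ 2 ∧
    deriv (fun t : ℝ => (ξ (t, -2 * t ^ 2)).1) 0 ≠ 0 ∧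
    deriv (fun t : ℝ => (ξ (t, -2 * t ^ 2)).2) 0 = 0 ∧
    3 * a * iteratedDeriv 2 (fun t : ℝ => (ξ (t, -2 * t ^ 2)).2) 0 =
      -d * deriv (fun t : ℝ => (ξ (t, -2 * t ^ 2)).1) 0 ^ 2 := by
  set α : ℝ := (fderiv ℝ ξ 0 (1, 0)).1 with hα
  set K := fderiv ℝ κ 0 with hK
  have hK0 : ∀ v, K v = 0 → v = 0 := fun v hv => h.bijective_target.1 (by rw [hv, map_zero])
  have hτ0 : legendreMap f 0 = 0 := legendreMap_zero hf0 hfx hfy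
  have dx : ∀ β : ℝ, deriv (fun t : ℝ => (ξ (t, β * t ^ 2)).1) 0 = α := fun β =>
    congrArg Prod.fst (h.deriv_curve β)
  have dy' : ∀ β : ℝ, deriv (fun t : ℝ => (ξ (t, β * t ^ 2)).2) 0 = (fderiv ℝ ξ 0 (1, 0)).2 :=
    fun β => congrArg Prod.snd (h.deriv_curve β)
  have cx0 : ∀ β : ℝ, (ξ (0, β * 0 ^ 2)).1 = 0 := fun β => by rw [h.curve_zero]; rfl
  have cy0 : ∀ β : ℝ, (ξ (0, β * 0 ^ 2)).2 = 0 := fun β => by rw [h.curve_zero]; rfl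
  have hs : ∀ β : ℝ, SmoothNear (fun t : ℝ => legendreMap f ((ξ (t, β * t ^ 2)).1,
      (ξ (t, β * t ^ 2)).2)) 0 := fun β =>
    smoothNear_legendre_curve hf (h.smooth_curve β).fst (h.smooth_curve β).snd (cx0 β) (cy0 β)
  have hbase : ∀ β : ℝ, legendreMap f ((ξ (0, β * 0 ^ 2)).1, (ξ (0, β * 0 ^ 2)).2) = 0 := by
    intro β
    rw [Prod.mk.eta, h.curve_zero, hτ0]
  have hκ : ∀ β : ℝ, SmoothNear κ (legendreMap f ((ξ (0, β * 0 ^ 2)).1,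
      (ξ (0, β * 0 ^ 2)).2)) := by
    intro β
    rw [hbase]; exact h.smooth_target
  -- the kernel of the differential of the tangential map is the asymptotic direction
  have hy1 : (fderiv ℝ ξ 0 (1, 0)).2 = 0 := by
    have e1 := (h.target_comp_curve 0).deriv_eq
    rw [deriv_standard_curve] at e1
    have e2 := (hκ 0).deriv_comp (hs 0)
    rw [hbase, hj.deriv_legendre hf hfx hfy (h.smooth_curve 0).fst (h.smooth_curve 0).snd
      (cx0 0) (cy0 0), dy' 0] at e2
    have e3 := congrFun (hK0 _ (e2.symm.trans e1)) 1
    simpa [hk] using e3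
  have dy : ∀ β : ℝ, deriv (fun t : ℝ => (ξ (t, β * t ^ 2)).2) 0 = 0 := fun β => by
    rw [dy', hy1]
  have hα0 : α ≠ 0 := by
    intro h0
    have : fderiv ℝ ξ 0 (1, 0) = fderiv ℝ ξ 0 0 := by
      rw [map_zero]; exact Prod.ext h0 hy1
    have := congrArg Prod.fst (h.bijective_source.1 this)
    norm_num at this
  set y₀ := px (px fun u => (ξ u).2) 0
  set e := py (fun u => (ξ u).2) 0
  have hpx : px (fun u => (ξ u).2) 0 = 0 := by
    have := (ContinuousLinearMap.snd ℝ ℝ ℝ).hasFDerivAt.comp (0 : ℝ × ℝ)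
      h.smooth_source.differentiableAt.hasFDerivAt
    have e4 := DFunLike.congr_fun this.fderiv (1, 0)
    exact e4.trans hy1
  have d2y : ∀ β : ℝ, iteratedDeriv 2 (fun t : ℝ => (ξ (t, β * t ^ 2)).2) 0 = y₀ + 2 * β * e :=
    fun β => iteratedDeriv_two_parabola h.smooth_source.snd hpx β
  have hd0 : ∀ β : ℝ, deriv (fun t : ℝ => legendreMap f ((ξ (t, β * t ^ 2)).1,
      (ξ (t, β * t ^ 2)).2)) 0 = 0 := by
    intro β
    rw [hj.deriv_legendre hf hfx hfy (h.smooth_curve β).fst (h.smooth_curve β).snd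
      (cx0 β) (cy0 β), dy β]
    ext i; fin_cases i <;> simp
  -- second derivatives along `t ↦ (t, β t²)`
  have two : ∀ β : ℝ, K ![0, a * α ^ 2 + k * (y₀ + 2 * β * e), 0] = ![2 * β, 0, 0] := by
    intro β
    have e1 := (iteratedDeriv_congr_nhds (h.target_comp_curve β) 2).self_of_nhds
    have e2 := (hκ β).iteratedDeriv_two_comp_of_deriv_eq_zero (hs β) (hd0 β)
    rw [hbase, (hj.iteratedDeriv_legendre hf (h.smooth_curve β).fst (h.smooth_curve β).snd
      (cx0 β) (cy0 β) (dy β)).1, dx, d2y] at e2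
    rw [iteratedDeriv_standard_curve] at e1
    refine e2.symm.trans (e1.trans ?_)
    simp
  -- third derivatives along `t ↦ (t, β t²)`
  have three : ∀ β : ℝ, ∃ E : ℝ, K ![d * α ^ 3 + 3 * a * α * (y₀ + 2 * β * e), E, 0] =
      ![0, -24 - 12 * β, 0] := by
    intro β
    have e1 := (iteratedDeriv_congr_nhds (h.target_comp_curve β) 3).self_of_nhds
    have e2 := (hκ β).iteratedDeriv_three_comp_of_deriv_eq_zero (hs β) (hd0 β)
    obtain ⟨E, hE⟩ := (hj.iteratedDeriv_legendre hf (h.smooth_curve β).fst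
      (h.smooth_curve β).snd (cx0 β) (cy0 β) (dy β)).2
    rw [hbase, hE, dx, d2y] at e2
    rw [iteratedDeriv_standard_curve] at e1
    refine ⟨E, e2.symm.trans (e1.trans ?_)⟩
    simp
  have hlin : ∀ s t : ℝ, K ![s, t, 0] = s • K ![1, 0, 0] + t • K ![0, 1, 0] := by
    intro s t
    rw [← map_smul, ← map_smul, ← map_add]
    congr 1
    ext i; fin_cases i <;> simp
  -- `K` sends the line of all second derivatives, the `f_y`-axis, to the `a`-axis, so that the second
  -- component of the third derivatives depends only on their `f_x`-component
  have w1 : K ![0, 1, 0] 1 = 0 := by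
    have e0 := two 0
    have e1 := two 1
    rw [hlin] at e0 e1
    have a1 := congrFun e1 1
    have a0 := congrFun e1 0
    simp at a1 a0
    rcases a1 with hz | hz
    · rw [hz] at a0; norm_num at a0
    · exact hz
  have hv0 : a * α ^ 2 + k * y₀ = 0 := by
    have e0 := two 0
    have : (![2 * 0, 0, 0] : R3) = 0 := by ext i; fin_cases i <;> simp
    rw [this] at e0
    simpa using congrFun (hK0 _ e0) 1
  have third : ∀ β : ℝ, (d * α ^ 3 + 3 * a * α * (y₀ + 2 * β * e)) * K ![1, 0, 0] 1 =
      -24 - 12 * β := by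
    intro β
    obtain ⟨E, hE⟩ := three β
    rw [hlin] at hE
    have := congrFun hE 1
    simp [w1] at this
    simpa using this
  -- the factor `-24 - 12 β` vanishes on the double curve `β = -2`, and not for `β = 0`
  have t0 := third 0
  have t2 := third (-2)
  have hp : K ![1, 0, 0] 1 ≠ 0 := by
    intro hz; rw [hz] at t0; norm_num at t0
  have t2' : d * α ^ 3 + 3 * a * α * (y₀ + 2 * -2 * e) = 0 := by
    have : (d * α ^ 3 + 3 * a * α * (y₀ + 2 * -2 * e)) * K ![1, 0, 0] 1 = 0 := by
      rw [t2]; norm_num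
    exact (mul_eq_zero.1 this).resolve_right hp
  have t0' : d * α ^ 3 + 3 * a * α * y₀ ≠ 0 := by
    intro hz
    simp only [mul_zero, zero_mul, add_zero, hz] at t0
    norm_num at t0
  refine ⟨?_, ?_, by rw [dx]; exact hα0, dy _, ?_⟩
  · rintro rfl
    apply t0'
    linear_combination t2'
  · intro hdk
    apply t0'
    refine (mul_eq_zero.1 (?_ : k * (d * α ^ 3 + 3 * a * α * y₀) = 0)).resolve_left hk
    linear_combination α ^ 3 * hdk + 3 * a * α * hv0
  · rw [dx, d2y]
    refine mul_left_cancel₀ hα0 ?_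
    linear_combination t2'

/-- The self-intersection of the standard swallowtail: two parameters with the same image are those
of a polynomial with two double roots. -/
theorem standardSwallowtail_eq_iff {u v : ℝ × ℝ} (hne : u ≠ v) :
    standardSwallowtail u = standardSwallowtail v ↔
      v.1 = -u.1 ∧ u.2 = -2 * u.1 ^ 2 ∧ v.2 = -2 * u.1 ^ 2 := by
  obtain ⟨s, c⟩ := u
  obtain ⟨t, c'⟩ := v
  simp only [standardSwallowtail]
  constructor
  · intro he
    have h0 := congrFun he 0
    have h1 := congrFun he 1
    have h2 := congrFun he 2
    simp at h0 h1 h2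
    subst h0
    have hst : s - t ≠ 0 := by
      intro hz
      exact hne (by rw [sub_eq_zero.1 hz])
    have k1 : 2 * (s ^ 2 + s * t + t ^ 2) + c = 0 := by
      refine (mul_eq_zero.1 (?_ : (s - t) * (2 * (s ^ 2 + s * t + t ^ 2) + c) = 0)).resolve_left hst
      linear_combination (-1 / 2) * h1
    have k2 : (s + t) * (3 * (s ^ 2 + t ^ 2) + c) = 0 := by
      refine (mul_eq_zero.1
        (?_ : (s - t) * ((s + t) * (3 * (s ^ 2 + t ^ 2) + c)) = 0)).resolve_left hst
      linear_combination h2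
    have k3 : (s + t) * (s - t) ^ 2 = 0 := by linear_combination k2 - (s + t) * k1
    have k4 : s + t = 0 := (mul_eq_zero.1 k3).resolve_right (pow_ne_zero 2 hst)
    have k5 : t = -s := by linarith
    subst k5
    refine ⟨rfl, ?_, ?_⟩ <;> linear_combination k1
  · rintro ⟨h1, h2, h3⟩
    subst h1 h2 h3
    ext i; fin_cases i
    · simp
    · simp; ring
    · simp; ring

end

/-! ### The conodal curve at a swallowtail -/

section

variable {S : Set R3} {g : R3} {A : (Fin 4 → ℝ) ≃ₗ[ℝ] (Fin 4 → ℝ)} {f : ℝ × ℝ → ℝ}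
  {ξ : ℝ × ℝ → ℝ × ℝ} {κ : R3 → R3}

/-- The conodal curve is the image of the self-intersection of the standard swallowtail. -/
theorem IsGraphChart.exists_conodal_arc (h : IsGraphChart S g A f)
    (hsw : IsSwallowtailChart f ξ κ) : ∃ π, ∃ V ∈ 𝓝 g, ∀ U ⊆ V, U ∈ 𝓝 g →
      IsLocalArc (conodalCurve S U) g (fun t => graphParam A f (ξ (t, -2 * t ^ 2))) π := by
  obtain ⟨η, hη, hη0, hηl, hηr⟩ := hsw.smooth_source.exists_local_inverse hsw.bijective_source
  obtain ⟨μ, -, -, hμl, -⟩ := hsw.smooth_target.exists_local_inverse hsw.bijective_target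
  rw [hsw.source_zero] at hη hη0 hηr
  have hξT : Tendsto ξ (𝓝 0) (𝓝 0) := by
    simpa [ContinuousAt, hsw.source_zero] using hsw.smooth_source.continuousAt
  have hηT : Tendsto η (𝓝 0) (𝓝 0) := by simpa [ContinuousAt, hη0] using hη.continuousAt
  have hτT : Tendsto (legendreMap f) (𝓝 0) (𝓝 0) := by
    simpa [ContinuousAt, h.legendreMap_base] using h.smooth_legendreMap.continuousAt
  set N : Set (ℝ × ℝ) := {w | η (ξ w) = w ∧ IsGraphPoint S A f (ξ w) ∧
    κ (legendreMap f (ξ w)) = standardSwallowtail w ∧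
    μ (κ (legendreMap f (ξ w))) = legendreMap f (ξ w)} with hN
  have hN0 : N ∈ 𝓝 (0 : ℝ × ℝ) := by
    filter_upwards [hηl, hξT.eventually h.eventually_isGraphPoint, hsw.eq_standard,
      (hτT.comp hξT).eventually hμl] with w h1 h2 h3 h4 using ⟨h1, h2, h3, h4⟩
  -- points of parameters in `N` with a common tangent plane
  have hsame : ∀ w ∈ N, ∀ w' ∈ N, ((∃ n, IsConormal S (graphParam A f (ξ w)) n ∧
      IsConormal S (graphParam A f (ξ w')) n ∧
      n (graphParam A f (ξ w') - graphParam A f (ξ w)) = 0) ↔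
        standardSwallowtail w = standardSwallowtail w') := by
    rintro w ⟨-, h2, h3, h4⟩ w' ⟨-, h2', h3', h4'⟩
    rw [h2.same_tangent_iff h2', ← h3, ← h3']
    exact ⟨fun e => by rw [e], fun e => by rw [← h4, e, h4']⟩
  have hinj : ∀ w ∈ N, ∀ w' ∈ N, graphParam A f (ξ w) = graphParam A f (ξ w') → w = w' := by
    rintro w ⟨h1, h2, -⟩ w' ⟨h1', h2', -⟩ e
    rw [← h1, ← h1', ← h2.planeCoord_eq, e, h2'.planeCoord_eq]
  -- `V` is a neighbourhood of `g` in which `S` is parametrised by `N`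
  set V : Set R3 := {p | p ∈ S → η (planeCoord A p) ∈ N ∧
    graphParam A f (ξ (η (planeCoord A p))) = p} with hV
  have hV0 : V ∈ 𝓝 g := by
    filter_upwards [h.eventually_mem_iff, h.tendsto_planeCoord.eventually hηr,
      (hηT.comp h.tendsto_planeCoord).eventually hN0] with p h1 h2 h3 hp
    exact ⟨h3, by rw [h2]; exact h1.1 hp⟩
  refine ⟨fun p => (η (planeCoord A p)).1, V, hV0, fun U hUV hU => ?_⟩
  set D : Set R3 := {q | q ∈ S ∩ U ∧ ∃ q' ∈ S ∩ U, q' ≠ q ∧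
    ∃ n, IsConormal S q n ∧ IsConormal S q' n ∧ n (q' - q) = 0} with hD
  -- a point of `D` and its partner are the images of a double point of the swallowtail
  have hDpar : ∀ q ∈ D, (η (planeCoord A q)).2 + 2 * (η (planeCoord A q)).1 ^ 2 = 0 := by
    rintro q ⟨⟨hqS, hqU⟩, q', ⟨hqS', hqU'⟩, hne, hn⟩
    obtain ⟨hw, he⟩ := hUV hqU hqS
    obtain ⟨hw', he'⟩ := hUV hqU' hqS'
    rw [← he, ← he'] at hn
    have hne' : η (planeCoord A q) ≠ η (planeCoord A q') := by
      intro e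
      apply hne
      rw [← he, ← he', e]
    have := ((standardSwallowtail_eq_iff hne').1 ((hsame _ hw _ hw').1 hn)).2.1
    linear_combination this
  have hline : Tendsto (fun t : ℝ => (t, -2 * t ^ 2)) (𝓝 0) (𝓝 (0 : ℝ × ℝ)) := by
    have : Continuous fun t : ℝ => (t, -2 * t ^ 2) := by fun_prop
    exact this.tendsto' 0 0 (by simp)
  have hline' : Tendsto (fun t : ℝ => (-t, -2 * t ^ 2)) (𝓝 0) (𝓝 (0 : ℝ × ℝ)) := by
    have : Continuous fun t : ℝ => (-t, -2 * t ^ 2) := by fun_prop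
    exact this.tendsto' 0 0 (by simp)
  have hσξ : Tendsto (fun w => graphParam A f (ξ w)) (𝓝 0) (𝓝 g) := h.tendsto_graphParam.comp hξT
  -- the points of parameters `t` and `-t` of the double curve are partners
  have hDmem : ∀ᶠ t in 𝓝 (0 : ℝ), t ≠ 0 → graphParam A f (ξ (t, -2 * t ^ 2)) ∈ D := by
    filter_upwards [hline.eventually hN0, hline'.eventually hN0,
      (hσξ.comp hline).eventually hU, (hσξ.comp hline').eventually hU] with t h1 h2 h3 h4 ht
    have hne : ((t, -2 * t ^ 2) : ℝ × ℝ) ≠ (-t, -2 * t ^ 2) := by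
      intro e
      have := congrArg Prod.fst e
      simp only at this
      exact ht (by linarith)
    exact ⟨⟨h1.2.1.defining.1, h3⟩, _, ⟨h2.2.1.defining.1, h4⟩,
      fun e => hne (hinj _ h1 _ h2 e.symm),
      (hsame _ h1 _ h2).2 ((standardSwallowtail_eq_iff hne).2 ⟨rfl, rfl, rfl⟩)⟩
  -- the point `g` itself has no partner: it lies in the closure of `D` only
  have hgD : g ∈ closure D := by
    have h1 : Tendsto (fun t : ℝ => graphParam A f (ξ (t, -2 * t ^ 2))) (𝓝[≠] 0) (𝓝 g) :=
      (hσξ.comp hline).mono_left nhdsWithin_le_nhds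
    refine mem_closure_of_tendsto h1 ?_
    exact eventually_nhdsWithin_iff.2 hDmem
  refine h.isLocalArc (δ := fun t => ξ (t, -2 * t ^ 2)) (ϖ := fun u => (η u).1)
    (eventually_mem_of_subset fun p hp => hp.1) (hsw.smooth_curve _) (hsw.curve_zero _) hη.fst
    ?_ ?_
  · filter_upwards [hline.eventually hηl] with t ht
    rw [ht]
  · have hϖT : Tendsto (fun u => (η u).1) (𝓝 0) (𝓝 0) :=
      (continuous_fst.tendsto' (0 : ℝ × ℝ) 0 rfl).comp hηT
    filter_upwards [h.eventually_isGraphPoint, hη.eventually, hηr, hϖT.eventually hDmem]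
      with u h1 h2 h3 h4
    constructor
    · rintro ⟨-, hcl⟩
      have hpc : SmoothNear (planeCoord A) (graphParam A f u) := smoothNear_planeCoord h1.den_ne
      have hcont : ContinuousAt (fun q => (η (planeCoord A q)).2 +
          2 * (η (planeCoord A q)).1 ^ 2) (graphParam A f u) := by
        have hc : ContinuousAt (fun q => η (planeCoord A q)) (graphParam A f u) :=
          (h2.comp_of_eq hpc h1.planeCoord_eq).continuousAt
        exact hc.snd.add ((hc.fst.pow 2).const_mul 2)
      have hz : (η (planeCoord A (graphParam A f u))).2 +
          2 * (η (planeCoord A (graphParam A f u))).1 ^ 2 = 0 := by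
        by_contra hne
        obtain ⟨q, hq, hqD⟩ := ((mem_closure_iff_frequently.1 hcl).and_eventually
          (hcont.eventually_ne hne)).exists
        exact hqD (hDpar q hq)
      rw [h1.planeCoord_eq] at hz
      have : ((η u).1, -2 * (η u).1 ^ 2) = η u := Prod.ext rfl (by simp only; linarith)
      rw [this, h3]
    · intro hu
      refine ⟨h1.defining.1, ?_⟩
      by_cases hs : (η u).1 = 0
      · rw [hs] at hu
        rw [← hu, hsw.curve_zero, h.graphParam_zero]
        exact hgD
      · have := h4 hs
        rw [hu] at this
        exact subset_closure this

end

/-! ### Swallowtails of the dual surface and separating jets -/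

section

variable {S : Set R3} {g : R3} {A : (Fin 4 → ℝ) ≃ₗ[ℝ] (Fin 4 → ℝ)} {f : ℝ × ℝ → ℝ}

namespace IsGraphChart

variable (h : IsGraphChart S g A f)
include h

theorem tangentialMap_base {b : Module.Basis (Fin 3) ℝ R3} (hb : IsTransverse S g b) :
    tangentialMap S b g = projMap (dualEquiv A b) 0 := by
  have := (h.eventually_tangentialMap_eq hb).self_of_nhds
  rwa [h.graphParam_zero, h.legendreMap_base] at this

theorem exists_swallowtailChart (hsw : IsDualSwallowtail S g) :
    ∃ ξ κ, IsSwallowtailChart f ξ κ := by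
  obtain ⟨b, hb, X, hX, hX0, hXinj, hXS, ψ, hψ, hψb, hev⟩ := hsw
  rw [h.tangentialMap_base hb] at hψ hψb
  have hB := h.dualEquiv_den_ne hb
  have hXT : Tendsto X (𝓝 0) (𝓝 g) := by simpa [ContinuousAt, hX0] using hX.continuousAt
  have hξ : SmoothNear (fun u => planeCoord A (X u)) 0 :=
    (smoothNear_planeCoord h.den_ne).comp_of_eq hX hX0
  have hξ0 : planeCoord A (X 0) = 0 := by rw [hX0, h.planeCoord_base]
  have hlift : ∀ᶠ u in 𝓝 0, graphParam A f (planeCoord A (X u)) = X u := by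
    filter_upwards [hXS, hXT.eventually h.eventually_mem_iff] with u h1 h2 using h2.1 h1
  have hθ := smoothNear_projMap (dualEquiv A b) hB
  refine ⟨fun u => planeCoord A (X u), fun V => ψ (projMap (dualEquiv A b) V), hξ, hξ0, ?_,
    hψ.comp hθ, ?_, ?_⟩
  · refine bijective_of_injective _ fun v hv => hXinj ?_
    have h1 : HasFDerivAt (graphParam A f) (fderiv ℝ (graphParam A f) 0)
        (planeCoord A (X 0)) := by
      rw [hξ0]; exact h.smooth_graphParam.differentiableAt.hasFDerivAt
    have h2 := (HasFDerivAt.comp (g := graphParam A f) (0 : ℝ × ℝ) h1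
      hξ.differentiableAt.hasFDerivAt).congr_of_eventuallyEq
      (f₁ := X) (hlift.mono fun u hu => hu.symm)
    rw [h2.fderiv, map_zero, ContinuousLinearMap.comp_apply, hv, map_zero]
  · have h1 := hψ.differentiableAt.hasFDerivAt.comp (0 : R3) hθ.differentiableAt.hasFDerivAt
    have h2 : fderiv ℝ (fun V => ψ (projMap (dualEquiv A b) V)) 0 = _ := h1.fderiv
    rw [h2]
    exact hψb.comp (bijective_fderiv_projMap (dualEquiv A b) hB)
  · have hξT : Tendsto (fun u => planeCoord A (X u)) (𝓝 0) (𝓝 0) := by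
      simpa [ContinuousAt, hξ0] using hξ.continuousAt
    filter_upwards [hlift, hξT.eventually (h.eventually_tangentialMap_eq hb), hev] with u h1 h2 h3
    rw [← h2, h1, h3]

theorem isDualSwallowtail {ξ : ℝ × ℝ → ℝ × ℝ} {κ : R3 → R3} (hsw : IsSwallowtailChart f ξ κ) :
    IsDualSwallowtail S g := by
  obtain ⟨b, hb⟩ := h.exists_isTransverse
  have hB := h.dualEquiv_den_ne hb
  have hB' := projMap_symm_den (dualEquiv A b) hB
  have hinv := projMap_symm_projMap (dualEquiv A b) hB
  have hξT : Tendsto ξ (𝓝 0) (𝓝 0) := by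
    simpa [ContinuousAt, hsw.source_zero] using hsw.smooth_source.continuousAt
  have hτT : Tendsto (legendreMap f) (𝓝 0) (𝓝 0) := by
    simpa [ContinuousAt, h.legendreMap_base] using h.smooth_legendreMap.continuousAt
  have hθ := smoothNear_projMap (dualEquiv A b).symm hB'
  have hκ : SmoothNear κ (projMap (dualEquiv A b).symm (projMap (dualEquiv A b) 0)) := by
    rw [hinv]; exact hsw.smooth_target
  refine ⟨b, hb, fun u => graphParam A f (ξ u),
    h.smooth_graphParam.comp_of_eq hsw.smooth_source hsw.source_zero,
    by simp only [hsw.source_zero, h.graphParam_zero], ?_, (hξT.eventually h.eventually_mem),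
    fun V => κ (projMap (dualEquiv A b).symm V), ?_, ?_, ?_⟩
  · have h1 : HasFDerivAt (graphParam A f) (fderiv ℝ (graphParam A f) 0) (ξ 0) := by
      rw [hsw.source_zero]; exact h.smooth_graphParam.differentiableAt.hasFDerivAt
    have h2 : fderiv ℝ (fun u => graphParam A f (ξ u)) 0 = _ :=
      (h1.comp (0 : ℝ × ℝ) hsw.smooth_source.differentiableAt.hasFDerivAt).fderiv
    rw [h2]
    refine Function.Injective.comp (g := fderiv ℝ (graphParam A f) 0) ?_ hsw.bijective_source.1
    have hpc : SmoothNear (planeCoord A) (graphParam A f 0) := by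
      rw [h.graphParam_zero]; exact smoothNear_planeCoord h.den_ne
    exact Function.LeftInverse.injective (g := fderiv ℝ (planeCoord A) (graphParam A f 0))
      fun v => fderiv_leftInverse h.smooth_graphParam hpc h.eventually_planeCoord_graphParam v
  · rw [h.tangentialMap_base hb]
    exact hκ.comp hθ
  · rw [h.tangentialMap_base hb]
    have h1 := hκ.differentiableAt.hasFDerivAt.comp _ hθ.differentiableAt.hasFDerivAt
    have h2 : fderiv ℝ (fun V => κ (projMap (dualEquiv A b).symm V)) _ = _ := h1.fderiv
    rw [h2]
    have hκb := hsw.bijective_target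
    rw [← hinv] at hκb
    exact hκb.comp (bijective_fderiv_projMap (dualEquiv A b).symm hB')
  · filter_upwards [hsw.eq_standard, hξT.eventually (h.eventually_tangentialMap_eq hb),
      (hτT.comp hξT).eventually (eventually_den_ne_zero (dualEquiv A b) hB)] with u h1 h2 h3
    simp only [Function.comp] at h3
    rw [h2, projMap_symm_projMap (dualEquiv A b) h3, h1]

/-- The `3`-jet of the tangential map along the curves of the surface with `2`-jet `y = c x²`. The
second derivative vanishes exactly for `c = 1`, the separating jet. -/
theorem tangentialMap_jets {r : ℝ} (hj : IsNormalJet f r) {b : Module.Basis (Fin 3) ℝ R3}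
    (hb : IsTransverse S g b) {γ : ℝ → R3} {c : ℝ} (hγ : IsCurveOn S g γ) (hc : HasJet A γ c) :
    ∃ m : ℝ, m ≠ 0 ∧ deriv (fun t => tangentialMap S b (γ t)) 0 = 0 ∧
      iteratedDeriv 2 (fun t => tangentialMap S b (γ t)) 0 =
        (2 * (c - 1) * m ^ 2) • fderiv ℝ (projMap (dualEquiv A b)) 0 ![0, 1, 0] ∧
      ∃ E : ℝ, iteratedDeriv 3 (fun t => tangentialMap S b (γ t)) 0 =
        fderiv ℝ (projMap (dualEquiv A b)) 0 ![12 * (r - c) * m ^ 3, E, 0] := by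
  obtain ⟨x, y, hx, hy, hx0, hy0, e⟩ := h.exists_plane_curve hγ
  have hc' := hc.congr e.symm
  rw [h.hasJet_graphParam hx hy hx0 hy0] at hc'
  obtain ⟨hm, hy1, hy2⟩ := hc'
  have hxyT : Tendsto (fun t => (x t, y t)) (𝓝 0) (𝓝 (0 : ℝ × ℝ)) := by
    have := (hx.prodMk hy).continuousAt.tendsto
    rw [hx0, hy0] at this
    exact this
  have hT : (fun t => tangentialMap S b (γ t)) =ᶠ[𝓝 0]
      fun t => projMap (dualEquiv A b) (legendreMap f (x t, y t)) := by
    filter_upwards [e, hxyT.eventually (h.eventually_tangentialMap_eq hb)] with t h1 h2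
    rw [h1, h2]
  have hg := hj.isGodronJet
  have hs := smoothNear_legendre_curve h.smooth hx hy hx0 hy0
  have hbase : legendreMap f (x 0, y 0) = 0 := by
    rw [hx0, hy0]; exact h.legendreMap_base
  have hθ : SmoothNear (projMap (dualEquiv A b)) (legendreMap f (x 0, y 0)) := by
    rw [hbase]; exact smoothNear_projMap _ (h.dualEquiv_den_ne hb)
  have hd0 : deriv (fun t => legendreMap f (x t, y t)) 0 = 0 := by
    rw [hg.deriv_legendre h.smooth h.px_zero h.py_zero hx hy hx0 hy0, hy1]
    ext i; fin_cases i <;> simp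
  obtain ⟨j2, E, j3⟩ := hg.iteratedDeriv_legendre h.smooth hx hy hx0 hy0 hy1
  refine ⟨deriv x 0, hm, ?_, ?_, E, ?_⟩
  · rw [hT.deriv_eq, hθ.deriv_comp hs, hd0, map_zero]
  · rw [(iteratedDeriv_congr_nhds hT 2).self_of_nhds,
      hθ.iteratedDeriv_two_comp_of_deriv_eq_zero hs hd0, hbase, j2, hy2, ← map_smul]
    congr 1
    ext i; fin_cases i
    · simp
    · simp; ring
    · simp
  · rw [(iteratedDeriv_congr_nhds hT 3).self_of_nhds,
      hθ.iteratedDeriv_three_comp_of_deriv_eq_zero hs hd0, hbase, j3, hy2]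
    congr 1
    ext i; fin_cases i
    · simp; ring
    · simp
    · simp

/-- The jet `c = 1` is the only one whose image is not a cusp; the condition `r ≠ 1` ensures that this
image has a tangent line, different from that of the cusps. -/
theorem isSeparatingJet_iff {r : ℝ} (hj : IsNormalJet f r) (hr : r ≠ 1) (s : ℝ) :
    IsSeparatingJet S g A s ↔ s = 1 := by
  constructor
  · rintro ⟨b, hb, L, h1, -⟩
    by_contra hs
    have hy := smoothNear_const_mul_sq 1
    have hcurve := h.isCurveOn_graphParam smoothNear_id hy rfl (by simp)
    have hjet : HasJet A (fun t => graphParam A f (t, 1 * t ^ 2)) 1 := by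
      rw [h.hasJet_graphParam smoothNear_id hy rfl (by simp), deriv_const_mul_sq,
        iteratedDeriv_const_mul_pow]
      simp [Nat.factorial]
    obtain ⟨m, -, -, h2, -⟩ := h.tangentialMap_jets hj hb hcurve hjet
    exact (h1 _ _ hcurve hjet (Ne.symm hs)).1.2 (by rw [h2]; simp)
  · rintro rfl
    obtain ⟨b, hb⟩ := h.exists_isTransverse
    set K := fderiv ℝ (projMap (dualEquiv A b)) 0 with hK
    have hK0 : Function.Injective K :=
      (bijective_fderiv_projMap (dualEquiv A b) (h.dualEquiv_den_ne hb)).1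
    have hW : K ![0, 1, 0] ≠ 0 := by
      intro h0
      have := congrFun (hK0 (h0.trans (map_zero K).symm)) 1
      simp at this
    refine ⟨b, hb, Submodule.span ℝ {K ![0, 1, 0]}, ?_, ?_, ?_⟩
    · intro γ c hγ hc hc1
      obtain ⟨m, hm, h1, h2, -⟩ := h.tangentialMap_jets hj hb hγ hc
      have hne : 2 * (c - 1) * m ^ 2 ≠ 0 :=
        mul_ne_zero (mul_ne_zero two_ne_zero (sub_ne_zero.2 hc1)) (pow_ne_zero 2 hm)
      have h2' : iteratedDeriv 2 (fun t => tangentialMap S b (γ t)) 0 ≠ 0 := by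
        rw [h2]; exact smul_ne_zero hne hW
      refine ⟨⟨h1, h2'⟩, 2, by norm_num, fun j hj0 hj2 => ?_, h2', ?_⟩
      · obtain rfl : j = 1 := by lia
        rw [iteratedDeriv_one, h1]
      · rw [h2, Submodule.span_singleton_smul_eq (IsUnit.mk0 _ hne)]
    · intro γ hγ hc
      obtain ⟨m, hm, h1, h2, E, h3⟩ := h.tangentialMap_jets hj hb hγ hc
      have h2' : iteratedDeriv 2 (fun t => tangentialMap S b (γ t)) 0 = 0 := by
        rw [h2]; simp
      have hne : 12 * (r - 1) * m ^ 3 ≠ 0 :=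
        mul_ne_zero (mul_ne_zero (by norm_num) (sub_ne_zero.2 hr)) (pow_ne_zero 3 hm)
      have h4 : ∀ k : ℝ, K ![12 * (r - 1) * m ^ 3, E, 0] ≠ k • K ![0, 1, 0] := by
        intro k he
        rw [← map_smul] at he
        have := congrFun (hK0 he) 0
        simp only [Matrix.cons_val_zero, Pi.smul_apply, smul_eq_mul, mul_zero] at this
        exact hne this
      refine ⟨h1, _, ⟨3, by norm_num, fun j hj0 hj3 => ?_, ?_, rfl⟩, ?_⟩
      · interval_cases j
        · rw [iteratedDeriv_one, h1]
        · exact h2'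
      · rw [h3]
        have := h4 0
        rwa [zero_smul] at this
      · intro he
        have hmem := Submodule.mem_span_singleton_self (R := ℝ)
          (iteratedDeriv 3 (fun t => tangentialMap S b (γ t)) 0)
        rw [he, h3] at hmem
        obtain ⟨k, hk⟩ := Submodule.mem_span_singleton.1 hmem
        exact h4 k hk.symm
    · intro γ₁ γ₂ c₁ c₂ hγ₁ hγ₂ hc₁ hc₂ hlt₁ hlt₂
      obtain ⟨m₁, hm₁, -, h₁, -⟩ := h.tangentialMap_jets hj hb hγ₁ hc₁
      obtain ⟨m₂, hm₂, -, h₂, -⟩ := h.tangentialMap_jets hj hb hγ₂ hc₂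
      have p₁ : 0 < m₁ ^ 2 := by positivity
      have p₂ : 0 < m₂ ^ 2 := by positivity
      have n₂ : 0 < 2 * (c₂ - 1) * m₂ ^ 2 := mul_pos (by linarith) p₂
      have n₁ : 2 * (c₁ - 1) * m₁ ^ 2 < 0 := mul_neg_of_neg_of_pos (by linarith) p₁
      refine ⟨2 * (c₁ - 1) * m₁ ^ 2 / (2 * (c₂ - 1) * m₂ ^ 2), div_neg_of_neg_of_pos n₁ n₂, ?_⟩
      rw [h₁, h₂, smul_smul, div_mul_cancel₀ _ n₂.ne']

end IsGraphChart

end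

/-! ### Taylor coefficients of weight less than five -/

/-- The Taylor coefficients `∂ₓ^i ∂_y^j f (0)` with `i + 2 j < 5`. -/
noncomputable def weightedJet (f : ℝ × ℝ → ℝ) : Fin 9 → ℝ :=
  ![f 0, px f 0, py f 0, px (px f) 0, py (px f) 0, py (py f) 0, px (px (px f)) 0,
    py (px (px f)) 0, px (px (px (px f))) 0]

theorem px_sub_eventuallyEq {f k : ℝ × ℝ → ℝ} {u : ℝ × ℝ} (hf : SmoothNear f u)
    (hk : SmoothNear k u) : px (fun v => f v - k v) =ᶠ[𝓝 u] fun v => px f v - px k v := by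
  filter_upwards [hf.eventually, hk.eventually] with v h1 h2
  simp only [px]
  rw [fderiv_fun_sub h1.differentiableAt h2.differentiableAt]
  rfl

theorem py_sub_eventuallyEq {f k : ℝ × ℝ → ℝ} {u : ℝ × ℝ} (hf : SmoothNear f u)
    (hk : SmoothNear k u) : py (fun v => f v - k v) =ᶠ[𝓝 u] fun v => py f v - py k v := by
  filter_upwards [hf.eventually, hk.eventually] with v h1 h2
  simp only [py]
  rw [fderiv_fun_sub h1.differentiableAt h2.differentiableAt]
  rfl

theorem weightedJet_sub {f k : ℝ × ℝ → ℝ} (hf : SmoothNear f 0) (hk : SmoothNear k 0) :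
    weightedJet (fun v => f v - k v) = weightedJet f - weightedJet k := by
  have x1 := px_sub_eventuallyEq hf hk
  have y1 := py_sub_eventuallyEq hf hk
  have x2 := (px_congr x1).trans (px_sub_eventuallyEq hf.partial_x hk.partial_x)
  have x3 := (px_congr x2).trans
    (px_sub_eventuallyEq hf.partial_x.partial_x hk.partial_x.partial_x)
  have x4 := (px_congr x3).trans
    (px_sub_eventuallyEq hf.partial_x.partial_x.partial_x hk.partial_x.partial_x.partial_x)
  have yx := (py_congr x1).trans (py_sub_eventuallyEq hf.partial_x hk.partial_x)
  have yy := (py_congr y1).trans (py_sub_eventuallyEq hf.partial_y hk.partial_y)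
  have yxx := (py_congr x2).trans
    (py_sub_eventuallyEq hf.partial_x.partial_x hk.partial_x.partial_x)
  rw [weightedJet, x1.self_of_nhds, y1.self_of_nhds, x2.self_of_nhds, yx.self_of_nhds,
    yy.self_of_nhds, x3.self_of_nhds, yxx.self_of_nhds, x4.self_of_nhds]
  ext i; fin_cases i <;> rfl

/-- The polynomial `y²/2 - x² y + r x⁴/2`. -/
noncomputable def normalPoly (r : ℝ) (u : ℝ × ℝ) : ℝ :=
  u.2 ^ 2 / 2 - u.1 ^ 2 * u.2 + r * u.1 ^ 4 / 2

theorem contDiff_normalPoly (r : ℝ) : ContDiff ℝ ∞ (normalPoly r) := by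
  unfold normalPoly; fun_prop

/-- A partial derivative in `x` computed along a horizontal line. -/
theorem px_eq_of_hasDerivAt {h h' : ℝ × ℝ → ℝ} (hh : ContDiff ℝ ∞ h)
    (hd : ∀ x y : ℝ, HasDerivAt (fun t => h (t, y)) (h' (x, y)) x) : px h = h' := by
  funext ⟨x, y⟩
  have h1 := (hh.smoothNear (x, y)).hasDerivAt_comp₂ (x := fun t => t) (y := fun _ => y) (t := x)
    (contDiff_id.smoothNear x) (smoothNear_const y x)
  have := h1.unique (hd x y)
  simpa using this

/-- A partial derivative in `y` computed along a vertical line. -/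
theorem py_eq_of_hasDerivAt {h h' : ℝ × ℝ → ℝ} (hh : ContDiff ℝ ∞ h)
    (hd : ∀ x y : ℝ, HasDerivAt (fun t => h (x, t)) (h' (x, y)) y) : py h = h' := by
  funext ⟨x, y⟩
  have h1 := (hh.smoothNear (x, y)).hasDerivAt_comp₂ (x := fun _ => x) (y := fun t => t) (t := y)
    (smoothNear_const x y) (contDiff_id.smoothNear y)
  have := h1.unique (hd x y)
  simpa using this

theorem px_normalPoly (r : ℝ) :
    px (normalPoly r) = fun u => -2 * u.1 * u.2 + 2 * r * u.1 ^ 3 := by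
  refine px_eq_of_hasDerivAt (contDiff_normalPoly r) fun x y => ?_
  have := ((hasDerivAt_const x (y ^ 2 / 2)).sub ((hasDerivAt_pow 2 x).mul_const y)).add
    (((hasDerivAt_pow 4 x).const_mul r).div_const 2)
  refine this.congr_deriv ?_
  norm_num; ring

theorem py_normalPoly (r : ℝ) : py (normalPoly r) = fun u => u.2 - u.1 ^ 2 := by
  refine py_eq_of_hasDerivAt (contDiff_normalPoly r) fun x y => ?_
  have := (((hasDerivAt_pow 2 y).div_const 2).sub ((hasDerivAt_id y).const_mul (x ^ 2))).add_const
    (r * x ^ 4 / 2)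
  refine this.congr_deriv ?_
  norm_num

theorem weightedJet_normalPoly (r : ℝ) :
    weightedJet (normalPoly r) = ![0, 0, 0, 0, 0, 1, 0, -2, 12 * r] := by
  have xx : px (px (normalPoly r)) = fun u => -2 * u.2 + 6 * r * u.1 ^ 2 := by
    rw [px_normalPoly]
    refine px_eq_of_hasDerivAt (by fun_prop) fun x y => ?_
    have := (((hasDerivAt_id x).const_mul (-2)).mul_const y).add
      ((hasDerivAt_pow 3 x).const_mul (2 * r))
    refine this.congr_deriv ?_
    norm_num; ring
  have yx : py (px (normalPoly r)) = fun u => -2 * u.1 := by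
    rw [px_normalPoly]
    refine py_eq_of_hasDerivAt (by fun_prop) fun x y => ?_
    have := ((hasDerivAt_id y).const_mul (-2 * x)).add_const (2 * r * x ^ 3)
    refine this.congr_deriv ?_
    norm_num
  have yy : py (py (normalPoly r)) = fun u => 1 := by
    rw [py_normalPoly]
    exact py_eq_of_hasDerivAt (by fun_prop) fun x y => (hasDerivAt_id y).sub_const (x ^ 2)
  have xxx : px (px (px (normalPoly r))) = fun u => 12 * r * u.1 := by
    rw [xx]
    refine px_eq_of_hasDerivAt (by fun_prop) fun x y => ?_
    have := ((hasDerivAt_pow 2 x).const_mul (6 * r)).const_add (-2 * y)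
    refine this.congr_deriv ?_
    norm_num; ring
  have yxx : py (px (px (normalPoly r))) = fun u => -2 := by
    rw [xx]
    refine py_eq_of_hasDerivAt (by fun_prop) fun x y => ?_
    have := ((hasDerivAt_id y).const_mul (-2)).add_const (6 * r * x ^ 2)
    refine this.congr_deriv ?_
    norm_num
  have xxxx : px (px (px (px (normalPoly r)))) = fun u => 12 * r := by
    rw [xxx]
    refine px_eq_of_hasDerivAt (by fun_prop) fun x y => ?_
    have := (hasDerivAt_id x).const_mul (12 * r)
    refine this.congr_deriv ?_
    norm_num
  rw [weightedJet, xxxx, yxx, xxx, yy, yx, xx, px_normalPoly, py_normalPoly]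
  ext i; fin_cases i <;> simp [normalPoly]

/-- The sum of the absolute values of the monomials which generate those of weight at least five. -/
noncomputable def weightFive (u : ℝ × ℝ) : ℝ :=
  |u.1| ^ 5 + |u.1| ^ 3 * |u.2| + |u.1| * |u.2| ^ 2 + |u.2| ^ 3

section

variable {φ : ℝ × ℝ → ℝ}

theorem SmoothNear.axis {t : ℝ} (hφ : SmoothNear φ (t, 0)) :
    SmoothNear (fun t : ℝ => φ (t, 0)) t :=
  hφ.comp_of_eq (y := (t, 0)) ((contDiff_id.prodMk contDiff_const).smoothNear t) rfl

/-- Derivatives along the `x`-axis are iterated partial derivatives. -/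
theorem iteratedDeriv_axis (hφ : SmoothNear φ 0) (n : ℕ) :
    iteratedDeriv n (fun t : ℝ => φ (t, 0)) =ᶠ[𝓝 0] fun t => (px^[n] φ) (t, 0) := by
  induction n generalizing φ with
  | zero => exact EventuallyEq.of_eq (by simp)
  | succ n ih =>
    have hT : Tendsto (fun t : ℝ => (t, (0 : ℝ))) (𝓝 0) (𝓝 0) := by
      have : Continuous fun t : ℝ => (t, (0 : ℝ)) := by fun_prop
      exact this.tendsto' 0 0 rfl
    have e : deriv (fun t : ℝ => φ (t, 0)) =ᶠ[𝓝 0] fun t => px φ (t, 0) := by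
      filter_upwards [hT.eventually hφ.eventually] with t ht
      have := SmoothNear.deriv_comp₂ (h := φ) (x := fun t => t) (y := fun _ => (0 : ℝ)) (t := t) ht
        (contDiff_id.smoothNear t) (smoothNear_const 0 t)
      simpa using this
    rw [iteratedDeriv_succ', Function.iterate_succ]
    exact (iteratedDeriv_congr_nhds e n).trans (ih hφ.partial_x)

theorem isBigO_axis_iff (hφ : SmoothNear φ 0) (n : ℕ) :
    (fun t : ℝ => φ (t, 0)) =O[𝓝 0] (fun t : ℝ => t ^ n) ↔ ∀ j < n, (px^[j] φ) 0 = 0 := by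
  have hs : SmoothNear (fun t : ℝ => φ (t, 0)) 0 := SmoothNear.axis (t := 0) hφ
  rw [hs.isBigO_pow_iff]
  refine forall₂_congr fun j _ => ?_
  rw [(iteratedDeriv_axis hφ j).self_of_nhds]
  rfl

theorem weightFive_isBigO {x y : ℝ → ℝ} {p q : ℕ} (hx : x =O[𝓝 0] fun t : ℝ => t ^ p)
    (hy : y =O[𝓝 0] fun t : ℝ => t ^ q) {n : ℕ} (h1 : n ≤ 5 * p) (_h2 : n ≤ 3 * p + q)
    (h3 : n ≤ p + 2 * q) (h4 : n ≤ 3 * q) :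
    (fun t => weightFive (x t, y t)) =O[𝓝 0] fun t : ℝ => t ^ n := by
  have key : ∀ {m : ℕ}, n ≤ m → (fun t : ℝ => t ^ m) =O[𝓝 0] fun t : ℝ => t ^ n := by
    intro m hm
    refine IsBigO.of_bound 1 ?_
    filter_upwards [Metric.ball_mem_nhds (0 : ℝ) one_pos] with t ht
    rw [Metric.mem_ball, dist_zero_right] at ht
    rw [norm_pow, norm_pow, one_mul]
    exact pow_le_pow_of_le_one (norm_nonneg t) ht.le hm
  have ax : (fun t => |x t|) =O[𝓝 0] fun t : ℝ => t ^ p := hx.norm_left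
  have ay : (fun t => |y t|) =O[𝓝 0] fun t : ℝ => t ^ q := hy.norm_left
  refine (((?_ : IsBigO _ _ _).add ?_).add ?_).add ?_
  · refine (ax.pow 5).trans ?_
    simp only [← pow_mul]
    exact key (by lia)
  · refine ((ax.pow 3).mul ay).trans ?_
    simp only [← pow_mul, ← pow_add]
    exact key (by lia)
  · refine (ax.mul (ay.pow 2)).trans ?_
    simp only [← pow_mul, ← pow_add]
    exact key (by lia)
  · refine (ay.pow 3).trans ?_
    simp only [← pow_mul]
    exact key (by lia)

/-- A remainder of weight at least five has no Taylor coefficient of smaller weight. The coefficients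
are read off along the curves `(t, 0)`, `(0, t)`, `(t, t)` and `(t, t²)`. -/
theorem weightedJet_eq_zero_of_isBigO (hφ : SmoothNear φ 0) (hO : φ =O[𝓝 0] weightFive) :
    weightedJet φ = 0 := by
  have along : ∀ {x y : ℝ → ℝ}, SmoothNear x 0 → SmoothNear y 0 → x 0 = 0 → y 0 = 0 →
      ∀ {p q n : ℕ}, x =O[𝓝 0] (fun t : ℝ => t ^ p) → y =O[𝓝 0] (fun t : ℝ => t ^ q) →
      n ≤ 5 * p → n ≤ 3 * p + q → n ≤ p + 2 * q → n ≤ 3 * q →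
      ∀ j < n, iteratedDeriv j (fun t => φ (x t, y t)) 0 = 0 := by
    intro x y hx hy hx0 hy0 p q n hxO hyO h1 h2 h3 h4
    have h0 : (x 0, y 0) = (0 : ℝ × ℝ) := by rw [hx0, hy0]; rfl
    have hs : SmoothNear (fun t => φ (x t, y t)) 0 := hφ.comp_of_eq (hx.prodMk hy) h0
    rw [← hs.isBigO_pow_iff]
    have hT := (hx.prodMk hy).continuousAt.tendsto
    rw [h0] at hT
    exact (hO.comp_tendsto hT).trans (weightFive_isBigO hxO hyO h1 h2 h3 h4)
  have s0 := smoothNear_const (0 : ℝ) (0 : ℝ)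
  have sid := smoothNear_id
  have ssq : SmoothNear (fun t : ℝ => t ^ 2) 0 := (contDiff_id.pow 2).smoothNear 0
  have o0 : ∀ n : ℕ, (fun _ : ℝ => (0 : ℝ)) =O[𝓝 0] fun t : ℝ => t ^ n := fun n => isBigO_zero _ _
  have oid : (fun t : ℝ => t) =O[𝓝 0] fun t : ℝ => t ^ 1 := by
    simpa using isBigO_refl (fun t : ℝ => t) (𝓝 0)
  have osq : (fun t : ℝ => t ^ 2) =O[𝓝 0] fun t : ℝ => t ^ 2 := isBigO_refl _ _
  have did : deriv (fun t : ℝ => t) 0 = 1 := by simp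
  have dsq : deriv (fun t : ℝ => t ^ 2) 0 = 0 := by simp
  have d2sq : iteratedDeriv 2 (fun t : ℝ => t ^ 2) 0 = 2 := by
    simp
  have d3sq : iteratedDeriv 3 (fun t : ℝ => t ^ 2) 0 = 0 := by
    simp
  have d0 : deriv (fun _ : ℝ => (0 : ℝ)) 0 = 0 := by simp
  have d20 : iteratedDeriv 2 (fun _ : ℝ => (0 : ℝ)) 0 = 0 := by simp
  have h00 : ((0 : ℝ), (0 : ℝ)) = (0 : ℝ × ℝ) := rfl
  -- along the `x`-axis
  have hx : ∀ j < 5, (px^[j] φ) 0 = 0 := by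
    have h1 := along sid s0 rfl rfl oid (o0 5) (n := 5) (by lia) (by lia) (by lia) (by lia)
    intro j hj
    have := h1 j hj
    rwa [(iteratedDeriv_axis hφ j).self_of_nhds] at this
  have x0 : φ 0 = 0 := hx 0 (by lia)
  have x1 : px φ 0 = 0 := hx 1 (by lia)
  have x2 : px (px φ) 0 = 0 := hx 2 (by lia)
  have x3 : px (px (px φ)) 0 = 0 := hx 3 (by lia)
  have x4 : px (px (px (px φ))) 0 = 0 := hx 4 (by lia)
  -- along the `y`-axis
  have hy := along s0 sid rfl rfl (o0 3) oid (n := 3) (by lia) (by lia) (by lia) (by lia)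
  have y1 : py φ 0 = 0 := by
    have h1 := hy 1 (by lia)
    rw [iteratedDeriv_one, SmoothNear.deriv_comp₂ (h := φ) (x := fun _ => (0 : ℝ))
      (y := fun t => t) (t := 0) hφ s0 sid, did, d0] at h1
    simpa [h00] using h1
  have y2 : py (py φ) 0 = 0 := by
    have h1 := hy 2 (by lia)
    rw [SmoothNear.iteratedDeriv_two_comp₂ (h := φ) (x := fun _ => (0 : ℝ))
      (y := fun t => t) (t := 0) hφ s0 sid, did, d0, d20, iteratedDeriv_two_id] at h1
    simpa [h00] using h1
  -- along the diagonal
  have hd := along sid sid rfl rfl oid oid (n := 3) (by lia) (by lia) (by lia) (by lia)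
  have yx : py (px φ) 0 = 0 := by
    have h1 := hd 2 (by lia)
    rw [SmoothNear.iteratedDeriv_two_comp₂ (h := φ) (x := fun t => t)
      (y := fun t => t) (t := 0) hφ sid sid, did, iteratedDeriv_two_id] at h1
    simpa [h00, x2, y2] using h1
  -- along the parabola
  have hp := along sid ssq rfl (by simp) oid osq (n := 5) (by lia) (by lia) (by lia) (by lia)
  have yxx : py (px (px φ)) 0 = 0 := by
    have h1 := hp 4 (by lia)
    have hbase : ((0 : ℝ), (0 : ℝ) ^ 2) = 0 := by simp
    have hxy : ∀ {k : ℝ × ℝ → ℝ}, SmoothNear k 0 → SmoothNear k ((0 : ℝ), (0 : ℝ) ^ 2) := by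
      intro k hk; rw [hbase]; exact hk
    have e : deriv (fun t : ℝ => φ (t, t ^ 2)) =ᶠ[𝓝 0] fun t =>
        px φ (t, t ^ 2) + (2 * t) * py φ (t, t ^ 2) := by
      filter_upwards [(SmoothNear.eventually_comp₂ (x := fun t => t) (y := fun t => t ^ 2) (t := 0)
        (hxy hφ) sid ssq)] with t ht
      rw [SmoothNear.deriv_comp₂ (h := φ) (x := fun t => t) (y := fun t => t ^ 2) (t := t) ht
        (contDiff_id.smoothNear t) ((contDiff_id.pow 2).smoothNear t)]
      simp
      ring
    have sp : SmoothNear (fun t : ℝ => px φ (t, t ^ 2)) 0 :=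
      hφ.partial_x.comp_of_eq (sid.prodMk ssq) hbase
    have sq : SmoothNear (fun t : ℝ => py φ (t, t ^ 2)) 0 :=
      hφ.partial_y.comp_of_eq (sid.prodMk ssq) hbase
    have st : SmoothNear (fun t : ℝ => 2 * t) 0 := (smoothNear_const 2 0).mul sid
    have dt : deriv (fun t : ℝ => 2 * t) = fun _ => 2 := by
      funext t
      simp
    have d2t : iteratedDeriv 2 (fun t : ℝ => 2 * t) = 0 := by
      rw [iteratedDeriv_two, dt]; ext t; simp
    have e' : deriv (fun t : ℝ => (2 * t) * py φ (t, t ^ 2)) =ᶠ[𝓝 0] fun t =>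
        2 * py φ (t, t ^ 2) + (2 * t) * deriv (fun t : ℝ => py φ (t, t ^ 2)) t := by
      filter_upwards [sq.eventually] with t ht
      rw [deriv_mul_of_smoothNear (x := fun t : ℝ => 2 * t)
        (ContDiff.smoothNear (by fun_prop) t) ht, dt]
    have q1 : deriv (fun t : ℝ => py φ (t, t ^ 2)) 0 = 0 := by
      rw [SmoothNear.deriv_comp₂ (h := py φ) (x := fun t => t) (y := fun t => t ^ 2) (t := 0)
        (hxy hφ.partial_y) sid ssq, hbase, px_py hφ, yx, y2]
      simp
    have q2 : iteratedDeriv 2 (fun t : ℝ => py φ (t, t ^ 2)) 0 = py (px (px φ)) 0 := by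
      have c1 : px (px (py φ)) 0 = py (px (px φ)) 0 := by
        rw [(px_congr (px_py_eventuallyEq hφ)).self_of_nhds, px_py hφ.partial_x]
      rw [SmoothNear.iteratedDeriv_two_comp₂ (h := py φ) (x := fun t => t) (y := fun t => t ^ 2)
        (t := 0) (hxy hφ.partial_y) sid ssq, hbase, c1, px_py hφ, yx, y2, did, dsq]
      simp
    have p3 : iteratedDeriv 3 (fun t : ℝ => px φ (t, t ^ 2)) 0 = 6 * py (px (px φ)) 0 := by
      rw [SmoothNear.iteratedDeriv_three_comp₂ (h := px φ) (x := fun t => t) (y := fun t => t ^ 2)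
        (t := 0) (hxy hφ.partial_x) sid ssq, hbase, x2, x3, x4, yx, did, dsq, d2sq]
      simp [d3sq]
      ring
    have t3 : iteratedDeriv 3 (fun t : ℝ => (2 * t) * py φ (t, t ^ 2)) 0 =
        6 * py (px (px φ)) 0 := by
      rw [iteratedDeriv_succ', (iteratedDeriv_congr_nhds e' 2).self_of_nhds,
        iteratedDeriv_add_of_smoothNear ((smoothNear_const 2 0).mul sq) (st.mul sq.derivative) 2,
        iteratedDeriv_two_mul (smoothNear_const 2 0) sq, iteratedDeriv_two_mul st sq.derivative,
        ← iteratedDeriv_two, q1, q2, dt, d2t]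
      simp [iteratedDeriv_const, h00, y1]
      ring
    rw [iteratedDeriv_succ', (iteratedDeriv_congr_nhds e 3).self_of_nhds,
      iteratedDeriv_add_of_smoothNear sp (st.mul sq) 3, p3, t3] at h1
    linarith
  rw [weightedJet, x0, x1, y1, x2, yx, y2, x3, yxx, x4]
  ext i; fin_cases i <;> rfl

/-- Integration in `y` of a bound on the `y`-derivative. -/
theorem isBigO_of_py (hφ : SmoothNear φ 0) {E : ℝ × ℝ → ℝ} {n : ℕ} (hE0 : ∀ u, 0 ≤ E u)
    (hE : ∀ x s y : ℝ, |s| ≤ |y| → E (x, s) ≤ E (x, y)) (hpy : py φ =O[𝓝 0] E)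
    (hax : (fun t : ℝ => φ (t, 0)) =O[𝓝 0] fun t : ℝ => t ^ n) :
    φ =O[𝓝 0] fun u => |u.1| ^ n + E u * |u.2| := by
  obtain ⟨C₁, hC₁⟩ := hpy.bound
  obtain ⟨C₂, hC₂⟩ := hax.bound
  have hfst : Tendsto (Prod.fst : ℝ × ℝ → ℝ) (𝓝 0) (𝓝 0) := continuous_fst.tendsto' 0 0 rfl
  obtain ⟨ε, hε, hb⟩ := Metric.eventually_nhds_iff_ball.1 (hC₁.and hφ.eventually)
  refine IsBigO.of_bound (max |C₁| |C₂|) ?_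
  filter_upwards [Metric.ball_mem_nhds (0 : ℝ × ℝ) hε, hfst.eventually hC₂] with u hu hu2
  obtain ⟨x, y⟩ := u
  rw [Metric.mem_ball, dist_zero_right] at hu
  have hx : |x| < ε := (le_max_left _ _).trans_lt hu
  have hy : |y| < ε := (le_max_right _ _).trans_lt hu
  have hder : ∀ s ∈ Set.uIcc 0 y, HasDerivWithinAt (fun s => φ (x, s)) (py φ (x, s))
      (Set.uIcc 0 y) s ∧ ‖py φ (x, s)‖ ≤ |C₁| * E (x, y) := by
    intro s hs
    have hsy : |s| ≤ |y| := by
      have := Set.abs_sub_left_of_mem_uIcc hs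
      simpa using this
    have hmem : (x, s) ∈ Metric.ball (0 : ℝ × ℝ) ε := by
      rw [Metric.mem_ball, dist_zero_right]
      exact max_lt hx (hsy.trans_lt hy)
    obtain ⟨h1, h2⟩ := hb _ hmem
    constructor
    · have := SmoothNear.hasDerivAt_comp₂ (h := φ) (x := fun _ => x) (y := fun t => t) (t := s) h2
        (smoothNear_const x s) (contDiff_id.smoothNear s)
      refine (this.congr_deriv ?_).hasDerivWithinAt
      simp
    · refine h1.trans ?_
      rw [Real.norm_of_nonneg (hE0 _)]
      exact mul_le_mul (le_abs_self _) (hE _ _ _ hsy) (hE0 _) (abs_nonneg _)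
  have hmv := (convex_uIcc (0 : ℝ) y).norm_image_sub_le_of_norm_hasDerivWithin_le
    (fun s hs => (hder s hs).1) (fun s hs => (hder s hs).2) Set.left_mem_uIcc Set.right_mem_uIcc
  have hu2' : ‖φ (x, 0)‖ ≤ |C₂| * |x| ^ n := by
    refine hu2.trans ?_
    rw [norm_pow, Real.norm_eq_abs]
    exact mul_le_mul_of_nonneg_right (le_abs_self _) (by positivity)
  have hn : ‖|x| ^ n + E (x, y) * |y|‖ = |x| ^ n + E (x, y) * |y| :=
    Real.norm_of_nonneg (by have := hE0 (x, y); positivity)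
  rw [sub_zero, Real.norm_eq_abs y] at hmv
  calc ‖φ (x, y)‖ = ‖φ (x, 0) + (φ (x, y) - φ (x, 0))‖ := by congr 1; ring
    _ ≤ |C₂| * |x| ^ n + |C₁| * E (x, y) * |y| := (norm_add_le _ _).trans (add_le_add hu2' hmv)
    _ ≤ max |C₁| |C₂| * |x| ^ n + max |C₁| |C₂| * E (x, y) * |y| := by
      have := hE0 (x, y)
      gcongr
      · exact le_max_right _ _
      · exact le_max_left _ _
    _ = max |C₁| |C₂| * ‖|x| ^ n + E (x, y) * |y|‖ := by rw [hn]; ring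

/-- A smooth function without Taylor coefficients of weight less than five is a remainder of weight
at least five. -/
theorem isBigO_of_weightedJet_eq_zero (hφ : SmoothNear φ 0) (hj : weightedJet φ = 0) :
    φ =O[𝓝 0] weightFive := by
  have j : ∀ i, weightedJet φ i = 0 := fun i => congrFun hj i
  have c1 : px (py φ) 0 = 0 := by rw [px_py hφ]; exact j 4
  have c2 : px (px (py φ)) 0 = 0 := by
    rw [(px_congr (px_py_eventuallyEq hφ)).self_of_nhds, px_py hφ.partial_x]; exact j 7
  have b3 : py (py (py φ)) =O[𝓝 0] fun _ : ℝ × ℝ => (1 : ℝ) :=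
    hφ.partial_y.partial_y.partial_y.continuousAt.tendsto.isBigO_one ℝ
  have b2 := isBigO_of_py (n := 1) hφ.partial_y.partial_y (fun _ => zero_le_one)
    (fun _ _ _ _ => le_rfl) b3 ((isBigO_axis_iff hφ.partial_y.partial_y 1).2 fun i hi => by
      interval_cases i; exact j 5)
  have b1 := isBigO_of_py (n := 3) hφ.partial_y (fun u => by positivity)
    (fun x s y hs => by gcongr) b2 ((isBigO_axis_iff hφ.partial_y 3).2 fun i hi => by
      interval_cases i
      · exact j 2
      · exact c1
      · exact c2)
  have b0 := isBigO_of_py (n := 5) hφ (fun u => by positivity)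
    (fun x s y hs => by gcongr) b1 ((isBigO_axis_iff hφ 5).2 fun i hi => by
      interval_cases i
      · exact j 0
      · exact j 1
      · exact j 3
      · exact j 6
      · exact j 8)
  refine b0.congr_right fun u => ?_
  rw [weightFive]
  ring

end

/-! ### The normal form and its Taylor coefficients -/

section

variable {S : Set R3} {g : R3} {A : (Fin 4 → ℝ) ≃ₗ[ℝ] (Fin 4 → ℝ)}

theorem isNormalForm_iff {r : ℝ} :
    IsNormalForm S g A r ↔ ∃ f, IsGraphChart S g A f ∧ IsNormalJet f r := by
  constructor
  · rintro ⟨h1, h2, φ, hφ, hO, hS⟩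
    have hP := (contDiff_normalPoly r).smoothNear 0
    have hf : SmoothNear (fun u => normalPoly r u + φ u) 0 := hP.add hφ
    have hjet : weightedJet (fun u => normalPoly r u + φ u) =
        ![0, 0, 0, 0, 0, 1, 0, -2, 12 * r] := by
      have e1 := weightedJet_sub hf hP
      have e2 : (fun v => (fun u => normalPoly r u + φ u) v - normalPoly r v) = φ := by
        funext v; simp
      rw [e2, weightedJet_eq_zero_of_isBigO hφ hO, weightedJet_normalPoly, eq_comm, sub_eq_zero]
        at e1
      exact e1
    have j : ∀ i, weightedJet (fun u => normalPoly r u + φ u) i =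
        (![0, 0, 0, 0, 0, 1, 0, -2, 12 * r] : Fin 9 → ℝ) i := fun i => congrFun hjet i
    refine ⟨fun u => normalPoly r u + φ u, ⟨h1, h2, hf, j 0, j 1, j 2, ?_⟩,
      ⟨j 3, j 4, j 5, j 6, j 7, j 8⟩⟩
    filter_upwards [hS] with p hp
    rw [hp, normalPoly]
  · rintro ⟨f, h, hj⟩
    have hP := (contDiff_normalPoly r).smoothNear 0
    refine ⟨h.den_ne, h.map_base, fun u => f u - normalPoly r u, h.smooth.sub hP,
      isBigO_of_weightedJet_eq_zero (h.smooth.sub hP) ?_, ?_⟩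
    · rw [weightedJet_sub h.smooth hP, weightedJet_normalPoly, weightedJet, h.zero, h.px_zero,
        h.py_zero, hj.xx, hj.yx, hj.yy, hj.xxx, hj.yxx, hj.xxxx, sub_self]
    · filter_upwards [h.mem_iff] with p hp
      rw [hp, normalPoly]
      simp only
      constructor <;> intro he <;> linarith

end

/-! ### Affine frames adapted to a surface -/

/-- The affine change of coordinates with origin `g` and frame `b`, as a projective
transformation. -/
noncomputable def frameEquiv (b : Module.Basis (Fin 3) ℝ R3) (g : R3) :
    (Fin 4 → ℝ) ≃ₗ[ℝ] (Fin 4 → ℝ) where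
  toFun V := Fin.snoc (α := fun _ => ℝ) (b.equivFun (Fin.init V - V 3 • g)) (V 3)
  map_add' V W := by
    have : Fin.init (V + W) - (V + W) 3 • g =
        (Fin.init V - V 3 • g) + (Fin.init W - W 3 • g) := by
      ext i; simp [Fin.init]; ring
    rw [this, map_add]
    ext i
    refine Fin.lastCases ?_ (fun j => ?_) i
    · simp only [Pi.add_apply, Fin.snoc_last]
    · simp only [Pi.add_apply, Fin.snoc_castSucc]
  map_smul' c V := by
    have : Fin.init (c • V) - (c • V) 3 • g = c • (Fin.init V - V 3 • g) := by
      ext i; simp [Fin.init]; ring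
    rw [this, map_smul]
    ext i
    refine Fin.lastCases ?_ (fun j => ?_) i
    · simp only [Pi.smul_apply, Fin.snoc_last, RingHom.id_apply]
    · simp only [Pi.smul_apply, Fin.snoc_castSucc, RingHom.id_apply]
  invFun W := Fin.snoc (α := fun _ => ℝ) (b.equivFun.symm (Fin.init W) + W 3 • g) (W 3)
  left_inv V := by
    have h3 : ∀ (q : R3) (t : ℝ), (Fin.snoc (α := fun _ => ℝ) q t : Fin 4 → ℝ) 3 = t :=
      fun q t => Fin.snoc_last (α := fun _ => ℝ) t q
    simp only [Fin.init_snoc, h3, LinearEquiv.symm_apply_apply, sub_add_cancel]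
    exact Fin.snoc_init_self V
  right_inv W := by
    have h3 : ∀ (q : R3) (t : ℝ), (Fin.snoc (α := fun _ => ℝ) q t : Fin 4 → ℝ) 3 = t :=
      fun q t => Fin.snoc_last (α := fun _ => ℝ) t q
    simp only [Fin.init_snoc, h3, add_sub_cancel_right, LinearEquiv.apply_symm_apply]
    exact Fin.snoc_init_self W

section

variable (b : Module.Basis (Fin 3) ℝ R3) (g : R3)

theorem frameEquiv_last (V : Fin 4 → ℝ) : frameEquiv b g V 3 = V 3 :=
  Fin.snoc_last (α := fun _ => ℝ) (V 3) (b.equivFun (Fin.init V - V 3 • g))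

theorem frameEquiv_castSucc (p : R3) (t : ℝ) (i : Fin 3) :
    frameEquiv b g ![p 0, p 1, p 2, t] i.castSucc = b.equivFun (p - t • g) i := by
  have : (Fin.init (![p 0, p 1, p 2, t] : Fin 4 → ℝ) : R3) = p := by
    ext j; fin_cases j <;> rfl
  change (Fin.snoc (α := fun _ => ℝ) (b.equivFun _) _ : Fin 4 → ℝ) i.castSucc = _
  rw [Fin.snoc_castSucc, this]
  rfl

theorem projMap_frameEquiv (p : R3) : projMap (frameEquiv b g) p = b.equivFun (p - g) := by
  ext i
  rw [projMap, frameEquiv_castSucc, frameEquiv_last]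
  simp

theorem projDir_frameEquiv (p w : R3) : projDir (frameEquiv b g) p w = b.equivFun w := by
  ext i
  rw [projDir_apply, frameEquiv_castSucc, frameEquiv_last]
  simp

end

/-- A frame whose first two vectors span the kernel of a covector, the first one being
prescribed. -/
theorem exists_adapted_basis {n : R3 →L[ℝ] ℝ} (hn : n ≠ 0) {w : R3} (hw : w ≠ 0) (hnw : n w = 0) :
    ∃ b : Module.Basis (Fin 3) ℝ R3, b 0 = w ∧ n (b 1) = 0 ∧ n (b 2) ≠ 0 := by
  obtain ⟨e, he⟩ : ∃ e, n e ≠ 0 := by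
    by_contra hne
    push Not at hne
    exact hn (ContinuousLinearMap.ext hne)
  obtain ⟨v, hv, hvw⟩ : ∃ v, n v = 0 ∧ v ∉ Submodule.span ℝ {w} := by
    by_contra hne
    push Not at hne
    have hle : LinearMap.ker (n : R3 →ₗ[ℝ] ℝ) ≤ Submodule.span ℝ {w} := fun v hv => hne v hv
    have h1 := Submodule.finrank_mono hle
    rw [finrank_span_singleton hw] at h1
    have h2 := (n : R3 →ₗ[ℝ] ℝ).finrank_range_add_finrank_ker
    have h3 := Submodule.finrank_le (LinearMap.range (n : R3 →ₗ[ℝ] ℝ))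
    simp only [Module.finrank_self, Module.finrank_fintype_fun_eq_card, Fintype.card_fin] at h2 h3
    omega
  have hli : LinearIndependent ℝ ![w, v, e] := by
    rw [Fintype.linearIndependent_iff]
    intro c hc
    simp only [Fin.sum_univ_three, Matrix.cons_val_zero, Matrix.cons_val_one,
      Matrix.cons_val] at hc
    have h2 : c 2 = 0 := by
      have := congrArg n hc
      simp only [map_add, map_smul, hnw, hv, map_zero, smul_eq_mul, mul_zero, zero_add] at this
      exact (mul_eq_zero.1 this).resolve_right he
    rw [h2, zero_smul, add_zero] at hc
    have h1 : c 1 = 0 := by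
      by_contra h1
      apply hvw
      refine Submodule.mem_span_singleton.2 ⟨-(c 1)⁻¹ * c 0, ?_⟩
      have h4 : c 0 • w = -(c 1 • v) := eq_neg_of_add_eq_zero_left hc
      rw [mul_smul, h4, smul_neg, neg_smul, neg_neg, smul_smul, inv_mul_cancel₀ h1, one_smul]
    rw [h1, zero_smul, add_zero] at hc
    have h0 : c 0 = 0 := (smul_eq_zero.1 hc).resolve_right hw
    intro i
    fin_cases i
    exacts [h0, h1, h2]
  refine ⟨basisOfLinearIndependentOfCardEqFinrank hli (by simp), ?_, ?_, ?_⟩ <;>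
    simp [hv, he]

/-- A surface is a graph over its tangent plane. -/
theorem IsDefining.exists_isGraphChart {S : Set R3} {g : R3} {G : R3 → ℝ} (h : IsDefining S g G)
    {b : Module.Basis (Fin 3) ℝ R3} (h0 : fderiv ℝ G g (b 0) = 0) (h1 : fderiv ℝ G g (b 1) = 0)
    (h2 : fderiv ℝ G g (b 2) ≠ 0) : ∃ f, IsGraphChart S g (frameEquiv b g) f := by
  let X : (ℝ × ℝ) × ℝ → R3 := fun v => g + v.1.1 • b 0 + v.1.2 • b 1 + v.2 • b 2
  let X' : (ℝ × ℝ) × ℝ →L[ℝ] R3 :=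
    ((ContinuousLinearMap.fst ℝ ℝ ℝ).comp (ContinuousLinearMap.fst ℝ (ℝ × ℝ) ℝ)).smulRight (b 0)
    + ((ContinuousLinearMap.snd ℝ ℝ ℝ).comp (ContinuousLinearMap.fst ℝ (ℝ × ℝ) ℝ)).smulRight (b 1)
    + (ContinuousLinearMap.snd ℝ (ℝ × ℝ) ℝ).smulRight (b 2)
  have hXe : X = fun v => g + X' v := by
    funext v
    simp [X, X', add_assoc]
  have hX : ∀ v, HasFDerivAt X X' v := fun v => by
    rw [hXe]; exact X'.hasFDerivAt.const_add g
  have hXs : SmoothNear X 0 := by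
    rw [hXe]; exact (contDiff_const.add X'.contDiff).smoothNear 0
  have hX0 : X 0 = g := by simp [X]
  have hH : SmoothNear (fun v => G (X v)) 0 := h.2.1.comp_of_eq hXs hX0
  have hd : HasFDerivAt (fun v => G (X v)) ((fderiv ℝ G g).comp X') 0 := by
    have := h.2.1.differentiableAt.hasFDerivAt
    rw [← hX0] at this
    have := this.comp 0 (hX 0)
    rwa [hX0] at this
  obtain ⟨f, hf, hf0, hev⟩ := exists_implicit_function hH (by simp only [hX0]; exact h.eq_zero) (by
    rw [hd.fderiv]; simpa [X'] using h2)
  -- the graph is tangent to the plane spanned by `b 0` and `b 1`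
  have hdf : fderiv ℝ f 0 = 0 := by
    have hΓ : HasFDerivAt (fun u : ℝ × ℝ => (u, f u))
        ((ContinuousLinearMap.id ℝ (ℝ × ℝ)).prod (fderiv ℝ f 0)) 0 :=
      (hasFDerivAt_id 0).prodMk hf.differentiableAt.hasFDerivAt
    have hΓ0 : ((0 : ℝ × ℝ), f 0) = 0 := by rw [hf0]; rfl
    have hd' := hd
    rw [← hΓ0] at hd'
    have hc := hd'.comp (0 : ℝ × ℝ) hΓ
    have hT : Tendsto (fun u : ℝ × ℝ => (u, f u)) (𝓝 0) (𝓝 0) := by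
      have := hΓ.continuousAt.tendsto
      rwa [hΓ0] at this
    have hz : HasFDerivAt ((fun v => G (X v)) ∘ fun u : ℝ × ℝ => (u, f u))
        (0 : ℝ × ℝ →L[ℝ] ℝ) 0 := by
      refine (hasFDerivAt_const (0 : ℝ) (0 : ℝ × ℝ)).congr_of_eventuallyEq ?_
      filter_upwards [hT.eventually hev] with u hu
      exact hu.2 rfl
    refine ContinuousLinearMap.ext fun v => ?_
    have h3 := DFunLike.congr_fun (hc.unique hz) v
    simp only [X', ContinuousLinearMap.comp_apply, ContinuousLinearMap.prod_apply,
      ContinuousLinearMap.id_apply, add_apply, ContinuousLinearMap.smulRight_apply,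
      ContinuousLinearMap.coe_fst', ContinuousLinearMap.coe_snd', map_add, map_smul, h0, h1,
      smul_eq_mul, mul_zero, zero_add, zero_apply] at h3
    simpa using (mul_eq_zero.1 h3).resolve_right h2
  refine ⟨f, ?_, ?_, hf, hf0, by simp [px, hdf], by simp [py, hdf], ?_⟩
  · rw [frameEquiv_last]; simp
  · rw [projMap_frameEquiv, sub_self, map_zero]
  · have hT : Tendsto (fun p : R3 => (((b.equivFun (p - g) 0, b.equivFun (p - g) 1),
        b.equivFun (p - g) 2) : (ℝ × ℝ) × ℝ)) (𝓝 g) (𝓝 0) := by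
      have hc : Continuous b.equivFun := b.equivFun.toLinearMap.continuous_of_finiteDimensional
      have : Continuous (fun p : R3 => (((b.equivFun (p - g) 0, b.equivFun (p - g) 1),
        b.equivFun (p - g) 2) : (ℝ × ℝ) × ℝ)) := by fun_prop
      refine this.tendsto' g 0 ?_
      simp only [sub_self, map_zero]
      rfl
    filter_upwards [h.2.2.2, hT.eventually hev] with p hp hq
    have hXp : X ((b.equivFun (p - g) 0, b.equivFun (p - g) 1), b.equivFun (p - g) 2) = p := by
      have := b.sum_equivFun (p - g)
      rw [Fin.sum_univ_three] at this
      simp only [X, add_assoc]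
      rw [← add_assoc (_ • b 0), this]
      simp
    rw [hXp] at hq
    rw [hp, hq, projMap_frameEquiv]
    exact eq_comm

/-! ### Jets at a godron -/

section

variable {S : Set R3} {g : R3} {A : (Fin 4 → ℝ) ≃ₗ[ℝ] (Fin 4 → ℝ)} {f : ℝ × ℝ → ℝ}

theorem IsArc.eventually_mem {C : Set R3} {γ : ℝ → R3} (h : IsArc C g γ) :
    ∀ᶠ t in 𝓝 0, γ t ∈ C := by
  obtain ⟨hs, h0, -, hev⟩ := h
  obtain ⟨ε, h1, hε⟩ := (hev.and self_mem_nhdsWithin).exists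
  have hT : Tendsto γ (𝓝 0) (𝓝 g) := by simpa [ContinuousAt, h0] using hs.continuousAt
  filter_upwards [hT.eventually h1, Ioo_mem_nhds (neg_lt_zero.2 hε) hε] with t h2 h3
  exact h2.2 ⟨t, h3, rfl⟩

/-- At a point of the parabolic curve, in a chart whose first axis is the asymptotic line, the second
form is a nonzero multiple of `dy²`. -/
theorem IsGraphChart.second_jet (h : IsGraphChart S g A f) (hg : g ∈ parabolicCurve S) {w : R3}
    (hw : IsAsymptotic S g w) (hA : projDir A g w = ![1, 0, 0]) :
    px (px f) 0 = 0 ∧ py (px f) 0 = 0 ∧ py (py f) 0 ≠ 0 := by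
  have hp := h.isGraphPoint
  have hw' : IsAsymptotic S (graphParam A f 0) w := by rwa [h.graphParam_zero]
  have hg' : graphParam A f 0 ∈ parabolicCurve S := by rwa [h.graphParam_zero]
  obtain ⟨a, b, -, hQ, he⟩ := (hp.isAsymptotic_iff w).1 hw'
  rw [h.graphParam_zero, hA] at he
  have ha : a = 1 := (congrFun he 0).symm
  have hb : b = 0 := (congrFun he 1).symm
  rw [ha, hb] at hQ
  have hxx : px (px f) 0 = 0 := by simpa [secondForm] using hQ
  obtain ⟨a', b', -, -, hun⟩ := hp.mem_parabolicCurve_iff.1 hg'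
  obtain ⟨k, hk1, hk2⟩ := hun 1 0 hQ
  have hk : k ≠ 0 := by rintro rfl; simp at hk1
  have hb' : b' = 0 := (mul_eq_zero.1 hk2.symm).resolve_left hk
  have hyx : py (px f) 0 = 0 := by
    obtain ⟨m, -, hm⟩ := hun (py (py f) 0) (-2 * py (px f) 0) (by
      simp only [secondForm, hxx]; ring)
    rw [hb'] at hm
    linarith
  refine ⟨hxx, hyx, fun hyy => ?_⟩
  obtain ⟨m, -, hm⟩ := hun 0 1 (by simp [secondForm, hyy])
  rw [hb'] at hm
  simp at hm

/-- The parabolic curve is tangent to the asymptotic line only if the latter has `4`-point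
contact. -/
theorem IsGraphChart.third_jet (h : IsGraphChart S g A f) (hxx : px (px f) 0 = 0)
    (hyx : py (px f) 0 = 0) (hyy : py (py f) 0 ≠ 0) {γ : ℝ → R3} (hγ : IsParabolicArc S g γ)
    (hA : projDir A g (deriv γ 0) = ![1, 0, 0]) : px (px (px f)) 0 = 0 := by
  have hf := h.smooth
  have hs : SmoothNear γ 0 := hγ.1
  have hγ0 : γ 0 = g := hγ.2.1
  have hT : Tendsto γ (𝓝 0) (𝓝 g) := by simpa [ContinuousAt, hγ0] using hs.continuousAt
  have hu : SmoothNear (fun t => planeCoord A (γ t)) 0 :=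
    (smoothNear_planeCoord h.den_ne).comp_of_eq hs hγ0
  have hu0 : planeCoord A (γ 0) = 0 := by rw [hγ0, h.planeCoord_base]
  have hTu : Tendsto (fun t => planeCoord A (γ t)) (𝓝 0) (𝓝 0) := h.tendsto_planeCoord.comp hT
  have hz : (fun t => hessianDet f (planeCoord A (γ t))) =ᶠ[𝓝 0] fun _ => 0 := by
    filter_upwards [IsArc.eventually_mem hγ, hT.eventually h.eventually_mem_iff,
      hTu.eventually h.eventually_isGraphPoint,
      hTu.eventually (hf.partial_y.partial_y.continuousAt.eventually_ne hyy)] with t h1 h2 h3 h4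
    have h5 := h2.1 h1.1
    rw [← h5] at h1
    have h6 := (h3.mem_parabolicCurve_iff_hessian h4).1 h1
    rw [hessianDet, ← sq]
    exact h6
  have hd : deriv (fun t => planeCoord A (γ t)) 0 = ((A ![g 0, g 1, g 2, 1] 3)⁻¹, 0) := by
    have h1 := (smoothNear_planeCoord h.den_ne).differentiableAt.hasFDerivAt
    rw [← hγ0] at h1
    have h2 := h1.comp_hasDerivAt (0 : ℝ) hs.hasDerivAt
    rw [hγ0] at h2
    refine h2.deriv.trans ?_
    rw [fderiv_planeCoord h.den_ne, fderiv_projMap A h.den_ne, hA]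
    simp
  have hx : deriv (fun t => (planeCoord A (γ t)).1) 0 = (A ![g 0, g 1, g 2, 1] 3)⁻¹ := by
    exact ((ContinuousLinearMap.fst ℝ ℝ ℝ).hasFDerivAt.comp_hasDerivAt (0 : ℝ) hu.hasDerivAt).deriv.trans
      (congrArg Prod.fst hd)
  have hy : deriv (fun t => (planeCoord A (γ t)).2) 0 = 0 := by
    exact ((ContinuousLinearMap.snd ℝ ℝ ℝ).hasFDerivAt.comp_hasDerivAt (0 : ℝ) hu.hasDerivAt).deriv.trans
      (congrArg Prod.snd hd)
  have along : ∀ {k : ℝ × ℝ → ℝ}, SmoothNear k 0 →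
      deriv (fun t => k (planeCoord A (γ t))) 0 = px k 0 * (A ![g 0, g 1, g 2, 1] 3)⁻¹ := by
    intro k hk
    have := SmoothNear.deriv_comp₂ (h := k) (x := fun t => (planeCoord A (γ t)).1)
      (y := fun t => (planeCoord A (γ t)).2) (t := 0) (by rw [Prod.mk.eta, hu0]; exact hk) hu.fst hu.snd
    rw [hx, hy, mul_zero, add_zero, Prod.mk.eta, hu0] at this
    exact this
  have sm : ∀ {k : ℝ × ℝ → ℝ}, SmoothNear k 0 → SmoothNear (fun t => k (planeCoord A (γ t))) 0 :=
    fun hk => hk.comp_of_eq hu hu0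
  have h7 := hz.deriv_eq
  simp only [hessianDet] at h7
  have sxx := sm hf.partial_x.partial_x
  have syx := sm hf.partial_x.partial_y
  have syy := sm hf.partial_y.partial_y
  have h8 := ((sxx.mul syy).hasDerivAt.sub (syx.mul syx).hasDerivAt).deriv.symm.trans h7
  rw [deriv_mul_of_smoothNear sxx syy, deriv_mul_of_smoothNear syx syx,
    along hf.partial_x.partial_x, hu0, hxx, hyx] at h8
  simp only [zero_mul, mul_zero, add_zero, sub_zero, deriv_const] at h8
  simpa [hyy, h.den_ne] using h8

/-! ### Scaling of the coordinates -/

theorem px_scale {h : ℝ × ℝ → ℝ} (hh : SmoothNear h 0) (ν s : ℝ) :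
    (px (fun u => ν * h (u.1, s * u.2)) =ᶠ[𝓝 0] fun u => ν * px h (u.1, s * u.2)) ∧
    (py (fun u => ν * h (u.1, s * u.2)) =ᶠ[𝓝 0] fun u => (ν * s) * py h (u.1, s * u.2)) := by
  let L : ℝ × ℝ →L[ℝ] ℝ × ℝ :=
    (ContinuousLinearMap.fst ℝ ℝ ℝ).prod (s • ContinuousLinearMap.snd ℝ ℝ ℝ)
  have hL : Tendsto L (𝓝 0) (𝓝 0) := by simpa using L.continuous.tendsto 0
  have hd : ∀ᶠ u in 𝓝 0, HasFDerivAt (fun u : ℝ × ℝ => ν * h (u.1, s * u.2))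
      (ν • (fderiv ℝ h (u.1, s * u.2)).comp L) u := by
    filter_upwards [hL.eventually hh.eventually] with u hu
    exact ((hu.differentiableAt.hasFDerivAt (x := L u)).comp u L.hasFDerivAt).const_mul ν
  constructor
  · filter_upwards [hd] with u hu
    rw [px, hu.fderiv]
    simp [L, px]
  · filter_upwards [hd] with u hu
    rw [py, hu.fderiv]
    have : ((0 : ℝ), s) = s • (0, 1) := by simp
    simp only [smul_apply, ContinuousLinearMap.comp_apply, L, ContinuousLinearMap.prod_apply,
      ContinuousLinearMap.coe_fst', ContinuousLinearMap.coe_snd', smul_eq_mul, mul_one]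
    rw [this, map_smul, py, smul_eq_mul, mul_assoc]

/-- The scaling of the `y` and `z` coordinates by `μ` and `ν`. -/
noncomputable def scaleEquiv {μ ν : ℝ} (hμ : μ ≠ 0) (hν : ν ≠ 0) :
    (Fin 4 → ℝ) ≃ₗ[ℝ] (Fin 4 → ℝ) :=
  LinearEquiv.piCongrRight fun i => LinearEquiv.smulOfNeZero ℝ ℝ ((![1, μ, ν, 1] : Fin 4 → ℝ) i)
    (by fin_cases i <;> simp [hμ, hν])

theorem projMap_scaleEquiv {μ ν : ℝ} (hμ : μ ≠ 0) (hν : ν ≠ 0) (p : R3) :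
    projMap (A.trans (scaleEquiv hμ hν)) p =
      ![projMap A p 0, μ * projMap A p 1, ν * projMap A p 2] := by
  ext i
  fin_cases i <;> simp [projMap, scaleEquiv, mul_div_assoc]

theorem IsGraphChart.scale (h : IsGraphChart S g A f) {s ν : ℝ} (hs : s ≠ 0) (hν : ν ≠ 0) :
    IsGraphChart S g (A.trans (scaleEquiv (inv_ne_zero hs) hν))
      (fun u => ν * f (u.1, s * u.2)) := by
  have hl : SmoothNear (fun u : ℝ × ℝ => (u.1, s * u.2)) 0 := ContDiff.smoothNear (by fun_prop) 0
  have hl0 : ((0 : ℝ × ℝ).1, s * (0 : ℝ × ℝ).2) = (0 : ℝ × ℝ) := by simp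
  refine ⟨?_, ?_, (smoothNear_const ν 0).mul (h.smooth.comp_of_eq hl hl0), ?_, ?_, ?_, ?_⟩
  · simpa [scaleEquiv] using h.den_ne
  · rw [projMap_scaleEquiv, h.map_base]
    ext i; fin_cases i <;> simp
  · rw [hl0, h.zero, mul_zero]
  · refine (px_scale h.smooth ν s).1.self_of_nhds.trans ?_
    beta_reduce
    rw [hl0, h.px_zero, mul_zero]
  · refine (px_scale h.smooth ν s).2.self_of_nhds.trans ?_
    beta_reduce
    rw [hl0, h.py_zero, mul_zero]
  · filter_upwards [h.mem_iff] with p hp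
    rw [hp, projMap_scaleEquiv]
    simp [hs, hν]

theorem IsGodronJet.scale {k a d : ℝ} (hj : IsGodronJet f k a d) (hf : SmoothNear f 0)
    (ν s : ℝ) : IsGodronJet (fun u => ν * f (u.1, s * u.2)) (ν * s ^ 2 * k) (ν * s * a) (ν * d) := by
  have hl0 : ((0 : ℝ × ℝ).1, s * (0 : ℝ × ℝ).2) = (0 : ℝ × ℝ) := by simp
  have ex := (px_scale hf ν s).1
  have ey := (px_scale hf ν s).2
  have exx := (px_congr ex).trans (px_scale hf.partial_x ν s).1
  have exy := (py_congr ex).trans (px_scale hf.partial_x ν s).2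
  have eyy := (py_congr ey).trans (px_scale hf.partial_y (ν * s) s).2
  have exxx := (px_congr exx).trans (px_scale hf.partial_x.partial_x ν s).1
  have exxy := (py_congr exx).trans (px_scale hf.partial_x.partial_x ν s).2
  have exxxx := (px_congr exxx).trans (px_scale hf.partial_x.partial_x.partial_x ν s).1
  refine ⟨?_, ?_, ?_, ?_, ?_, ?_⟩
  · refine exx.self_of_nhds.trans ?_
    beta_reduce
    rw [hl0, hj.xx, mul_zero]
  · refine exy.self_of_nhds.trans ?_
    beta_reduce
    rw [hl0, hj.yx, mul_zero]
  · refine eyy.self_of_nhds.trans ?_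
    beta_reduce
    rw [hl0, hj.yy]; ring
  · refine exxx.self_of_nhds.trans ?_
    beta_reduce
    rw [hl0, hj.xxx, mul_zero]
  · refine exxy.self_of_nhds.trans ?_
    beta_reduce
    rw [hl0, hj.yxx]
  · refine exxxx.self_of_nhds.trans ?_
    beta_reduce
    rw [hl0, hj.xxxx]

/-- Simple godrons have a normal form: once the asymptotic line is the `x`-axis, only the scaling of
the coordinates `y` and `z` is needed. -/
theorem IsSimpleGodron.exists_isNormalJet (hS : IsSmoothSurface S) (hg : IsSimpleGodron S g) :
    ∃ A f r, IsGraphChart S g A f ∧ IsNormalJet f r := by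
  obtain ⟨⟨hgP, γ, hγ, hw⟩, hsw⟩ := hg
  obtain ⟨G, hG⟩ := hS g hgP.1
  have hGw : fderiv ℝ G g (deriv γ 0) = 0 := by
    have h1 := (lineContact_iff hG _ 3).1 hw.2
    have hl : SmoothNear (fun t : ℝ => g + t • deriv γ 0) 0 := ContDiff.smoothNear (by fun_prop) 0
    have hs : SmoothNear (fun t : ℝ => G (g + t • deriv γ 0)) 0 :=
      hG.2.1.comp_of_eq hl (by simp)
    have h2 := (hs.isBigO_pow_iff 3).1 h1 1 (by omega)
    rw [iteratedDeriv_one] at h2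
    have hd : HasDerivAt (fun t : ℝ => g + t • deriv γ 0) (deriv γ 0) 0 := by
      simpa using ((hasDerivAt_id (0 : ℝ)).smul_const (deriv γ 0)).const_add g
    have h3 : HasFDerivAt G (fderiv ℝ G g) (g + (0 : ℝ) • deriv γ 0) := by
      simpa using hG.2.1.differentiableAt.hasFDerivAt
    exact (h3.comp_hasDerivAt (0 : ℝ) hd).deriv.symm.trans h2
  obtain ⟨b, hb0, hb1, hb2⟩ := exists_adapted_basis hG.2.2.1 hw.1 hGw
  obtain ⟨f, hf⟩ := hG.exists_isGraphChart (by rw [hb0, hGw]) hb1 hb2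
  have hA : projDir (frameEquiv b g) g (deriv γ 0) = ![1, 0, 0] := by
    rw [projDir_frameEquiv, ← hb0]
    ext i; fin_cases i <;> simp
  obtain ⟨hxx, hyx, hyy⟩ := hf.second_jet hgP hw hA
  have hxxx := hf.third_jet hxx hyx hyy hγ hA
  have hj : IsGodronJet f _ _ _ := ⟨hxx, hyx, rfl, hxxx, rfl, rfl⟩
  obtain ⟨ξ, κ, hκ⟩ := hf.exists_swallowtailChart hsw
  have ha := (hκ.jets hj hyy hf.smooth hf.px_zero hf.py_zero hf.zero).1
  set k := py (py f) 0
  set a := py (px (px f)) 0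
  have hs : -a / (2 * k) ≠ 0 := div_ne_zero (neg_ne_zero.2 ha) (mul_ne_zero two_ne_zero hyy)
  have hν : (k * (-a / (2 * k)) ^ 2)⁻¹ ≠ 0 := inv_ne_zero (mul_ne_zero hyy (pow_ne_zero 2 hs))
  refine ⟨_, _, (k * (-a / (2 * k)) ^ 2)⁻¹ * px (px (px (px f))) 0 / 12, hf.scale hs hν,
    IsGodronJet.isNormalJet ?_⟩
  convert hj.scale hf.smooth (k * (-a / (2 * k)) ^ 2)⁻¹ (-a / (2 * k)) using 1
  · field_simp
  · field_simp
  · ring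

end

/-! ### The cross-ratio of four coplanar lines -/

/-- Three lines of slopes `β₁, β₂, β₃` and the line of infinite slope have the cross-ratio given by
the usual formula, whatever the basis of the plane in which it is computed. -/
theorem isCrossRatio_span_iff {V : Type*} [AddCommGroup V] [Module ℝ V] {E F : V}
    (hEF : LinearIndependent ℝ ![E, F]) {β₁ β₂ β₃ : ℝ} (hβ : β₂ ≠ β₃) (ρ : ℝ) :
    IsCrossRatio (Submodule.span ℝ {E + β₁ • F}) (Submodule.span ℝ {E + β₂ • F})
      (Submodule.span ℝ {E + β₃ • F}) (Submodule.span ℝ {F}) ρ ↔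
      ρ = (β₁ - β₃) / (β₂ - β₃) := by
  have hβ' : β₂ - β₃ ≠ 0 := sub_ne_zero.2 hβ
  constructor
  · rintro ⟨e, f, hef, a₁, b₁, a₂, b₂, a₃, b₃, a₄, b₄, h1, h2, h3, h4, hd, hd', rfl⟩
    obtain ⟨m₁, hm₁⟩ := Submodule.span_singleton_eq_span_singleton.1 h1.symm
    obtain ⟨m₂, hm₂⟩ := Submodule.span_singleton_eq_span_singleton.1 h2.symm
    obtain ⟨m₃, hm₃⟩ := Submodule.span_singleton_eq_span_singleton.1 h3.symm
    obtain ⟨m₄, hm₄⟩ := Submodule.span_singleton_eq_span_singleton.1 h4.symm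
    simp only [Units.smul_def] at hm₁ hm₂ hm₃ hm₄
    have n₁ := m₁.ne_zero
    have n₂ := m₂.ne_zero
    have n₃ := m₃.ne_zero
    have n₄ := m₄.ne_zero
    generalize (m₁ : ℝ) = m₁ at *
    generalize (m₂ : ℝ) = m₂ at *
    generalize (m₃ : ℝ) = m₃ at *
    generalize (m₄ : ℝ) = m₄ at *
    -- the coordinates of `E + β • F` in the basis `e, f` are affine functions of `β`
    have hE : E = m₁ • (a₁ • e + b₁ • f) - β₁ • F := eq_sub_of_add_eq hm₁.symm
    have key : ∀ {m a b β : ℝ}, m • (a • e + b • f) = E + β • F →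
        m * a = m₁ * a₁ + (β - β₁) * (m₄ * a₄) ∧ m * b = m₁ * b₁ + (β - β₁) * (m₄ * b₄) := by
      intro m a b β hm
      rw [hE, ← hm₄] at hm
      have h0 : (m * a - (m₁ * a₁ + (β - β₁) * (m₄ * a₄))) • e +
          (m * b - (m₁ * b₁ + (β - β₁) * (m₄ * b₄))) • f = 0 := by
        rw [← sub_eq_zero] at hm
        rw [← hm]
        module
      obtain ⟨k1, k2⟩ := LinearIndependent.pair_iff.1 hef _ _ h0
      exact ⟨sub_eq_zero.1 k1, sub_eq_zero.1 k2⟩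
    obtain ⟨ka₂, kb₂⟩ := key hm₂
    obtain ⟨ka₃, kb₃⟩ := key hm₃
    have i₂₃ : m₂ * m₃ * (a₂ * b₃ - a₃ * b₂) =
        m₁ * m₄ * (β₃ - β₂) * (a₁ * b₄ - a₄ * b₁) := by
      linear_combination (m₃ * b₃) * ka₂
        + (m₁ * a₁ + (β₂ - β₁) * (m₄ * a₄)) * kb₃ - (m₃ * a₃) * kb₂
        - (m₁ * b₁ + (β₂ - β₁) * (m₄ * b₄)) * ka₃
    have i₁₃ : m₃ * (a₁ * b₃ - a₃ * b₁) = m₄ * (β₃ - β₁) * (a₁ * b₄ - a₄ * b₁) := by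
      linear_combination a₁ * kb₃ - b₁ * ka₃
    have i₂₄ : m₂ * (a₂ * b₄ - a₄ * b₂) = m₁ * (a₁ * b₄ - a₄ * b₁) := by
      linear_combination b₄ * ka₂ - a₄ * kb₂
    rw [div_eq_div_iff (mul_ne_zero hd hd') hβ']
    have n : m₂ * m₃ * (m₁ * m₄) ≠ 0 := mul_ne_zero (mul_ne_zero n₂ n₃) (mul_ne_zero n₁ n₄)
    apply mul_left_cancel₀ n
    calc m₂ * m₃ * (m₁ * m₄) * ((a₁ * b₃ - a₃ * b₁) * (a₂ * b₄ - a₄ * b₂) * (β₂ - β₃))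
        = m₁ * m₄ * (β₂ - β₃) * (m₃ * (a₁ * b₃ - a₃ * b₁)) * (m₂ * (a₂ * b₄ - a₄ * b₂)) := by ring
      _ = (β₁ - β₃) * (m₁ * m₄ * (a₁ * b₄ - a₄ * b₁)) *
          (m₁ * m₄ * (β₃ - β₂) * (a₁ * b₄ - a₄ * b₁)) := by rw [i₁₃, i₂₄]; ring
      _ = (β₁ - β₃) * (m₁ * m₄ * (a₁ * b₄ - a₄ * b₁)) *
          (m₂ * m₃ * (a₂ * b₃ - a₃ * b₂)) := by rw [i₂₃]
      _ = _ := by ring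
  · rintro rfl
    refine ⟨E, F, hEF, 1, β₁, 1, β₂, 1, β₃, 0, 1, by simp, by simp, by simp, by simp, ?_, by simp, ?_⟩
    · simpa [sub_eq_zero] using hβ.symm
    · have : β₃ - β₂ ≠ 0 := sub_ne_zero.2 hβ.symm
      simp only [one_mul, mul_one, zero_mul, sub_zero]
      rw [div_eq_div_iff hβ' this]
      ring

/-! ### Legendrian lines in a graph chart -/

section

variable {S : Set R3} {g : R3} {A : (Fin 4 → ℝ) ≃ₗ[ℝ] (Fin 4 → ℝ)} {f : ℝ × ℝ → ℝ}

namespace IsGraphChart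

variable (h : IsGraphChart S g A f)
include h

theorem deriv_projMap_curve {γ : ℝ → R3} (hγ : IsCurveOn S g γ) (i : Fin 3) :
    deriv (fun t => projMap A (γ t) i) 0 = fderiv ℝ (projMap A) g (deriv γ 0) i := by
  have hΦ : SmoothNear (projMap A) (γ 0) := by rw [hγ.2.1]; exact smoothNear_projMap A h.den_ne
  have hs : SmoothNear (fun t => projMap A (γ t)) 0 := hΦ.comp hγ.1
  rw [← deriv_apply hs, hΦ.deriv_comp hγ.1, hγ.2.1]

theorem curve_third_coord {γ : ℝ → R3} (hγ : IsCurveOn S g γ) :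
    (fun t => projMap A (γ t) 2) =ᶠ[𝓝 0] fun t => f (projMap A (γ t) 0, projMap A (γ t) 1) := by
  have hT : Tendsto γ (𝓝 0) (𝓝 g) := by simpa [ContinuousAt, hγ.2.1] using hγ.1.continuousAt
  filter_upwards [hγ.2.2, hT.eventually h.mem_iff] with t h1 h2
  exact h2.1 h1

/-- The first derivative of a curve having a `2`-jet `y = c x²`. -/
theorem fderiv_projMap_deriv {γ : ℝ → R3} (hγ : IsCurveOn S g γ) {c : ℝ} (hc : HasJet A γ c) :
    fderiv ℝ (projMap A) g (deriv γ 0) 0 ≠ 0 ∧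
    fderiv ℝ (projMap A) g (deriv γ 0) =
      fderiv ℝ (projMap A) g (deriv γ 0) 0 • ![1, 0, 0] := by
  have hΦ : SmoothNear (fun t => projMap A (γ t)) 0 :=
    (smoothNear_projMap A h.den_ne).comp_of_eq hγ.1 hγ.2.1
  obtain ⟨-, -, hx, hy, -⟩ := hc
  rw [h.deriv_projMap_curve hγ] at hx hy
  have h0 : (projMap A (γ 0) 0, projMap A (γ 0) 1) = (0 : ℝ × ℝ) := by
    rw [hγ.2.1, h.map_base]; rfl
  have hz : deriv (fun t => projMap A (γ t) 2) 0 = 0 := by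
    rw [(h.curve_third_coord hγ).deriv_eq,
      SmoothNear.deriv_comp₂ (by rw [h0]; exact h.smooth) (hΦ.apply 0) (hΦ.apply 1), h0,
      h.px_zero, h.py_zero]
    ring
  rw [h.deriv_projMap_curve hγ] at hz
  refine ⟨hx, ?_⟩
  ext i
  fin_cases i
  · simp
  · simpa using hy
  · simpa using hz

/-- The second derivative of a curve having a `2`-jet `y = c x²`, modulo its tangent line: it depends
on the jet in an affine way. -/
theorem mkQ_iteratedDeriv_two (hxx : px (px f) 0 = 0) {γ : ℝ → R3} (hγ : IsCurveOn S g γ) {c : ℝ}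
    (hc : HasJet A γ c) {W Q : R3} (hW : fderiv ℝ (projMap A) g W = ![0, 1, 0])
    (hQ : fderiv ℝ (projMap A) g Q = iteratedFDeriv ℝ 2 (projMap A) g (fun _ => deriv γ 0)) :
    (Submodule.span ℝ {deriv γ 0}).mkQ (iteratedDeriv 2 γ 0) =
      -(Submodule.span ℝ {deriv γ 0}).mkQ Q +
      (2 * c * fderiv ℝ (projMap A) g (deriv γ 0) 0 ^ 2) •
        (Submodule.span ℝ {deriv γ 0}).mkQ W := by
  have hΦ : SmoothNear (projMap A) (γ 0) := by rw [hγ.2.1]; exact smoothNear_projMap A h.den_ne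
  have hs : SmoothNear (fun t => projMap A (γ t)) 0 := hΦ.comp hγ.1
  obtain ⟨hm, hv⟩ := h.fderiv_projMap_deriv hγ hc
  set m := fderiv ℝ (projMap A) g (deriv γ 0) 0 with hmdef
  obtain ⟨-, -, -, hy, hyy⟩ := hc
  rw [h.deriv_projMap_curve hγ, ← hmdef] at hyy
  have h0 : (projMap A (γ 0) 0, projMap A (γ 0) 1) = (0 : ℝ × ℝ) := by
    rw [hγ.2.1, h.map_base]; rfl
  have hzz : iteratedDeriv 2 (fun t => projMap A (γ t) 2) 0 = 0 := by
    rw [(iteratedDeriv_congr_nhds (h.curve_third_coord hγ) 2).self_of_nhds,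
      SmoothNear.iteratedDeriv_two_comp₂ (by rw [h0]; exact h.smooth) (hs.apply 0) (hs.apply 1), h0,
      h.px_zero, h.py_zero, hxx, hy]
    ring
  have h2 := hΦ.iteratedDeriv_two_comp hγ.1
  rw [hγ.2.1, ← hQ] at h2
  set n := iteratedDeriv 2 (fun t => projMap A (γ t) 0) 0 with hn
  have h3 : iteratedDeriv 2 (fun t => projMap A (γ t)) 0 =
      fderiv ℝ (projMap A) g ((n / m) • deriv γ 0 + (2 * c * m ^ 2) • W) := by
    rw [map_add, map_smul, map_smul, hv, hW]
    ext i
    rw [iteratedDeriv_apply hs]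
    fin_cases i
    · simp [hn, hm]
    · simpa using hyy
    · simpa using hzz
  rw [h3, ← map_add] at h2
  have h4 := (bijective_fderiv_projMap A h.den_ne).1 h2
  have h5 : iteratedDeriv 2 γ 0 = (n / m) • deriv γ 0 + (-Q + (2 * c * m ^ 2) • W) := by
    rw [eq_sub_of_add_eq' h4.symm]
    abel
  have hv0 : (Submodule.span ℝ {deriv γ 0}).mkQ (deriv γ 0) = 0 := by simp
  rw [h5, map_add, map_smul, hv0, smul_zero, zero_add, map_add, map_neg, map_smul]

/-- The fibre of contact elements is directed by the second axis of the chart. -/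
theorem fibreLine_eq {v W : R3} {m : ℝ} (hm : m ≠ 0)
    (hv : fderiv ℝ (projMap A) g v = m • ![1, 0, 0])
    (hW : fderiv ℝ (projMap A) g W = ![0, 1, 0]) :
    fibreLine S g v = Submodule.span ℝ {(0, (Submodule.span ℝ {v}).mkQ W)} := by
  have hmem : ∀ w, w ∈ tangentDirections S g ↔ fderiv ℝ (projMap A) g w 2 = 0 := by
    intro w
    rw [tangentDirections_eq h.isDefining, LinearMap.mem_ker, ContinuousLinearMap.coe_coe,
      fderiv_graphEq h.den_ne (by rw [h.planeCoord_base]; exact h.smooth), h.planeCoord_base,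
      h.px_zero, h.py_zero]
    simp
  apply le_antisymm
  · rintro _ ⟨w, hw, rfl⟩
    have h2 := (hmem w).1 hw
    set p := fderiv ℝ (projMap A) g w 0
    set q := fderiv ℝ (projMap A) g w 1
    have h3 : w = (p / m) • v + q • W := by
      apply (bijective_fderiv_projMap A h.den_ne).1
      rw [map_add, map_smul, map_smul, hv, hW]
      ext i
      fin_cases i
      · simp [p, hm]
      · simp [q]
      · simpa using h2
    refine Submodule.mem_span_singleton.2 ⟨q, ?_⟩
    rw [h3]
    simp
  · rw [Submodule.span_singleton_le_iff_mem]
    exact ⟨W, (hmem W).2 (by rw [hW]; rfl), by simp⟩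

/-- In a chart where the three curves have the `2`-jets `y = c x²`, the cross-ratio of the Legendrian
lines and of the fibre is that of the coefficients `c` and `∞`. -/
theorem isCrossRatio_legendrianLine_iff (hxx : px (px f) 0 = 0) {v : R3} {γ₁ γ₂ γ₃ : ℝ → R3}
    {c₁ c₂ c₃ : ℝ} (h₁ : IsCurveOn S g γ₁) (h₂ : IsCurveOn S g γ₂) (h₃ : IsCurveOn S g γ₃)
    (j₁ : HasJet A γ₁ c₁) (j₂ : HasJet A γ₂ c₂) (j₃ : HasJet A γ₃ c₃)
    (v₁ : deriv γ₁ 0 = v) (v₂ : deriv γ₂ 0 = v) (v₃ : deriv γ₃ 0 = v) (hc : c₂ ≠ c₃) (ρ : ℝ) :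
    IsCrossRatio (legendrianLine v γ₁) (legendrianLine v γ₂) (legendrianLine v γ₃)
      (fibreLine S g v) ρ ↔ ρ = (c₁ - c₃) / (c₂ - c₃) := by
  obtain ⟨W, hW⟩ := (bijective_fderiv_projMap A h.den_ne).2 ![0, 1, 0]
  obtain ⟨Q, hQ⟩ := (bijective_fderiv_projMap A h.den_ne).2
    (iteratedFDeriv ℝ 2 (projMap A) g (fun _ => v))
  obtain ⟨hm, hv⟩ := h.fderiv_projMap_deriv h₁ j₁
  have k₁ := h.mkQ_iteratedDeriv_two hxx h₁ j₁ hW (by rw [v₁]; exact hQ)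
  have k₂ := h.mkQ_iteratedDeriv_two hxx h₂ j₂ hW (by rw [v₂]; exact hQ)
  have k₃ := h.mkQ_iteratedDeriv_two hxx h₃ j₃ hW (by rw [v₃]; exact hQ)
  rw [v₁] at k₁ hm hv
  rw [v₂] at k₂
  rw [v₃] at k₃
  set m := fderiv ℝ (projMap A) g v 0
  set q := (Submodule.span ℝ {v}).mkQ with hq
  have line : ∀ {γ : ℝ → R3} {c : ℝ}, q (iteratedDeriv 2 γ 0) = -q Q + (2 * c * m ^ 2) • q W →
      legendrianLine v γ = Submodule.span ℝ {(v, -q Q) + (2 * c * m ^ 2) • ((0 : R3), q W)} := by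
    intro γ c hγ
    rw [legendrianLine, ← hq, hγ]
    simp
  have hv0 : v ≠ 0 := by
    rintro rfl
    exact hm (by simp [m])
  have hW0 : q W ≠ 0 := by
    intro h0
    obtain ⟨k, hk⟩ := Submodule.mem_span_singleton.1 ((Submodule.Quotient.mk_eq_zero _).1 h0)
    have h1 := congrFun (congrArg (fderiv ℝ (projMap A) g) hk) 1
    rw [map_smul, hv, hW] at h1
    simp at h1
  have hli : LinearIndependent ℝ ![((v, -q Q) : R3 × (R3 ⧸ Submodule.span ℝ {v})), (0, q W)] := by
    rw [LinearIndependent.pair_iff]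
    intro s t hst
    have h1 : s • v = 0 := by simpa using congrArg Prod.fst hst
    have h2 := congrArg Prod.snd hst
    have hs : s = 0 := (smul_eq_zero.1 h1).resolve_right hv0
    subst hs
    refine ⟨rfl, (smul_eq_zero.1 ?_).resolve_right hW0⟩
    simpa using h2
  have hm2 : (2 : ℝ) * m ^ 2 ≠ 0 := mul_ne_zero two_ne_zero (pow_ne_zero 2 hm)
  rw [line k₁, line k₂, line k₃, h.fibreLine_eq hm hv hW, isCrossRatio_span_iff hli]
  · have : (2 * c₁ * m ^ 2 - 2 * c₃ * m ^ 2) / (2 * c₂ * m ^ 2 - 2 * c₃ * m ^ 2) =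
        (c₁ - c₃) / (c₂ - c₃) := by
      rw [← mul_div_mul_left (c₁ - c₃) (c₂ - c₃) hm2]
      ring_nf
    rw [this]
  · intro he
    apply hc
    apply mul_left_cancel₀ hm2
    linear_combination he

end IsGraphChart

/-! ### The two-jets of the three curves -/

theorem IsArc.isCurveOn {C : Set R3} (hC : C ⊆ S) {γ : ℝ → R3} (h : IsArc C g γ) :
    IsCurveOn S g γ :=
  ⟨h.1, h.2.1, h.eventually_mem.mono fun _ ht => hC ht⟩

theorem IsArc.comp_mul {C : Set R3} {γ : ℝ → R3} (h : IsArc C g γ) {k : ℝ} (hk : k ≠ 0) :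
    IsArc C g (fun t => γ (k * t)) ∧ deriv (fun t => γ (k * t)) 0 = k • deriv γ 0 := by
  obtain ⟨hs, h0, hd, hev⟩ := h
  have hl : SmoothNear (fun t : ℝ => k * t) 0 := ContDiff.smoothNear (by fun_prop) 0
  have hd' : deriv (fun t => γ (k * t)) 0 = k • deriv γ 0 := by
    rw [deriv_comp_mul_left, mul_zero]
  refine ⟨⟨hs.comp_of_eq hl (by simp), by simpa using h0, ?_, ?_⟩, hd'⟩
  · rw [hd']
    exact smul_ne_zero hk hd
  · have hT : Tendsto (fun ε : ℝ => |k| * ε) (𝓝[>] 0) (𝓝[>] 0) := by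
      refine tendsto_nhdsWithin_of_tendsto_nhds_of_eventually_within _ ?_ ?_
      · have : Continuous fun ε : ℝ => |k| * ε := by fun_prop
        exact (this.tendsto' 0 0 (by simp)).mono_left nhdsWithin_le_nhds
      · filter_upwards [self_mem_nhdsWithin] with ε hε
        exact mul_pos (abs_pos.2 hk) hε
    filter_upwards [hT.eventually hev] with ε hε
    have hset : (fun t => γ (k * t)) '' Set.Ioo (-ε) ε = γ '' Set.Ioo (-(|k| * ε)) (|k| * ε) := by
      have hI : ∀ t, t ∈ Set.Ioo (-ε) ε ↔ k * t ∈ Set.Ioo (-(|k| * ε)) (|k| * ε) := by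
        intro t
        rw [Set.mem_Ioo, Set.mem_Ioo, ← abs_lt, ← abs_lt, abs_mul,
          mul_lt_mul_iff_right₀ (abs_pos.2 hk)]
      ext p
      constructor
      · rintro ⟨t, ht, rfl⟩
        exact ⟨k * t, (hI t).1 ht, rfl⟩
      · rintro ⟨t, ht, rfl⟩
        refine ⟨k⁻¹ * t, (hI _).2 ?_, ?_⟩ <;> simp only [mul_inv_cancel_left₀ hk]
        exact ht
    rw [hset]
    exact hε

theorem IsConodalArc.exists_isArc {γ : ℝ → R3} (h : IsConodalArc S g γ) {V : Set R3}
    (hV : V ∈ 𝓝 g) : ∃ U ⊆ V, U ∈ 𝓝 g ∧ IsArc (conodalCurve S U) g γ := by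
  obtain ⟨s, hs, hs'⟩ := eventually_smallSets.1 h
  exact ⟨s ∩ V, Set.inter_subset_right, inter_mem hs hV,
    hs' _ Set.inter_subset_left (inter_mem hs hV)⟩

theorem IsParabolicArc.isCurveOn {γ : ℝ → R3} (h : IsParabolicArc S g γ) : IsCurveOn S g γ :=
  IsArc.isCurveOn (fun _ hp => hp.1) h

theorem IsFlecnodalArc.isCurveOn {γ : ℝ → R3} (h : IsFlecnodalArc S g γ) : IsCurveOn S g γ :=
  IsArc.isCurveOn (fun _ hp => hp.1) h

theorem IsConodalArc.isCurveOn {γ : ℝ → R3} (h : IsConodalArc S g γ) : IsCurveOn S g γ := by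
  obtain ⟨U, -, -, hU⟩ := h.exists_isArc univ_mem
  exact IsArc.isCurveOn (fun _ hp => hp.1) hU

theorem IsConodalArc.comp_mul {γ : ℝ → R3} (h : IsConodalArc S g γ) {k : ℝ} (hk : k ≠ 0) :
    IsConodalArc S g (fun t => γ (k * t)) ∧ deriv (fun t => γ (k * t)) 0 = k • deriv γ 0 := by
  obtain ⟨U, -, -, hU⟩ := h.exists_isArc univ_mem
  exact ⟨h.mono fun U hU hUg => ((hU hUg).comp_mul hk).1, (hU.comp_mul hk).2⟩

namespace IsGraphChart

variable {r : ℝ} (h : IsGraphChart S g A f) (hj : IsNormalJet f r)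
include h hj

theorem hasJet_of_isParabolicArc {γ : ℝ → R3} (hγ : IsParabolicArc S g γ) :
    HasJet A γ (3 * r - 2) := by
  obtain ⟨γ₀, π, hl, hc⟩ := h.exists_parabolic_arc hj
  exact hl.hasJet h.den_ne hc hγ

theorem hasJet_of_isFlecnodalArc {γ : ℝ → R3} (hγ : IsFlecnodalArc S g γ) :
    HasJet A γ (r * (2 * r - 1)) := by
  obtain ⟨γ₀, π, hl, hc⟩ := h.exists_flecnodal_arc hj
  exact hl.hasJet h.den_ne hc hγ

/-- The conodal curve is the image, in the parameters of the swallowtail, of the double points of the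
swallowtail; its jet is read off from that of the swallowtail chart. -/
theorem conodal_jet (hsw : IsDualSwallowtail S g) : r ≠ 1 ∧
    (∃ γ, IsConodalArc S g γ) ∧ ∀ γ, IsConodalArc S g γ → HasJet A γ r := by
  obtain ⟨ξ, κ, hκ⟩ := h.exists_swallowtailChart hsw
  obtain ⟨π, V, hV, harc⟩ := h.exists_conodal_arc hκ
  obtain ⟨-, h1, hx, hy, hyy⟩ := hκ.jets hj.isGodronJet one_ne_zero h.smooth h.px_zero h.py_zero
    h.zero
  have hξ := hκ.smooth_curve (-2)
  have hξ0 := hκ.curve_zero (-2)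
  have hjet : HasJet A (fun t => graphParam A f (ξ (t, -2 * t ^ 2))) r := by
    refine (h.hasJet_graphParam hξ.fst hξ.snd (congrArg Prod.fst hξ0)
      (congrArg Prod.snd hξ0)).2 ⟨hx, hy, ?_⟩
    linarith
  refine ⟨?_, ⟨_, eventually_smallSets.2 ⟨V, hV, fun U hU hUg => (harc U hU hUg).isArc⟩⟩, ?_⟩
  · rintro rfl
    norm_num at h1
  · intro γ hγ
    obtain ⟨U, hUV, hUg, hU⟩ := hγ.exists_isArc hV
    exact (harc U hUV hUg).hasJet h.den_ne hjet hU

theorem exists_isParabolicArc : ∃ γ, IsParabolicArc S g γ := by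
  obtain ⟨γ, π, hl, -⟩ := h.exists_parabolic_arc hj
  exact ⟨γ, hl.isArc⟩

theorem exists_isFlecnodalArc : ∃ γ, IsFlecnodalArc S g γ := by
  obtain ⟨γ, π, hl, -⟩ := h.exists_flecnodal_arc hj
  exact ⟨γ, hl.isArc⟩

/-- The cr-invariant is the coefficient of `x⁴ / 2` in the normal form. -/
theorem isCrInvariant_iff (hsw : IsDualSwallowtail S g) (ρ : ℝ) : IsCrInvariant S g ρ ↔ ρ = r := by
  obtain ⟨hr, ⟨γD, hD⟩, jD⟩ := h.conodal_jet hj hsw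
  have hne : 3 * r - 2 ≠ r := fun h0 => hr (by linarith)
  have hval : (r * (2 * r - 1) - r) / (3 * r - 2 - r) = r := by
    rw [div_eq_iff (sub_ne_zero.2 hne)]
    ring
  constructor
  · rintro ⟨v, γF, γP, γD, hF, hP, hD, vF, vP, vD, hcr⟩
    rw [h.isCrossRatio_legendrianLine_iff hj.xx hF.isCurveOn hP.isCurveOn hD.isCurveOn
      (h.hasJet_of_isFlecnodalArc hj hF) (h.hasJet_of_isParabolicArc hj hP) (jD _ hD) vF vP vD hne,
      hval] at hcr
    exact hcr
  · rintro rfl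
    obtain ⟨γP, hP⟩ := h.exists_isParabolicArc hj
    obtain ⟨γF, hF⟩ := h.exists_isFlecnodalArc hj
    obtain ⟨e, he⟩ := (bijective_fderiv_projMap A h.den_ne).2 ![1, 0, 0]
    -- all three velocities are multiples of the asymptotic vector `e`
    have hvel : ∀ {γ : ℝ → R3} {c : ℝ}, IsCurveOn S g γ → HasJet A γ c →
        ∃ k : ℝ, k ≠ 0 ∧ k • deriv γ 0 = e := by
      intro γ c hγ hc
      obtain ⟨hm, hv⟩ := h.fderiv_projMap_deriv hγ hc
      refine ⟨_, inv_ne_zero hm, (bijective_fderiv_projMap A h.den_ne).1 ?_⟩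
      rw [map_smul, hv, he, smul_smul, Pi.smul_apply]
      simp [hm]
    obtain ⟨kF, kF0, hkF⟩ := hvel hF.isCurveOn (h.hasJet_of_isFlecnodalArc hj hF)
    obtain ⟨kP, kP0, hkP⟩ := hvel hP.isCurveOn (h.hasJet_of_isParabolicArc hj hP)
    obtain ⟨kD, kD0, hkD⟩ := hvel hD.isCurveOn (jD _ hD)
    obtain ⟨hF', vF⟩ := IsArc.comp_mul hF kF0
    obtain ⟨hP', vP⟩ := IsArc.comp_mul hP kP0
    obtain ⟨hD', vD⟩ := hD.comp_mul kD0
    rw [hkF] at vF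
    rw [hkP] at vP
    rw [hkD] at vD
    refine ⟨e, _, _, _, hF', hP', hD', vF, vP, vD, ?_⟩
    rw [h.isCrossRatio_legendrianLine_iff hj.xx (IsFlecnodalArc.isCurveOn hF')
      (IsParabolicArc.isCurveOn hP') hD'.isCurveOn (h.hasJet_of_isFlecnodalArc hj hF')
      (h.hasJet_of_isParabolicArc hj hP') (jD _ hD') vF vP vD hne, hval]

/-- The asymptotic line is the line `y = 0` of the normal form. -/
theorem hasJet_of_isAsymptotic {w : R3} (hw : IsAsymptotic S g w) :
    HasJet A (fun t : ℝ => g + t • w) 0 := by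
  obtain ⟨a, b, hab, hQ, he⟩ := (h.isGraphPoint.isAsymptotic_iff w).1
    (by rw [h.graphParam_zero]; exact hw)
  rw [h.graphParam_zero] at he
  have hb : b = 0 := by simpa [secondForm, hj.xx, hj.yx, hj.yy] using hQ
  have ha : a ≠ 0 := hab.resolve_right (not_not.2 hb)
  have hd := h.den_ne
  set d := A ![g 0, g 1, g 2, 1] 3 with hdd
  have hl : SmoothNear (fun t : ℝ => g + t • w) 0 := ContDiff.smoothNear (by fun_prop) 0
  have hs : SmoothNear (fun t : ℝ => projMap A (g + t • w)) 0 :=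
    (smoothNear_projMap A h.den_ne).comp_of_eq hl (by simp)
  have hy : (fun t : ℝ => projMap A (g + t • w) 1) =ᶠ[𝓝 0] fun _ => 0 := by
    have hc : ContinuousAt (fun t : ℝ => d + t * A ![w 0, w 1, w 2, 0] 3) 0 := by fun_prop
    filter_upwards [hc.eventually_ne (by simpa using hd)] with t ht
    rw [projMap_line A hd w t ht, h.map_base, he, hb]
    simp
  have hx : deriv (fun t : ℝ => projMap A (g + t • w) 0) 0 = d⁻¹ * a := by
    have h1 : HasDerivAt (fun t : ℝ => g + t • w) w 0 := by
      simpa using ((hasDerivAt_id (0 : ℝ)).smul_const w).const_add g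
    have h2 : HasFDerivAt (projMap A) (fderiv ℝ (projMap A) g) (g + (0 : ℝ) • w) := by
      simpa using (smoothNear_projMap A h.den_ne).differentiableAt.hasFDerivAt
    rw [← deriv_apply hs]
    refine (congrFun (h2.comp_hasDerivAt (0 : ℝ) h1).deriv 0).trans ?_
    rw [fderiv_projMap A hd, he]
    simp [hdd]
  refine ⟨by simp [h.map_base], by simp [h.map_base], ?_, ?_, ?_⟩
  · rw [hx]
    exact mul_ne_zero (inv_ne_zero hd) ha
  · rw [hy.deriv_eq, deriv_const]
  · rw [(iteratedDeriv_congr_nhds hy 2).self_of_nhds]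
    simp

end IsGraphChart

end

/-! ### Simple godrons with a given invariant -/

theorem isNormalJet_normalPoly (r : ℝ) : IsNormalJet (normalPoly r) r := by
  have j := congrFun (weightedJet_normalPoly r)
  exact ⟨j 3, j 4, j 5, j 6, j 7, j 8⟩

theorem IsGraphChart.isGodron {S : Set R3} {g : R3} {A : (Fin 4 → ℝ) ≃ₗ[ℝ] (Fin 4 → ℝ)}
    {f : ℝ × ℝ → ℝ} {r : ℝ} (h : IsGraphChart S g A f) (hj : IsNormalJet f r) :
    IsGodron S g := by
  obtain ⟨γ, π, hl, hc⟩ := h.exists_parabolic_arc hj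
  have hγ : IsParabolicArc S g γ := hl.isArc
  refine ⟨by rw [← hl.base]; exact (IsArc.eventually_mem hγ).self_of_nhds, γ, hγ, ?_⟩
  obtain ⟨hm, hv⟩ := h.fderiv_projMap_deriv hγ.isCurveOn hc
  set m := fderiv ℝ (projMap A) g (deriv γ 0) 0
  have hd := h.den_ne
  have he := fderiv_projMap A h.den_ne (deriv γ 0)
  have := (h.isGraphPoint.isAsymptotic_iff (deriv γ 0)).2
    ⟨A ![g 0, g 1, g 2, 1] 3 * m, 0, Or.inl (mul_ne_zero hd hm), by simp [secondForm, hj.xx], by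
      rw [h.graphParam_zero, h.px_zero, h.py_zero]
      rw [hv] at he
      rw [← inv_smul_eq_iff₀ (inv_ne_zero hd), inv_inv] at he
      rw [← he]
      ext i
      fin_cases i <;> simp⟩
  rwa [h.graphParam_zero] at this

/-- The graph of `z = y²/2 - x² y + r x⁴/2`. -/
def normalGraph (r : ℝ) : Set R3 := {p | p 2 = normalPoly r (p 0, p 1)}

theorem isSmoothSurface_normalGraph (r : ℝ) : IsSmoothSurface (normalGraph r) := by
  intro q hq
  have hP : ContDiff ℝ ∞ fun p : R3 => normalPoly r (p 0, p 1) :=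
    (contDiff_normalPoly r).comp (by fun_prop : ContDiff ℝ ∞ fun p : R3 => (p 0, p 1))
  have hG : ContDiff ℝ ∞ fun p : R3 => p 2 - normalPoly r (p 0, p 1) :=
    (by fun_prop : ContDiff ℝ ∞ fun p : R3 => p 2).sub hP
  refine ⟨fun p => p 2 - normalPoly r (p 0, p 1), hq, hG.smoothNear q, fun h0 => ?_,
    Eventually.of_forall fun p => sub_eq_zero.symm⟩
  have hl : HasDerivAt (fun t : ℝ => q + t • (Pi.single 2 1 : R3)) (Pi.single 2 1) 0 := by
    simpa using ((hasDerivAt_id (0 : ℝ)).smul_const (Pi.single 2 1 : R3)).const_add q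
  have h1 : HasFDerivAt (fun p : R3 => p 2 - normalPoly r (p 0, p 1)) (0 : R3 →L[ℝ] ℝ)
      (q + (0 : ℝ) • (Pi.single 2 1 : R3)) := by
    rw [← h0]
    simpa using (hG.smoothNear q).differentiableAt.hasFDerivAt
  have h2 := h1.comp_hasDerivAt (0 : ℝ) hl
  have h3 : HasDerivAt (fun t : ℝ => q 2 + t - normalPoly r (q 0, q 1)) 1 0 :=
    ((hasDerivAt_id (0 : ℝ)).const_add (q 2)).sub_const _
  have h4 : ((fun p : R3 => p 2 - normalPoly r (p 0, p 1)) ∘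
      fun t : ℝ => q + t • (Pi.single 2 1 : R3)) = fun t => q 2 + t - normalPoly r (q 0, q 1) := by
    funext t
    simp
  rw [h4] at h2
  simpa using h2.unique h3

theorem isGraphChart_normalGraph (r : ℝ) :
    IsGraphChart (normalGraph r) 0 (LinearEquiv.refl ℝ _) (normalPoly r) := by
  have hid : ∀ p : R3, projMap (LinearEquiv.refl ℝ _) p = p := by
    intro p
    ext i
    fin_cases i <;> simp [projMap]
  refine ⟨by simp, hid 0, (contDiff_normalPoly r).smoothNear 0, by simp [normalPoly],
    by simp [px_normalPoly], by simp [py_normalPoly], Eventually.of_forall fun p => ?_⟩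
  rw [hid]
  rfl

/-- In the coordinates `x` and `p = ∂f/∂y = y - x²`, the Legendre map of the normal form is
`(-2 x p + 2 (r - 1) x³, p, -p²/2 + x² p - 3 (r - 1) x⁴ / 2)`, a standard swallowtail up to
scalings, if `r ≠ 1`. -/
theorem isSwallowtailChart_normalPoly {r : ℝ} (hr : r ≠ 1) :
    IsSwallowtailChart (normalPoly r) (fun u => (u.1, u.2 / (-2 / (r - 1)) + u.1 ^ 2))
      (fun τ => ![(-2 / (r - 1)) * τ 1, (-2 / (r - 1)) * τ 0,
        (-2 / (r - 1)) * (τ 2 + τ 1 ^ 2 / 2)]) := by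
  have hr' : r - 1 ≠ 0 := sub_ne_zero.2 hr
  obtain ⟨α, hα, hα0⟩ : ∃ α, α = -2 / (r - 1) ∧ α ≠ 0 :=
    ⟨_, rfl, div_ne_zero (by norm_num) hr'⟩
  have hαr : α * (r - 1) = -2 := by rw [hα]; field_simp
  rw [← hα]
  have sξ : ContDiff ℝ ∞ fun u : ℝ × ℝ => (u.1, u.2 / α + u.1 ^ 2) := by fun_prop
  have sη : ContDiff ℝ ∞ fun v : ℝ × ℝ => (v.1, α * (v.2 - v.1 ^ 2)) := by fun_prop
  have sκ : ContDiff ℝ ∞ fun τ : R3 => (![α * τ 1, α * τ 0, α * (τ 2 + τ 1 ^ 2 / 2)] : R3) := by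
    refine contDiff_pi.2 fun i => ?_
    fin_cases i
    · change ContDiff ℝ ∞ fun τ : R3 => α * τ 1
      fun_prop
    · change ContDiff ℝ ∞ fun τ : R3 => α * τ 0
      fun_prop
    · change ContDiff ℝ ∞ fun τ : R3 => α * (τ 2 + τ 1 ^ 2 / 2)
      fun_prop
  have sμ : ContDiff ℝ ∞ fun σ : R3 => (![σ 1 / α, σ 0 / α, σ 2 / α - (σ 0 / α) ^ 2 / 2] : R3) := by
    refine contDiff_pi.2 fun i => ?_
    fin_cases i
    · change ContDiff ℝ ∞ fun σ : R3 => σ 1 / α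
      fun_prop
    · change ContDiff ℝ ∞ fun σ : R3 => σ 0 / α
      fun_prop
    · change ContDiff ℝ ∞ fun σ : R3 => σ 2 / α - (σ 0 / α) ^ 2 / 2
      fun_prop
  -- both changes of variables have explicit global inverses
  have bij : ∀ {E : Type} [NormedAddCommGroup E] [NormedSpace ℝ E] [FiniteDimensional ℝ E]
      {F G : E → E}, ContDiff ℝ ∞ F → ContDiff ℝ ∞ G → (∀ v, G (F v) = v) →
      Function.Bijective (fderiv ℝ F 0) := by
    intro E _ _ _ F G hF hG hGF
    refine bijective_of_injective _ fun v hv => ?_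
    have := fderiv_leftInverse (hF.smoothNear 0) (hG.smoothNear _) (Eventually.of_forall hGF) v
    rw [← this, hv, map_zero]
  refine ⟨sξ.smoothNear 0, by simp, bij sξ sη fun v => ?_, sκ.smoothNear 0,
    bij sκ sμ fun τ => ?_, Eventually.of_forall fun u => ?_⟩
  · ext <;> simp; field_simp
  · ext i
    fin_cases i
    · simp; field_simp
    · simp; field_simp
    · simp; field_simp; ring
  · obtain ⟨x, y⟩ := u
    obtain ⟨p, rfl⟩ : ∃ p, y = α * p := ⟨y / α, by field_simp⟩
    rw [legendreMap, px_normalPoly, py_normalPoly]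
    simp only [mul_div_cancel_left₀ p hα0]
    ext i
    fin_cases i
    · simp [standardSwallowtail]
    · simp [standardSwallowtail]
      linear_combination 2 * x ^ 3 * hαr
    · simp [standardSwallowtail, normalPoly]
      linear_combination (-3 / 2 * x ^ 4) * hαr

theorem isSimpleGodron_normalGraph {r : ℝ} (hr : r ≠ 1) : IsSimpleGodron (normalGraph r) 0 :=
  ⟨(isGraphChart_normalGraph r).isGodron (isNormalJet_normalPoly r),
    (isGraphChart_normalGraph r).isDualSwallowtail (isSwallowtailChart_normalPoly hr)⟩

/-! ### The configurations of the canonical coefficients -/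

/-- The position of `ρ` with respect to `-1/2, 0, 1/2, 2/3, 1` determines the order of the canonical
coefficients, because of the factorizations
`c_F - c_P = 2 (ρ - 1)²`, `c_F - c_D = 2 ρ (ρ - 1)`, `c_P - c_D = 2 (ρ - 1)` and
`c_F - 1 = (2 ρ + 1) (ρ - 1)`. -/
theorem canonical_configurations {ρ cF cP cD : ℝ} (hρ : ρ ≠ 1) (hF : cF = ρ * (2 * ρ - 1))
    (hP : cP = 3 * ρ - 2) (hD : cD = ρ) :
    (1 < ρ ↔ (1 < cD ∧ cD < cP ∧ cP < cF)) ∧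
    ((2 / 3 < ρ ∧ ρ < 1) ↔ (0 < cP ∧ cP < cF ∧ cF < cD ∧ cD < 1)) ∧
    ((1 / 2 < ρ ∧ ρ < 2 / 3) ↔ (cP < 0 ∧ 0 < cF ∧ cF < cD ∧ cD < 1)) ∧
    ((0 < ρ ∧ ρ < 1 / 2) ↔ (cP < cF ∧ cF < 0 ∧ 0 < cD ∧ cD < 1)) ∧
    ((-1 / 2 < ρ ∧ ρ < 0) ↔ (cP < cD ∧ cD < 0 ∧ 0 < cF ∧ cF < 1)) ∧
    (ρ < -1 / 2 ↔ (cP < cD ∧ cD < 0 ∧ 1 < cF)) ∧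
    ([0, 1, cF, cP, cD].Nodup →
      (1 < cD ∧ cD < cP ∧ cP < cF) ∨
      (0 < cP ∧ cP < cF ∧ cF < cD ∧ cD < 1) ∨
      (cP < 0 ∧ 0 < cF ∧ cF < cD ∧ cD < 1) ∨
      (cP < cF ∧ cF < 0 ∧ 0 < cD ∧ cD < 1) ∨
      (cP < cD ∧ cD < 0 ∧ 0 < cF ∧ cF < 1) ∨
      (cP < cD ∧ cD < 0 ∧ 1 < cF)) := by
  subst hF hP hD
  have hPF : 3 * cD - 2 < cD * (2 * cD - 1) ↔ True := by
    have : 0 < (cD - 1) ^ 2 := by have := sub_ne_zero.2 hρ; positivity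
    exact iff_true_intro (by linarith)
  have hFD : cD * (2 * cD - 1) < cD ↔ 0 < cD ∧ cD < 1 := by
    constructor
    · intro h
      constructor <;> nlinarith
    · rintro ⟨h1, h2⟩
      nlinarith
  have hF0 : cD * (2 * cD - 1) < 0 ↔ 0 < cD ∧ cD < 1 / 2 := by
    constructor
    · intro h
      constructor <;> nlinarith
    · rintro ⟨h1, h2⟩
      nlinarith
  have hF0' : 0 < cD * (2 * cD - 1) ↔ cD < 0 ∨ 1 / 2 < cD := by
    constructor
    · intro h
      by_contra! hc
      nlinarith [mul_nonneg hc.1 (sub_nonneg.2 hc.2)]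
    · rintro (h1 | h1) <;> nlinarith
  have hF1 : cD * (2 * cD - 1) < 1 ↔ -1 / 2 < cD ∧ cD < 1 := by
    constructor
    · intro h
      constructor <;> nlinarith
    · rintro ⟨h1, h2⟩
      nlinarith
  have hF1' : 1 < cD * (2 * cD - 1) ↔ cD < -1 / 2 ∨ 1 < cD := by
    constructor
    · intro h
      by_contra! hc
      nlinarith [mul_nonneg (sub_nonneg.2 hc.1) (sub_nonneg.2 hc.2)]
    · rintro (h1 | h1) <;> nlinarith
  rw [hPF, hFD, hF0, hF0', hF1, hF1']
  refine ⟨?_, ?_, ?_, ?_, ?_, ?_, fun hnd => ?_⟩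
  · grind
  · grind
  · grind
  · grind
  · grind
  · grind
  · have n0 : cD ≠ 0 := by rintro rfl; simp at hnd
    have n1 : cD ≠ 2 / 3 := by rintro rfl; norm_num at hnd
    have n2 : cD ≠ 1 / 2 := by rintro rfl; norm_num at hnd
    have n3 : cD ≠ -1 / 2 := by rintro rfl; norm_num at hnd
    clear hnd hPF hFD hF0 hF0' hF1 hF1'
    grind

theorem theorem5 :
    (∀ (S : Set R3) (g : R3), IsSmoothSurface S → IsSimpleGodron S g →
      ∃ ρ : ℝ, (∀ r : ℝ, IsCrInvariant S g r ↔ r = ρ) ∧ ρ ≠ 1 ∧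
        (∃ A, IsNormalForm S g A ρ) ∧
        ∀ A r, IsNormalForm S g A r →
          r = ρ ∧
          (∀ w, IsAsymptotic S g w → HasJet A (fun t : ℝ => g + t • w) 0) ∧
          (∀ s : ℝ, IsSeparatingJet S g A s ↔ s = 1) ∧
          ∃ cF cP cD : ℝ,
            (∀ c : ℝ, (∃ γ, IsFlecnodalArc S g γ ∧ HasJet A γ c) ↔ c = cF) ∧
            (∀ c : ℝ, (∃ γ, IsParabolicArc S g γ ∧ HasJet A γ c) ↔ c = cP) ∧
            (∀ c : ℝ, (∃ γ, IsConodalArc S g γ ∧ HasJet A γ c) ↔ c = cD) ∧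
            cF = ρ * (2 * ρ - 1) ∧ cP = 3 * ρ - 2 ∧ cD = ρ ∧
            (1 < ρ ↔ (1 < cD ∧ cD < cP ∧ cP < cF)) ∧
            ((2 / 3 < ρ ∧ ρ < 1) ↔ (0 < cP ∧ cP < cF ∧ cF < cD ∧ cD < 1)) ∧
            ((1 / 2 < ρ ∧ ρ < 2 / 3) ↔ (cP < 0 ∧ 0 < cF ∧ cF < cD ∧ cD < 1)) ∧
            ((0 < ρ ∧ ρ < 1 / 2) ↔ (cP < cF ∧ cF < 0 ∧ 0 < cD ∧ cD < 1)) ∧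
            ((-1 / 2 < ρ ∧ ρ < 0) ↔ (cP < cD ∧ cD < 0 ∧ 0 < cF ∧ cF < 1)) ∧
            (ρ < -1 / 2 ↔ (cP < cD ∧ cD < 0 ∧ 1 < cF)) ∧
            ([0, 1, cF, cP, cD].Nodup →
              (1 < cD ∧ cD < cP ∧ cP < cF) ∨
              (0 < cP ∧ cP < cF ∧ cF < cD ∧ cD < 1) ∨
              (cP < 0 ∧ 0 < cF ∧ cF < cD ∧ cD < 1) ∨
              (cP < cF ∧ cF < 0 ∧ 0 < cD ∧ cD < 1) ∨
              (cP < cD ∧ cD < 0 ∧ 0 < cF ∧ cF < 1) ∨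
              (cP < cD ∧ cD < 0 ∧ 1 < cF))) ∧
    (∀ ρ : ℝ, ρ ≠ 1 → ∃ (S : Set R3) (g : R3),
      IsSmoothSurface S ∧ IsSimpleGodron S g ∧ IsCrInvariant S g ρ) := by
  constructor
  · intro S g hS hg
    obtain ⟨A₀, f₀, ρ, h₀, j₀⟩ := hg.exists_isNormalJet hS
    have hcr := h₀.isCrInvariant_iff j₀ hg.2
    have hρ := (h₀.conodal_jet j₀ hg.2).1
    refine ⟨ρ, hcr, hρ, ⟨A₀, isNormalForm_iff.2 ⟨f₀, h₀, j₀⟩⟩, fun A r hAr => ?_⟩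
    obtain ⟨f, h, hj⟩ := isNormalForm_iff.1 hAr
    -- the cr-invariant does not depend on the chart, hence neither does the coefficient
    obtain rfl : r = ρ := (hcr r).1 ((h.isCrInvariant_iff hj hg.2 r).2 rfl)
    obtain ⟨γP, hP⟩ := h.exists_isParabolicArc hj
    obtain ⟨γF, hF⟩ := h.exists_isFlecnodalArc hj
    obtain ⟨-, ⟨γD, hD⟩, jD⟩ := h.conodal_jet hj hg.2
    refine ⟨rfl, fun w hw => h.hasJet_of_isAsymptotic hj hw, h.isSeparatingJet_iff hj hρ,
      r * (2 * r - 1), 3 * r - 2, r, fun c => ⟨?_, ?_⟩, fun c => ⟨?_, ?_⟩, fun c => ⟨?_, ?_⟩,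
      rfl, rfl, rfl, canonical_configurations hρ rfl rfl rfl⟩
    · rintro ⟨γ, hγ, hc⟩
      exact hc.unique (h.hasJet_of_isFlecnodalArc hj hγ)
    · rintro rfl
      exact ⟨γF, hF, h.hasJet_of_isFlecnodalArc hj hF⟩
    · rintro ⟨γ, hγ, hc⟩
      exact hc.unique (h.hasJet_of_isParabolicArc hj hγ)
    · rintro rfl
      exact ⟨γP, hP, h.hasJet_of_isParabolicArc hj hP⟩
    · rintro ⟨γ, hγ, hc⟩
      exact hc.unique (jD γ hγ)
    · rintro rfl
      exact ⟨γD, hD, jD γD hD⟩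
  · intro ρ hρ
    have hsg := isSimpleGodron_normalGraph hρ
    exact ⟨normalGraph ρ, 0, isSmoothSurface_normalGraph ρ, hsg,
      ((isGraphChart_normalGraph ρ).isCrInvariant_iff (isNormalJet_normalPoly ρ) hsg.2 ρ).2 rfl⟩
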